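/- Let $\mathbb H=\{\tau\in\mathbb C:\operatorname{Im}\tau>0\}$ and \[ \vartheta_4(z;\tau)=\sum_{n\in\mathbb Z}(-1)^n e^{\pi i n^2\tau+2inz},\qquad \vartheta_3(z;\tau)=\vartheta_4(z+\tfrac{\pi}{2};\tau), \] \[ \vartheta_1(z;\tau)=-i\,e^{iz+\frac14\pi i\tau}\,\vartheta_4(z+\tfrac{\pi}{2}\tau;\tau),\qquad \vartheta_2(z;\tau)=\vartheta_1(z+\tfrac{\pi}{2};\tau) \] for $(z,\tau)\in\mathbb C\times\mathbb H$. The thetanulls are the functions $\vartheta_j(0;\tau)$, $j=2,3,4$. Put $\delta=\frac{1}{\pi i}\frac{\partial}{\partial\tau}$ and $\tilde\vartheta_1(z;\tau)=\vartheta_1(\pi z/2;\tau)$. Let $\Lambda_\tau=2\mathbb Z+2\tau\mathbb Z$, let $\wp(z;\tau)$ be the Weierstrass function of the lattice $\Lambda_\tau$, and let \[ \zeta(z;\tau)=\frac1z+\sum_{0\ne l\in\Lambda_\tau}\Bigl(\frac1{z-l}+\frac1l+\frac z{l^2}\Bigr). \] The polar locus of $\zeta$ (or of $\wp$) is the set of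 $(z,\tau)\in\mathbb C\times\mathbb H$ such that $z$ is a pole of $\zeta(\cdot;\tau)$ (or of $\wp(\cdot;\tau)$). A tuple $\phi=(\phi_1,\dots,\phi_\ell)$ of holomorphic functions on an open set $U\subset\mathbb C^n$ satisfies a rational Noetherian system without poles on $U$ if there are polynomials $Q_{i,j},R_{i,j}\in\mathbb C[x_1,\dots,x_n,y_1,\dots,y_\ell]$ such that, for all $i,j$ and all $x\in U$, $R_{i,j}(x,\phi(x))\neq0$ and $\partial\phi_i/\partial x_j=Q_{i,j}(x,\phi)/R_{i,j}(x,\phi)$. A Noetherian chain on a bounded domain $\Omega\subset\mathbb C^n$ is a tuple $\phi$ of functions that are holomorphic on a neighbourhood of $\overline\Omega$ and satisfy $\partial\phi_i/\partial x_j=P_{i,j}(x,\phi)$ on $\Omega$ with polynomials $P_{i,j}$; a Noetherian function on $\Omega$ is a polynomial in $x$ and some Noetherian chain on $\Omega$. Then: 1. For every $\tau\in\mathbb H$, $\partial_z\zeta(z;\tau)=-\wp(z;\tau)$ for $z\notin\Lambda_\tau$, and $\lim_{z\to0}(\zeta(z;\tau)-z^{-1})=0$. 2. The polar loci of $\zeta$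 and of $\wp$ coincide, and they are equal to $\{(z,\tau)\in\mathbb C\times\mathbb H:\tilde\vartheta_1(z;\tau)=0\}$ and to $\{(z,\tau)\in\mathbb C\times\mathbb H: z\in\Lambda_\tau\}$. Denote this set by $\Sigma$. 3. The six functions $\vartheta_j(0;\tau)$, $\delta\vartheta_j(0;\tau)$ ($j=2,3,4$) of $\tau$ satisfy a rational Noetherian system without poles on $\mathbb H$. The eleven functions $\vartheta_j(0;\tau)$, $\delta\vartheta_j(0;\tau)$ ($j=2,3,4$), $\tilde\vartheta_1$, $\zeta$, $\partial_z\zeta=-\wp$, $\partial_z^2\zeta$, $\partial_z^3\zeta$ of $(z,\tau)$ satisfy a rational Noetherian system without poles on $(\mathbb C\times\mathbb H)\setminus\Sigma$. 4. The thetanulls are Noetherian functions (of $\tau$, respectively of $(z,\tau)$) on every domain whose closure is a compact subset of $\mathbb H$, respectively of $\mathbb C\times\mathbb H$. On every domain $\Omega$ whose closure is a compact subset of $(\mathbb C\times\mathbb H)\setminus\Sigma$, the functions $\tilde\vartheta_1(z;\tau)$, $\zeta(z;\tau)$ and $\wp(z;\tau)$ are Noetherian functions of $(z,\tau)$. -/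

import Mathlib

noncomputable section

/-! ### Theta functions -/

/-- `ϑ(z;τ) = ϑ₄(z;τ) = ∑_{n ∈ ℤ} (-1)^n exp(π i n² τ + 2 i n z)`; the series converges for
`Im τ > 0`. -/
def thetaFour (z τ : ℂ) : ℂ :=
  ∑' n : ℤ, (-1 : ℂ) ^ n *
    Complex.exp (Real.pi * Complex.I * (n : ℂ) ^ 2 * τ + 2 * Complex.I * (n : ℂ) * z)

/-- `ϑ₃(z;τ) = ϑ₄(z + π/2;τ)`. -/
def thetaThree (z τ : ℂ) : ℂ := thetaFour (z + Real.pi / 2) τ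

/-- `ϑ₁(z;τ) = -i exp(i z + π i τ / 4) ϑ₄(z + π τ / 2;τ)`. -/
def thetaOne (z τ : ℂ) : ℂ :=
  -Complex.I * Complex.exp (Complex.I * z + Real.pi * Complex.I * τ / 4) *
    thetaFour (z + Real.pi * τ / 2) τ

/-- `ϑ₂(z;τ) = ϑ₁(z + π/2;τ)`. -/
def thetaTwo (z τ : ℂ) : ℂ := thetaOne (z + Real.pi / 2) τ

/-- The thetanulls `ϑ₂(0;τ)`, `ϑ₃(0;τ)`, `ϑ₄(0;τ)`, numbered `0, 1, 2`. -/
def thetaNull : Fin 3 → ℂ → ℂ :=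
  ![fun τ => thetaTwo 0 τ, fun τ => thetaThree 0 τ, fun τ => thetaFour 0 τ]

/-- The derivation `δ = (1 / (π i)) ∂/∂τ`. -/
def deltaDeriv (f : ℂ → ℂ) (τ : ℂ) : ℂ := 1 / (Real.pi * Complex.I) * deriv f τ

/-- `ϑ₁(π z / 2;τ)`. -/
def thetaOneTilde (z τ : ℂ) : ℂ := thetaOne (Real.pi * z / 2) τ

/-! ### Weierstrass functions with periods `2, 2τ` -/

/-- The pair of periods `2, 2τ` (half-periods `1, τ`). -/
def halfPeriodPair (τ : UpperHalfPlane) : PeriodPair where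
  ω₁ := 2
  ω₂ := 2 * (τ : ℂ)
  indep := by
    rw [LinearIndependent.pair_iff]
    intro s t h
    have him := congrArg Complex.im h
    have hre := congrArg Complex.re h
    simp at him hre
    have ht : t = 0 := by
      rcases him with h | h
      · exact h
      · exact absurd h τ.im_pos.ne'
    subst ht
    simpa using hre

/-- `℘(z;τ)`, the Weierstrass function with periods `2, 2τ`. -/
def wpTau (z : ℂ) (τ : UpperHalfPlane) : ℂ := (halfPeriodPair τ).weierstrassP z

/-- The Weierstrass function
`ζ(z;τ) = 1/z + ∑_{l ≠ 0} (1/(z - l) + 1/l + z/l²)`, `l` in the lattice `2ℤ + 2τℤ`.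
In the code `l = 0` is included in the sum: its term is `1/z`, because division by zero gives
zero. -/
def zetaTau (z : ℂ) (τ : UpperHalfPlane) : ℂ :=
  ∑' l : (halfPeriodPair τ).lattice, (1 / (z - (l : ℂ)) + 1 / (l : ℂ) + z / (l : ℂ) ^ 2)

/-! ### Functions of the two variables `x 0 = z`, `x 1 = τ` -/

/-- The domain `ℂ × ℍ`. -/
def planeTimesUpper : Set (Fin 2 → ℂ) := {x | 0 < (x 1).im}

/-- A function on `ℂ × ℍ` as a function on `ℂ²` (only its values on `ℂ × ℍ` matter). -/
def onPlane (f : ℂ → UpperHalfPlane → ℂ) (x : Fin 2 → ℂ) : ℂ :=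
  f (x 0) (UpperHalfPlane.ofComplex (x 1))

/-- The polar locus: all `(z, τ) ∈ ℂ × ℍ` such that `z` is a pole of `f(·;τ)`. -/
def polarLocus (f : ℂ → UpperHalfPlane → ℂ) : Set (Fin 2 → ℂ) :=
  {x | x ∈ planeTimesUpper ∧
    meromorphicOrderAt (fun z => f z (UpperHalfPlane.ofComplex (x 1))) (x 0) < 0}

/-- The thetanulls followed by their `δ`-derivatives, as functions of `x 0 = τ`. -/
def thetaNullChain : Fin 6 → (Fin 1 → ℂ) → ℂ :=
  ![fun x => thetaNull 0 (x 0), fun x => thetaNull 1 (x 0), fun x => thetaNull 2 (x 0),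
    fun x => deltaDeriv (thetaNull 0) (x 0), fun x => deltaDeriv (thetaNull 1) (x 0),
    fun x => deltaDeriv (thetaNull 2) (x 0)]

/-- The thetanulls, their `δ`-derivatives, `ϑ₁(π z / 2;τ)`, and `ζ` with its first three
`z`-derivatives, as functions of `x 0 = z`, `x 1 = τ`. -/
def thetaZetaChain : Fin 11 → (Fin 2 → ℂ) → ℂ :=
  ![fun x => thetaNull 0 (x 1), fun x => thetaNull 1 (x 1), fun x => thetaNull 2 (x 1),
    fun x => deltaDeriv (thetaNull 0) (x 1), fun x => deltaDeriv (thetaNull 1) (x 1),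
    fun x => deltaDeriv (thetaNull 2) (x 1),
    fun x => thetaOneTilde (x 0) (x 1),
    onPlane zetaTau,
    onPlane fun z τ => iteratedDeriv 1 (fun w => zetaTau w τ) z,
    onPlane fun z τ => iteratedDeriv 2 (fun w => zetaTau w τ) z,
    onPlane fun z τ => iteratedDeriv 3 (fun w => zetaTau w τ) z]

/-! ### Noetherian systems -/

/-- The value of `P(x, φ(x))` for a polynomial `P` in the `n + ℓ` variables `x, φ`. -/
def evalChain {n ℓ : ℕ} (P : MvPolynomial (Fin n ⊕ Fin ℓ) ℂ)
    (φ : Fin ℓ → (Fin n → ℂ) → ℂ) (x : Fin n → ℂ) : ℂ :=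
  MvPolynomial.eval (Sum.elim x fun i => φ i x) P

/-- The partial derivative `∂f/∂x_j` at `x`. -/
def partialAt {n : ℕ} (f : (Fin n → ℂ) → ℂ) (j : Fin n) (x : Fin n → ℂ) : ℂ :=
  fderiv ℂ f x (Pi.single j 1)

/-- `φ` is holomorphic on the open set `U` and satisfies there a rational system
`∂φ_i/∂x_j = Q_{i,j}(x, φ) / R_{i,j}(x, φ)` with polynomials `Q_{i,j}`, `R_{i,j}`, none of whose
denominators `R_{i,j}(x, φ(x))` vanishes at a point of `U`. -/
def SatisfiesRationalSystem {n ℓ : ℕ} (U : Set (Fin n → ℂ))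
    (φ : Fin ℓ → (Fin n → ℂ) → ℂ) : Prop :=
  IsOpen U ∧ (∀ i, AnalyticOnNhd ℂ (φ i) U) ∧
    ∃ Q R : Fin ℓ → Fin n → MvPolynomial (Fin n ⊕ Fin ℓ) ℂ,
      ∀ i j, ∀ x ∈ U, evalChain (R i j) φ x ≠ 0 ∧
        partialAt (φ i) j x = evalChain (Q i j) φ x / evalChain (R i j) φ x

/-- `φ` is a (complex) Noetherian chain on the bounded domain `Ω`: it is holomorphic on a
neighbourhood of the closure of `Ω`, and its partial derivatives are polynomials in `x, φ`. -/
def IsNoetherianChain {n ℓ : ℕ} (Ω : Set (Fin n → ℂ))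
    (φ : Fin ℓ → (Fin n → ℂ) → ℂ) : Prop :=
  IsOpen Ω ∧ IsConnected Ω ∧ Bornology.IsBounded Ω ∧
    (∀ i, AnalyticOnNhd ℂ (φ i) (closure Ω)) ∧
    ∃ P : Fin ℓ → Fin n → MvPolynomial (Fin n ⊕ Fin ℓ) ℂ,
      ∀ i j, ∀ x ∈ Ω, partialAt (φ i) j x = evalChain (P i j) φ x

/-- `F` is a Noetherian function on `Ω`: a polynomial in `x` and a Noetherian chain on `Ω`. -/
def IsNoetherianFunction {n : ℕ} (Ω : Set (Fin n → ℂ)) (F : (Fin n → ℂ) → ℂ) : Prop :=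
  ∃ (ℓ : ℕ) (φ : Fin ℓ → (Fin n → ℂ) → ℂ) (P : MvPolynomial (Fin n ⊕ Fin ℓ) ℂ),
    IsNoetherianChain Ω φ ∧ ∀ x ∈ Ω, F x = evalChain P φ x

/-- `Ω` is a domain (open, connected, non-empty) whose closure is compact and contained in `U`. -/
def IsRelCompactDomain {n : ℕ} (U Ω : Set (Fin n → ℂ)) : Prop :=
  IsOpen Ω ∧ IsConnected Ω ∧ IsCompact (closure Ω) ∧ closure Ω ⊆ U

end

open Filter Topology
open scoped Real
open Complex (I exp)

/-!
The entire functions with the quasi-periodicity of `ϑ₁` form a line, because their Fourier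
coefficients satisfy a first-order recursion. Write `ϑ₁` for `ϑ₁(π z / 2; τ)` and `Λ` for
`2ℤ + 2τℤ`. If `h` is elliptic and the zeros of `ϑ₁` compensate its poles, then `h ϑ₁` is such an
entire function, so `h` is constant. Applied to suitable `h`, this shows that the zeros of `ϑ₁` are
simple and equal to `Λ`, and that `ϑ₁' / ϑ₁ = ζ + c(τ) z`.

The even thetas are translates of `ϑ₁` by half periods, up to exponential factors, so their Taylor
coefficients at `0` are polynomials in `c`, `g₂` and the values of `℘` at the half periods. The heat
equation turns the second and fourth of them into `δϑⱼ / ϑⱼ` and `δ²ϑⱼ / ϑⱼ`, and eliminating `c`,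
`g₂` and the values of `℘` leaves a rational system for the thetanulls. Comparing the mixed second
derivatives of `ϑ₁` gives `∂ζ/∂τ`.

On a compact set without poles, adjoining the inverse of a common denominator makes a rational
system polynomial.
-/

/-! ### The Jacobi theta function: joint analyticity and the heat equation -/

theorem summable_smul_of_norm_le_one {ι E : Type*} [NormedAddCommGroup E] [NormedSpace ℂ E]
    [CompleteSpace E] {c : ι → ℂ} {γ : ι → ℝ} {e : ι → E} (hγ : Summable γ)
    (hc : ∀ n, ‖c n‖ ≤ γ n) (he : ∀ n, ‖e n‖ ≤ 1) : Summable fun n => c n • e n :=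
  hγ.of_norm_bounded fun n => by
    rw [norm_smul]
    exact (mul_le_of_le_one_right (norm_nonneg _) (he n)).trans (hc n)

theorem analyticOnNhd_tsum_smul {ι E : Type*} [NormedAddCommGroup E] [NormedSpace ℂ E]
    [CompleteSpace E] {c : ι → ℂ → ℂ} {γ : ι → ℝ} {U : Set ℂ} {e : ι → E} (hU : IsOpen U)
    (hγ : Summable γ) (hd : ∀ n, DifferentiableOn ℂ (c n) U) (hc : ∀ n, ∀ w ∈ U, ‖c n w‖ ≤ γ n)
    (he : ∀ n, ‖e n‖ ≤ 1) : AnalyticOnNhd ℂ (fun w => ∑' n, c n w • e n) U :=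
  (Complex.differentiableOn_tsum_of_summable_norm hγ (fun n => (hd n).smul_const (e n)) hU
    fun n w hw => by
      rw [norm_smul]
      exact (mul_le_of_le_one_right (norm_nonneg _) (he n)).trans (hc n w hw)).analyticOnNhd hU

theorem analyticOnNhd_tsum_mul {ι : Type*} {a b : ι → ℂ → ℂ} {α β : ι → ℝ} {U V : Set ℂ}
    (hU : IsOpen U) (hV : IsOpen V) (hα : Summable α) (hβ : Summable β)
    (ha : ∀ n, DifferentiableOn ℂ (a n) U) (hb : ∀ n, DifferentiableOn ℂ (b n) V)
    (haα : ∀ n, ∀ w ∈ U, ‖a n w‖ ≤ α n) (hbβ : ∀ n, ∀ w ∈ V, ‖b n w‖ ≤ β n) :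
    AnalyticOnNhd ℂ (fun p : ℂ × ℂ => ∑' n, a n p.1 * b n p.2) (U ×ˢ V) := by
  classical
  -- The series is the pairing of a holomorphic function of `p.2` with values in `ℓ¹` and a
  -- holomorphic function of `p.1` with values in its dual.
  let e (n : ι) : lp (fun _ : ι => ℂ) 1 := lp.single 1 n 1
  let δ (n : ι) : lp (fun _ : ι => ℂ) 1 →L[ℂ] ℂ := lp.evalCLM ℂ (fun _ : ι => ℂ) 1 n
  have he n : ‖e n‖ ≤ 1 := by simp [e, lp.norm_single]
  have hδ n : ‖δ n‖ ≤ 1 := LinearMap.mkContinuous_norm_le _ zero_le_one _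
  have hδe n m : δ n (e m) = (Pi.single m 1 : ι → ℂ) n := by
    change (lp.single 1 m (1 : ℂ) : lp (fun _ : ι => ℂ) 1) n = _
    rw [lp.coeFn_single]
  have hcoord {w : ℂ} (hw : w ∈ V) n : δ n (∑' m, b m w • e m) = b n w := by
    rw [(δ n).map_tsum (summable_smul_of_norm_le_one hβ (hbβ · w hw) he),
      tsum_eq_single n fun m hm => by simp [hδe, Pi.single_eq_of_ne' hm]]
    simp [hδe]
  have hpair {p : ℂ × ℂ} (hp : p ∈ U ×ˢ V) :
      (∑' n, a n p.1 • δ n) (∑' n, b n p.2 • e n) = ∑' n, a n p.1 * b n p.2 := by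
    have h := (ContinuousLinearMap.apply ℂ ℂ (∑' m, b m p.2 • e m)).map_tsum
      (summable_smul_of_norm_le_one hα (haα · p.1 hp.1) hδ)
    simpa only [ContinuousLinearMap.apply_apply, smul_apply, smul_eq_mul, hcoord hp.2] using h
  refine AnalyticOnNhd.congr (hU.prod hV) (fun p hp => ?_) fun p => hpair
  have hu : AnalyticAt ℂ (fun q : ℂ × ℂ => ∑' n, a n q.1 • δ n) p :=
    (analyticOnNhd_tsum_smul hU hα ha haα hδ p.1 hp.1).fun_comp analyticAt_fst
  have hv : AnalyticAt ℂ (fun q : ℂ × ℂ => ∑' n, b n q.2 • e n) p :=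
    (analyticOnNhd_tsum_smul hV hβ hb hbβ he p.2 hp.2).fun_comp analyticAt_snd
  exact ((ContinuousLinearMap.id ℂ _).analyticAt_bilinear _).fun_comp (hu.prod hv)

theorem summable_exp_neg_quadratic (S : ℝ) {T : ℝ} (hT : 0 < T) :
    Summable fun n : ℤ => Real.exp (-π * (T * n ^ 2 - 2 * S * |(n : ℝ)|)) := by
  simpa using summable_pow_mul_jacobiTheta₂_term_bound S hT 0

theorem jacobiTheta₂_term_eq_mul (n : ℤ) (z σ τ : ℂ) :
    jacobiTheta₂_term n z τ = jacobiTheta₂_term n z σ * jacobiTheta₂_term n 0 (τ - σ) := by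
  simp only [jacobiTheta₂_term, ← Complex.exp_add]
  ring_nf

theorem differentiable_jacobiTheta₂_term_fst (n : ℤ) (τ : ℂ) :
    Differentiable ℂ fun z => jacobiTheta₂_term n z τ := by
  unfold jacobiTheta₂_term; fun_prop

theorem isOpen_abs_im_lt (S : ℝ) : IsOpen {w : ℂ | |w.im| < S} :=
  isOpen_lt (continuous_abs.comp Complex.continuous_im) continuous_const

theorem analyticAt_jacobiTheta₂ (z : ℂ) {τ : ℂ} (hτ : 0 < τ.im) :
    AnalyticAt ℂ (fun p : ℂ × ℂ => jacobiTheta₂ p.1 p.2) (z, τ) := by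
  obtain ⟨T, hT, hTτ⟩ := exists_between hτ
  obtain ⟨S, hS⟩ := exists_gt |z.im|
  let σ : ℂ := I * (T / 2 : ℝ)
  have hσ : σ.im = T / 2 := by simp [σ]
  have hsum := analyticOnNhd_tsum_mul (U := {w : ℂ | |w.im| < S}) (V := {w : ℂ | T < w.im})
    (a := fun n w => jacobiTheta₂_term n w σ) (b := fun n w => jacobiTheta₂_term n 0 (w - σ))
    (isOpen_abs_im_lt S) (isOpen_lt continuous_const Complex.continuous_im)
    (summable_exp_neg_quadratic S (half_pos hT)) (summable_exp_neg_quadratic 0 (half_pos hT))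
    (fun n => (differentiable_jacobiTheta₂_term_fst n σ).differentiableOn)
    (fun n => Differentiable.differentiableOn (by unfold jacobiTheta₂_term; fun_prop))
    (fun n w hw => by
      simpa using norm_jacobiTheta₂_term_le (half_pos hT) (le_of_lt hw) hσ.ge n)
    (fun n w hw => by
      have him : T / 2 ≤ (w - σ).im := by
        rw [Complex.sub_im, hσ]
        linarith [show T < w.im from hw]
      simpa using norm_jacobiTheta₂_term_le (S := 0) (z := 0) (half_pos hT) (by simp) him n)
  refine (hsum (z, τ) ⟨hS, hTτ⟩).congr (Eventually.of_forall fun p => ?_)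
  exact tsum_congr fun n => (jacobiTheta₂_term_eq_mul n p.1 σ p.2).symm

theorem hasDerivAt_jacobiTheta₂_term_fst (n : ℤ) (z τ : ℂ) :
    HasDerivAt (fun w => jacobiTheta₂_term n w τ) (jacobiTheta₂'_term n z τ) z :=
  (((hasDerivAt_id' z).const_mul _).add_const _).cexp.congr_deriv (by
    rw [jacobiTheta₂'_term, jacobiTheta₂_term]; ring)

theorem hasSum_deriv_jacobiTheta₂' (z : ℂ) {τ : ℂ} (hτ : 0 < τ.im) :
    HasSum (fun n : ℤ => (2 * π * I * n) ^ 2 * jacobiTheta₂_term n z τ)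
      (deriv (fun w => jacobiTheta₂' w τ) z) := by
  obtain ⟨S, hS⟩ := exists_gt |z.im|
  have hterm (n : ℤ) (w : ℂ) : HasDerivAt (fun w => jacobiTheta₂'_term n w τ)
      ((2 * π * I * n) ^ 2 * jacobiTheta₂_term n w τ) w :=
    ((hasDerivAt_jacobiTheta₂_term_fst n w τ).const_mul (2 * π * I * n)).congr_deriv (by
      rw [jacobiTheta₂'_term]; ring)
  have hbound : Summable fun n : ℤ => 2 * π * |(n : ℝ)| *
      Real.exp (-π * (τ.im * n ^ 2 - 2 * S * |(n : ℝ)|)) := by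
    simpa [mul_assoc] using
      (summable_pow_mul_jacobiTheta₂_term_bound S hτ 1).mul_left (2 * π)
  have h := Complex.hasSum_deriv_of_summable_norm (F := fun n w => jacobiTheta₂'_term n w τ)
    hbound (fun n w _ => (hterm n w).differentiableAt.differentiableWithinAt)
    (isOpen_abs_im_lt S)
    (fun n w hw => by simpa using norm_jacobiTheta₂'_term_le hτ (le_of_lt hw) le_rfl n) hS
  simp only [(hterm _ _).deriv] at h
  exact h

theorem jacobiTheta₂_fderiv_apply_fst (z : ℂ) {τ : ℂ} (hτ : 0 < τ.im) :
    jacobiTheta₂_fderiv z τ (1, 0) = jacobiTheta₂' z τ := by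
  refine ((ContinuousLinearMap.apply ℂ ℂ ((1 : ℂ), (0 : ℂ))).hasSum
    (hasSum_jacobiTheta₂_term_fderiv z hτ)).unique ?_
  refine (hasSum_jacobiTheta₂'_term z hτ).congr_fun fun n => ?_
  simp [jacobiTheta₂_term_fderiv, jacobiTheta₂'_term, jacobiTheta₂_term, mul_comm]

theorem jacobiTheta₂_fderiv_apply_snd (z : ℂ) {τ : ℂ} (hτ : 0 < τ.im) :
    jacobiTheta₂_fderiv z τ (0, 1) = -I / (4 * π) * deriv (fun w => jacobiTheta₂' w τ) z := by
  refine ((ContinuousLinearMap.apply ℂ ℂ ((0 : ℂ), (1 : ℂ))).hasSum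
    (hasSum_jacobiTheta₂_term_fderiv z hτ)).unique ?_
  refine ((hasSum_deriv_jacobiTheta₂' z hτ).mul_left _).congr_fun fun n => ?_
  have hpi : (π : ℂ) ≠ 0 := by exact_mod_cast Real.pi_ne_zero
  simp only [ContinuousLinearMap.apply_apply, jacobiTheta₂_term_fderiv, jacobiTheta₂_term,
    smul_apply, add_apply, ContinuousLinearMap.coe_fst', ContinuousLinearMap.coe_snd',
    smul_eq_mul]
  field_simp
  linear_combination 4 * (n : ℂ) ^ 2 * Complex.I_sq

/-! ### Entire functions with the quasi-periodicity of the theta function -/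

theorem intervalIntegral_add_const_of_periodic {g : ℂ → ℂ} {T : ℝ} (hg : Differentiable ℂ g)
    (hper : g.Periodic T) (s : ℂ) : ∫ x in (0 : ℝ)..T, g (x + s) = ∫ x in (0 : ℝ)..T, g x := by
  obtain ⟨G, hG⟩ := hg.isExactOn_univ
  replace hG z : HasDerivAt G (g z) z := hG z trivial
  have hint (s : ℂ) : ∫ x in (0 : ℝ)..T, g (x + s) = G (T + s) - G s := by
    rw [intervalIntegral.integral_eq_sub_of_hasDerivAt (f := fun y : ℝ => G (y + s))
      fun x _ => ((hG (x + s)).comp_add_const (x : ℂ) s).comp_ofReal]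
    · simp
    · exact (hg.continuous.comp (by fun_prop)).intervalIntegrable _ _
  have hconst s : HasDerivAt (fun s => G (T + s) - G s) 0 s := by
    have h := ((hG (T + s)).comp_const_add (T : ℂ) s).sub (hG s)
    rwa [add_comm (T : ℂ) s, hper, sub_self] at h
  have h0 := hint 0
  simp only [add_zero] at h0
  rw [hint, h0]
  simpa using is_const_of_deriv_eq_zero (fun s => (hconst s).differentiableAt)
    (fun s => (hconst s).deriv) s 0

theorem eq_zero_of_forall_ofReal_eq_zero {f : ℂ → ℂ} (hf : Differentiable ℂ f)
    (h : ∀ x : ℝ, f x = 0) : f = 0 := by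
  have hreal : Tendsto ((↑) : ℝ → ℂ) (𝓝[≠] 0) (𝓝[≠] 0) := by
    refine tendsto_nhdsWithin_iff.2 ⟨?_, ?_⟩
    · simpa using (Complex.continuous_ofReal.tendsto 0).mono_left nhdsWithin_le_nhds
    · filter_upwards [self_mem_nhdsWithin] with x hx
      simpa using hx
  exact AnalyticOnNhd.eq_of_frequently_eq (fun z _ => hf.analyticAt z)
    (fun z _ => analyticAt_const) (hreal.frequently (Eventually.of_forall h).frequently)

theorem eq_zero_of_fourier_integral_eq_zero {f : ℂ → ℂ} (hf : Differentiable ℂ f)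
    (hper : f.Periodic 1) (h : ∀ n : ℤ, ∫ x in (0 : ℝ)..1, exp (2 * π * I * n * x) * f x = 0) :
    f = 0 := by
  have : Fact ((0 : ℝ) < 1) := ⟨one_pos⟩
  have hp : Function.Periodic (fun x : ℝ => f x) 1 := fun x => by simp [hper (x : ℂ)]
  let F : C(AddCircle (1 : ℝ), ℂ) :=
    ⟨hp.lift, continuous_coinduced_dom.2 (hf.continuous.comp Complex.continuous_ofReal)⟩
  have hF (x : ℝ) : F (x : AddCircle (1 : ℝ)) = f x := rfl
  have hcoeff : fourierCoeff F = 0 := by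
    funext n
    rw [fourierCoeff_eq_intervalIntegral _ _ 0]
    simp only [hF, fourier_coe_apply, zero_add, smul_eq_mul, Complex.ofReal_one, div_one, h,
      smul_zero, Pi.zero_apply]
  refine eq_zero_of_forall_ofReal_eq_zero hf fun x => ?_
  have hs := has_pointwise_sum_fourier_series_of_summable (f := F)
    (by rw [hcoeff]; exact summable_zero) (x : AddCircle (1 : ℝ))
  rw [hcoeff, hF] at hs
  exact hs.unique (by simp)

/-- The transformation law of `jacobiTheta₂ · τ` under the periods `1` and `τ`. -/
structure IsThetaQuasiPeriodic (f : ℂ → ℂ) (τ : ℂ) : Prop where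
  add_one (z : ℂ) : f (z + 1) = f z
  add_tau (z : ℂ) : f (z + τ) = exp (-π * I * (τ + 2 * z)) * f z

namespace IsThetaQuasiPeriodic

variable {f : ℂ → ℂ} {τ : ℂ}

theorem integral_exp_mul_succ (hf : IsThetaQuasiPeriodic f τ) (hd : Differentiable ℂ f) (n : ℤ) :
    ∫ x in (0 : ℝ)..1, exp (2 * π * I * (n + 1 : ℤ) * x) * f x =
      exp (2 * π * I * (n + 1) * τ - π * I * τ) *
        ∫ x in (0 : ℝ)..1, exp (2 * π * I * n * x) * f x := by
  have hper : Function.Periodic (fun z => exp (2 * π * I * (n + 1 : ℤ) * z) * f z) (1 : ℝ) :=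
    fun z => by
      simp only [Complex.ofReal_one, hf.add_one]
      rw [mul_add, Complex.exp_add, mul_one,
        mul_comm (2 * (π : ℂ) * I), Complex.exp_int_mul_two_pi_mul_I, mul_one]
  rw [← intervalIntegral_add_const_of_periodic (by fun_prop) hper τ,
    ← intervalIntegral.integral_const_mul]
  refine intervalIntegral.integral_congr fun x _ => ?_
  simp only [hf.add_tau, ← mul_assoc, ← Complex.exp_add]
  congr 2; push_cast; ring

theorem eq_zero_of_integral_eq_zero (hf : IsThetaQuasiPeriodic f τ) (hd : Differentiable ℂ f)
    (h0 : ∫ x in (0 : ℝ)..1, f x = 0) : f = 0 := by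
  refine eq_zero_of_fourier_integral_eq_zero hd hf.add_one fun n => ?_
  induction n using Int.induction_on with
  | zero => simpa using h0
  | succ n ih => rw [hf.integral_exp_mul_succ hd, ih, mul_zero]
  | pred n ih =>
    have h := hf.integral_exp_mul_succ hd (-n - 1)
    rw [sub_add_cancel, ih, eq_comm, mul_eq_zero] at h
    exact h.resolve_left (Complex.exp_ne_zero _)

end IsThetaQuasiPeriodic

theorem integral_jacobiTheta₂_term (n : ℤ) (τ : ℂ) :
    ∫ x in (0 : ℝ)..1, jacobiTheta₂_term n x τ = if n = 0 then 1 else 0 := by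
  split_ifs with hn
  · simp [hn, jacobiTheta₂_term]
  · have hc : 2 * π * I * n ≠ 0 := mul_ne_zero Complex.two_pi_I_ne_zero (Int.cast_ne_zero.2 hn)
    have hperiod : exp (2 * π * I * n * (1 : ℝ)) = 1 := by
      rw [Complex.ofReal_one, mul_one, mul_comm, Complex.exp_int_mul_two_pi_mul_I]
    simp only [jacobiTheta₂_term, Complex.exp_add]
    rw [intervalIntegral.integral_mul_const, integral_exp_mul_complex hc, hperiod]
    simp

theorem integral_jacobiTheta₂ {τ : ℂ} (hτ : 0 < τ.im) :
    ∫ x in (0 : ℝ)..1, jacobiTheta₂ x τ = 1 := by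
  let F (n : ℤ) : C(ℝ, ℂ) := ⟨fun x => jacobiTheta₂_term n x τ,
    (differentiable_jacobiTheta₂_term_fst n τ).continuous.comp Complex.continuous_ofReal⟩
  have hF (n : ℤ) (x : ℝ) : ‖F n x‖ ≤ Real.exp (-π * (τ.im * n ^ 2 - 2 * 0 * |(n : ℝ)|)) := by
    simpa [F] using norm_jacobiTheta₂_term_le (S := 0) hτ (z := x) (by simp) le_rfl n
  have h := intervalIntegral.hasSum_intervalIntegral_of_summable_norm (a := 0) (b := 1) (f := F)
    ((summable_exp_neg_quadratic 0 hτ).of_nonneg_of_le (fun n => norm_nonneg _) fun n =>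
      (ContinuousMap.norm_le _ (Real.exp_pos _).le).2 fun x => hF n x)
  change HasSum (fun n => ∫ x in (0 : ℝ)..1, jacobiTheta₂_term n x τ) _ at h
  simp only [integral_jacobiTheta₂_term] at h
  exact h.unique (hasSum_ite_eq 0 1)

theorem differentiable_jacobiTheta₂_fst {τ : ℂ} (hτ : 0 < τ.im) :
    Differentiable ℂ (jacobiTheta₂ · τ) :=
  fun z => differentiableAt_jacobiTheta₂_fst z hτ

theorem IsThetaQuasiPeriodic.exists_eq_const_mul {f : ℂ → ℂ} {τ : ℂ}
    (hf : IsThetaQuasiPeriodic f τ) (hτ : 0 < τ.im) (hd : Differentiable ℂ f) :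
    ∃ c : ℂ, ∀ z, f z = c * jacobiTheta₂ z τ := by
  set c := ∫ x in (0 : ℝ)..1, f x
  have hJ := differentiable_jacobiTheta₂_fst hτ
  have hquasi : IsThetaQuasiPeriodic (fun z => f z - c * jacobiTheta₂ z τ) τ :=
    ⟨fun z => by rw [hf.add_one, jacobiTheta₂_add_left],
      fun z => by rw [hf.add_tau, jacobiTheta₂_add_left']; ring⟩
  have hzero := hquasi.eq_zero_of_integral_eq_zero (by fun_prop) (by
    rw [intervalIntegral.integral_sub, intervalIntegral.integral_const_mul,
      integral_jacobiTheta₂ hτ, mul_one, sub_self]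
    · exact (hd.continuous.comp Complex.continuous_ofReal).intervalIntegrable _ _
    · exact ((hJ.continuous.comp Complex.continuous_ofReal).const_mul c).intervalIntegrable _ _)
  exact ⟨c, fun z => sub_eq_zero.1 (congr_fun hzero z)⟩

theorem exists_jacobiTheta₂_ne_zero {τ : ℂ} (hτ : 0 < τ.im) : ∃ z, jacobiTheta₂ z τ ≠ 0 := by
  by_contra! h
  simpa [h] using integral_jacobiTheta₂ hτ

/-! ### The Weierstrass zeta function -/

theorem hasDerivAt_of_hasSumLocallyUniformlyOn {ι : Type*} {f f' : ι → ℂ → ℂ} {F : ℂ → ℂ}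
    {U : Set ℂ} {z F' : ℂ} (hU : IsOpen U) (hF : HasSumLocallyUniformlyOn f F U)
    (hf : ∀ i, ∀ w ∈ U, HasDerivAt (f i) (f' i w) w) (hz : z ∈ U)
    (hF' : HasSum (fun i => f' i z) F') : HasDerivAt F F' z := by
  have hsum (s : Finset ι) {w : ℂ} (hw : w ∈ U) :
      HasDerivAt (fun w => ∑ i ∈ s, f i w) (∑ i ∈ s, f' i w) w :=
    HasDerivAt.fun_sum fun i _ => hf i w hw
  have hlim : TendstoLocallyUniformlyOn (fun (s : Finset ι) w => ∑ i ∈ s, f i w) F atTop U := hF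
  have hdiff : ∀ᶠ s : Finset ι in atTop, DifferentiableOn ℂ (fun w => ∑ i ∈ s, f i w) U :=
    Eventually.of_forall fun s w hw => (hsum s hw).differentiableAt.differentiableWithinAt
  have hderiv : deriv F z = F' := tendsto_nhds_unique
    (((hlim.deriv hdiff hU).tendsto_at hz).congr fun s => (hsum s hz).deriv) hF'
  exact hderiv ▸ ((hlim.differentiableOn hdiff hU).differentiableAt (hU.mem_nhds hz)).hasDerivAt

/-- The contribution of the lattice point `l` to the Weierstrass zeta function. The formula also
serves `l = 0`, where it reads `1 / z` because division by zero gives zero. -/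
noncomputable def weierstrassZetaSummand (l z : ℂ) : ℂ := 1 / (z - l) + 1 / l + z / l ^ 2

theorem weierstrassZetaSummand_neg_neg (l z : ℂ) :
    weierstrassZetaSummand (-l) (-z) = -weierstrassZetaSummand l z := by
  have hzl : -z - -l = -(z - l) := by ring
  simp only [weierstrassZetaSummand, hzl, div_neg, neg_sq]
  ring

theorem hasDerivAt_weierstrassZetaSummand {l z : ℂ} (h : z - l ≠ 0) :
    HasDerivAt (weierstrassZetaSummand l) (-(1 / (z - l) ^ 2 - 1 / l ^ 2)) z := by
  have hinv : HasDerivAt (fun w => 1 / (w - l)) (-1 / (z - l) ^ 2) z := by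
    simpa only [one_div] using ((hasDerivAt_id' z).sub_const l).fun_inv h
  exact ((hinv.add_const _).add ((hasDerivAt_id' z).div_const _)).congr_deriv (by ring)

theorem norm_weierstrassZetaSummand_le {r : ℝ} {l z : ℂ} (hz : ‖z‖ < r) (hl : 2 * r ≤ ‖l‖) :
    ‖weierstrassZetaSummand l z‖ ≤ 2 * r ^ 2 * ‖l‖ ^ (-3 : ℝ) := by
  have hl_pos : 0 < ‖l‖ := by linarith [norm_nonneg z]
  have hl0 : l ≠ 0 := norm_pos_iff.1 hl_pos
  have hzl : ‖l‖ / 2 ≤ ‖z - l‖ := by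
    rw [norm_sub_rev]
    exact .trans (by linarith) (norm_sub_norm_le l z)
  have hzl0 : z - l ≠ 0 := norm_pos_iff.1 (by linarith)
  have hcombine : weierstrassZetaSummand l z = z ^ 2 / (l ^ 2 * (z - l)) := by
    rw [weierstrassZetaSummand]; field_simp; ring
  rw [hcombine, norm_div, norm_mul, norm_pow, norm_pow]
  calc ‖z‖ ^ 2 / (‖l‖ ^ 2 * ‖z - l‖) ≤ r ^ 2 / (‖l‖ ^ 2 * (‖l‖ / 2)) := by gcongr
    _ = 2 * r ^ 2 / ‖l‖ ^ 3 := by field_simp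
    _ = 2 * r ^ 2 * ‖l‖ ^ (-3 : ℝ) := by
      rw [Real.rpow_neg hl_pos.le, div_eq_mul_inv]; norm_cast

/-- The Weierstrass zeta function of a lattice. -/
noncomputable def weierstrassZeta (L : PeriodPair) (z : ℂ) : ℂ :=
  ∑' l : L.lattice, weierstrassZetaSummand l z

/-- The Weierstrass zeta function without the summand of `l₀`: the part that is holomorphic at
the lattice point `l₀`. -/
noncomputable def weierstrassZetaExcept (L : PeriodPair) (l₀ z : ℂ) : ℂ :=
  ∑' l : L.lattice, if (l : ℂ) = l₀ then 0 else weierstrassZetaSummand l z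

section WeierstrassZeta

variable (L : PeriodPair)

theorem hasSumLocallyUniformly_weierstrassZetaExcept (l₀ : ℂ) :
    HasSumLocallyUniformly
      (fun (l : L.lattice) (z : ℂ) => if (l : ℂ) = l₀ then 0 else weierstrassZetaSummand l z)
      (weierstrassZetaExcept L l₀) := by
  refine L.hasSumLocallyUniformly_aux (u := (2 * · ^ 2 * ‖·‖ ^ (-3 : ℝ))) _
    (fun _ _ => (ZLattice.summable_norm_rpow _ _ (by simp; norm_num)).mul_left _) fun r _ =>
    Filter.eventually_atTop.mpr ⟨2 * r, ?_⟩
  rintro _ hl z hz l rfl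
  split_ifs
  · rw [norm_zero]; positivity
  · exact norm_weierstrassZetaSummand_le hz hl

theorem weierstrassZetaExcept_add (l₀ : L.lattice) (z : ℂ) :
    weierstrassZetaExcept L l₀ z + weierstrassZetaSummand l₀ z = weierstrassZeta L z := by
  have hsummand : ∑' l : L.lattice, (if (l : ℂ) = l₀ then weierstrassZetaSummand l₀ z else 0) =
      weierstrassZetaSummand l₀ z := by simp
  rw [← hsummand, weierstrassZetaExcept, ← Summable.tsum_add]
  · refine tsum_congr fun l => ?_
    split_ifs with h <;> simp only [h, zero_add, add_zero]
  · exact ⟨_, (hasSumLocallyUniformly_weierstrassZetaExcept L _).hasSum⟩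
  · exact summable_of_hasFiniteSupport ((Set.finite_singleton l₀).subset (by simp))

theorem weierstrassZetaExcept_of_notMem {l₀ : ℂ} (hl₀ : l₀ ∉ L.lattice) :
    weierstrassZetaExcept L l₀ = weierstrassZeta L :=
  funext fun _ => tsum_congr fun l => if_neg fun h : (l : ℂ) = l₀ => hl₀ (h ▸ l.2)

theorem hasDerivAt_weierstrassZetaExcept (l₀ : ℂ) {z : ℂ}
    (hz : z ∈ (L.lattice \ {l₀} : Set ℂ)ᶜ) :
    HasDerivAt (weierstrassZetaExcept L l₀) (-L.weierstrassPExcept l₀ z) z := by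
  refine hasDerivAt_of_hasSumLocallyUniformlyOn (L.isOpen_compl_lattice_sdiff (s := {l₀}))
    (f' := fun (l : L.lattice) w => -(if (l : ℂ) = l₀ then 0 else 1 / (w - l) ^ 2 - 1 / l ^ 2))
    (hasSumLocallyUniformly_weierstrassZetaExcept L l₀).tendstoLocallyUniformlyOn
    (fun l w hw => ?_) hz (L.hasSum_weierstrassPExcept l₀ z).neg
  split_ifs with hl
  · simpa using hasDerivAt_const w (0 : ℂ)
  · exact hasDerivAt_weierstrassZetaSummand fun h => hw ⟨sub_eq_zero.1 h ▸ l.2,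
      fun hwl => hl ((sub_eq_zero.1 h).symm.trans hwl)⟩

theorem hasDerivAt_weierstrassZeta {z : ℂ} (hz : z ∉ L.lattice) :
    HasDerivAt (weierstrassZeta L) (-L.weierstrassP z) z := by
  rw [← weierstrassZetaExcept_of_notMem L hz, ← L.weierstrassPExcept_of_notMem z hz]
  exact hasDerivAt_weierstrassZetaExcept L z (by simp)

theorem analyticAt_weierstrassZeta {z : ℂ} (hz : z ∉ L.lattice) :
    AnalyticAt ℂ (weierstrassZeta L) z :=
  DifferentiableOn.analyticAt (s := (L.lattice : Set ℂ)ᶜ)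
    (fun _ hw => (hasDerivAt_weierstrassZeta L hw).differentiableAt.differentiableWithinAt)
    (L.isClosed_lattice.isOpen_compl.mem_nhds hz)

theorem analyticAt_weierstrassZetaExcept (l₀ : ℂ) :
    AnalyticAt ℂ (weierstrassZetaExcept L l₀) l₀ :=
  DifferentiableOn.analyticAt (s := (L.lattice \ {l₀} : Set ℂ)ᶜ)
    (fun _ hw =>
      (hasDerivAt_weierstrassZetaExcept L l₀ hw).differentiableAt.differentiableWithinAt)
    (L.compl_lattice_sdiff_singleton_mem_nhds l₀)

theorem exists_weierstrassZeta_eq_inv_add {l : ℂ} (hl : l ∈ L.lattice) :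
    ∃ g : ℂ → ℂ, AnalyticAt ℂ g l ∧ ∀ z, weierstrassZeta L z = 1 / (z - l) + g z := by
  refine ⟨fun z => weierstrassZetaExcept L l z + (1 / l + z * (l ^ 2)⁻¹), ?_, fun z => ?_⟩
  · have h := analyticAt_weierstrassZetaExcept L l
    fun_prop
  · rw [← weierstrassZetaExcept_add L ⟨l, hl⟩, weierstrassZetaSummand]; ring

theorem exists_weierstrassP_eq_inv_sq_add {l : ℂ} (hl : l ∈ L.lattice) :
    ∃ g : ℂ → ℂ, AnalyticAt ℂ g l ∧ ∀ z, L.weierstrassP z = 1 / (z - l) ^ 2 + g z := by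
  refine ⟨fun z => L.weierstrassPExcept l z - 1 / l ^ 2, ?_, fun z => ?_⟩
  · exact (L.analyticAt_weierstrassPExcept l).fun_sub analyticAt_const
  · rw [← L.weierstrassPExcept_add ⟨l, hl⟩]; ring

theorem meromorphic_weierstrassZeta : Meromorphic (weierstrassZeta L) := by
  intro x
  by_cases hx : x ∈ L.lattice
  · obtain ⟨g, hg, hζ⟩ := exists_weierstrassZeta_eq_inv_add L hx
    rw [funext hζ]
    exact (MeromorphicAt.div (by fun_prop) (by fun_prop)).fun_add hg.meromorphicAt
  · exact (analyticAt_weierstrassZeta L hx).meromorphicAt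

theorem meromorphicOrderAt_weierstrassZeta {l : ℂ} (hl : l ∈ L.lattice) :
    meromorphicOrderAt (weierstrassZeta L) l = (-1 : ℤ) := by
  obtain ⟨g, hg, hζ⟩ := exists_weierstrassZeta_eq_inv_add L hl
  refine (meromorphicOrderAt_eq_int_iff (meromorphic_weierstrassZeta L l)).2
    ⟨fun z => 1 + (z - l) * g z, by fun_prop, by simp, ?_⟩
  filter_upwards [self_mem_nhdsWithin] with z hz
  have hzl : z - l ≠ 0 := sub_ne_zero.2 hz
  rw [hζ, zpow_neg_one, smul_eq_mul]
  field_simp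

theorem neg_one_le_meromorphicOrderAt_weierstrassZeta (x : ℂ) :
    (-1 : ℤ) ≤ meromorphicOrderAt (weierstrassZeta L) x := by
  by_cases hx : x ∈ L.lattice
  · exact (meromorphicOrderAt_weierstrassZeta L hx).ge
  · exact le_trans (by decide) (analyticAt_weierstrassZeta L hx).meromorphicOrderAt_nonneg

theorem weierstrassZeta_neg (z : ℂ) : weierstrassZeta L (-z) = -weierstrassZeta L z := by
  rw [weierstrassZeta, ← (Equiv.neg L.lattice).tsum_eq, weierstrassZeta, ← tsum_neg]
  exact tsum_congr fun l => weierstrassZetaSummand_neg_neg l z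

theorem isPreconnected_compl_lattice : IsPreconnected (L.lattice : Set ℂ)ᶜ := by
  have : Countable L.lattice := L.latticeEquivProd.toEquiv.countable_iff.2 inferInstance
  exact ((Set.countable_coe_iff.1 this).isConnected_compl_of_one_lt_rank
    (Complex.rank_real_complex ▸ Cardinal.one_lt_two)).isPreconnected

theorem exists_weierstrassZeta_add_coe_eq {l : ℂ} (hl : l ∈ L.lattice) :
    ∃ η : ℂ, ∀ z, z ∉ L.lattice → weierstrassZeta L (z + l) = weierstrassZeta L z + η := by
  have hd : ∀ z ∈ (L.lattice : Set ℂ)ᶜ,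
      HasDerivAt (fun w => weierstrassZeta L (w + l) - weierstrassZeta L w) 0 z := fun z hz => by
    have hzl : z + l ∉ L.lattice := fun h => hz (by simpa using L.lattice.sub_mem h hl)
    refine (((hasDerivAt_weierstrassZeta L hzl).comp_add_const z l).sub
      (hasDerivAt_weierstrassZeta L hz)).congr_deriv ?_
    rw [L.weierstrassP_add_coe z ⟨l, hl⟩, sub_self]
  obtain ⟨η, hη⟩ := L.isClosed_lattice.isOpen_compl.exists_is_const_of_deriv_eq_zero
    (isPreconnected_compl_lattice L)
    (fun z hz => (hd z hz).differentiableAt.differentiableWithinAt) (fun z hz => (hd z hz).deriv)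
  exact ⟨η, fun z hz => by rw [← hη z hz]; ring⟩

theorem tendsto_weierstrassZeta_sub_inv :
    Tendsto (fun z => weierstrassZeta L z - z⁻¹) (𝓝[≠] 0) (𝓝 0) := by
  have hzero : weierstrassZetaExcept L 0 0 = 0 := by
    rw [weierstrassZetaExcept, ← tsum_zero (α := ℂ) (β := L.lattice)]
    exact tsum_congr fun l => by simp [weierstrassZetaSummand, div_eq_mul_inv, inv_neg]
  have hlim := (analyticAt_weierstrassZetaExcept L 0).continuousAt.tendsto
  rw [hzero] at hlim
  refine (hlim.mono_left nhdsWithin_le_nhds).congr fun z => ?_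
  rw [← weierstrassZetaExcept_add L 0]
  simp [weierstrassZetaSummand]

theorem hasDerivAt_weierstrassP {z : ℂ} (hz : z ∉ L.lattice) :
    HasDerivAt L.weierstrassP (L.derivWeierstrassP z) z := by
  rw [← L.deriv_weierstrassP]
  exact (L.analyticOnNhd_weierstrassP z hz).differentiableAt.hasDerivAt

theorem eventually_notMem_lattice (x : ℂ) : ∀ᶠ z in 𝓝[≠] x, z ∉ L.lattice := by
  filter_upwards [mem_nhdsWithin_of_mem_nhds (L.compl_lattice_sdiff_singleton_mem_nhds x),
    self_mem_nhdsWithin] with z hz hzx h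
  exact hz ⟨h, hzx⟩

theorem not_eventually_weierstrassP_eq (k : ℂ) {l : ℂ} (hl : l ∈ L.lattice) :
    ¬ ∀ᶠ z in 𝓝[≠] l, L.weierstrassP z = k := by
  intro h
  have horder := meromorphicOrderAt_congr (f₁ := L.weierstrassP) (f₂ := fun _ => k) h
  have hconst := (analyticAt_const (𝕜 := ℂ) (v := k) (x := l)).meromorphicOrderAt_nonneg
  rw [← horder, L.order_weierstrassP l hl] at hconst
  exact absurd hconst (by decide)

theorem derivWeierstrassP_mul_deriv_sub_eq_zero {z : ℂ} (hz : z ∉ L.lattice) :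
    L.derivWeierstrassP z *
      (deriv L.derivWeierstrassP z - (6 * L.weierstrassP z ^ 2 - L.g₂ / 2)) = 0 := by
  have hleft := (L.analyticOnNhd_derivWeierstrassP z hz).differentiableAt.hasDerivAt.fun_pow 2
  have hright := ((((hasDerivAt_weierstrassP L hz).fun_pow 3).const_mul 4).sub
    ((hasDerivAt_weierstrassP L hz).const_mul L.g₂)).sub_const L.g₃
  have hunique := hright.unique (hleft.congr_of_eventuallyEq (by
    filter_upwards [L.isClosed_lattice.isOpen_compl.mem_nhds hz] with u hu
    exact (L.derivWeierstrassP_sq u hu).symm))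
  norm_num at hunique
  linear_combination (-1 / 2) * hunique

theorem not_eqOn_derivWeierstrassP_zero :
    ¬ Set.EqOn L.derivWeierstrassP 0 (L.lattice : Set ℂ)ᶜ := by
  intro h
  obtain ⟨k, hk⟩ := L.isClosed_lattice.isOpen_compl.exists_is_const_of_deriv_eq_zero
    (isPreconnected_compl_lattice L)
    (fun w hw => (hasDerivAt_weierstrassP L hw).differentiableAt.differentiableWithinAt)
    (by simpa only [L.deriv_weierstrassP] using h)
  exact not_eventually_weierstrassP_eq L k L.lattice.zero_mem
    ((eventually_notMem_lattice L 0).mono hk)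

theorem hasDerivAt_derivWeierstrassP {z : ℂ} (hz : z ∉ L.lattice) :
    HasDerivAt L.derivWeierstrassP (6 * L.weierstrassP z ^ 2 - L.g₂ / 2) z := by
  have hP' : AnalyticOnNhd ℂ L.derivWeierstrassP (L.lattice : Set ℂ)ᶜ :=
    L.analyticOnNhd_derivWeierstrassP
  have hfactor : AnalyticOnNhd ℂ (fun w => deriv L.derivWeierstrassP w -
      (6 * L.weierstrassP w ^ 2 - L.g₂ / 2)) (L.lattice : Set ℂ)ᶜ := fun w hw =>
    (hP' w hw).deriv.fun_sub ((analyticAt_const.fun_mul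
      ((L.analyticOnNhd_weierstrassP w hw).fun_pow 2)).fun_sub analyticAt_const)
  rcases hP'.eq_zero_or_eq_zero_of_smul_eq_zero hfactor
    (fun w hw => derivWeierstrassP_mul_deriv_sub_eq_zero L hw) (isPreconnected_compl_lattice L)
    with h | h
  · exact (not_eqOn_derivWeierstrassP_zero L h).elim
  · exact sub_eq_zero.1 (h z hz) ▸ (hP' z hz).differentiableAt.hasDerivAt

theorem derivWeierstrassP_eq_zero_of_two_mul_mem {a : ℂ} (ha : 2 * a ∈ L.lattice) :
    L.derivWeierstrassP a = 0 := by
  have h := L.derivWeierstrassP_add_coe (-a) ⟨2 * a, ha⟩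
  simp only [show -a + 2 * a = a by ring, L.derivWeierstrassP_neg] at h
  linear_combination h / 2

end WeierstrassZeta

/-! ### Quasi-periodicity of the theta functions -/

theorem thetaFour_eq_jacobiTheta₂ (z τ : ℂ) :
    thetaFour z τ = jacobiTheta₂ (z / π + 1 / 2) τ := by
  have hpi : (π : ℂ) ≠ 0 := by exact_mod_cast Real.pi_ne_zero
  refine tsum_congr fun n => ?_
  rw [jacobiTheta₂_term, ← Complex.exp_pi_mul_I, ← Complex.exp_int_mul, ← Complex.exp_add]
  congr 1; field_simp; ring

theorem thetaOneTilde_eq_jacobiTheta₂ (z τ : ℂ) : thetaOneTilde z τ =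
    -I * exp (π * I * (z / 2 + τ / 4)) * jacobiTheta₂ (z / 2 + τ / 2 + 1 / 2) τ := by
  have hpi : (π : ℂ) ≠ 0 := by exact_mod_cast Real.pi_ne_zero
  rw [thetaOneTilde, thetaOne, thetaFour_eq_jacobiTheta₂]
  congr 2
  · congr 2; ring
  · field_simp

theorem thetaOneTilde_add_two (z τ : ℂ) : thetaOneTilde (z + 2) τ = -thetaOneTilde z τ := by
  rw [thetaOneTilde_eq_jacobiTheta₂, thetaOneTilde_eq_jacobiTheta₂,
    show (z + 2) / 2 + τ / 2 + 1 / 2 = (z / 2 + τ / 2 + 1 / 2) + 1 by ring, jacobiTheta₂_add_left,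
    show π * I * ((z + 2) / 2 + τ / 4) = π * I * (z / 2 + τ / 4) + π * I by ring,
    Complex.exp_antiperiodic]
  ring

theorem thetaOneTilde_add_two_mul (z τ : ℂ) :
    thetaOneTilde (z + 2 * τ) τ = -exp (-π * I * (τ + z)) * thetaOneTilde z τ := by
  rw [thetaOneTilde_eq_jacobiTheta₂, thetaOneTilde_eq_jacobiTheta₂,
    show (z + 2 * τ) / 2 + τ / 2 + 1 / 2 = (z / 2 + τ / 2 + 1 / 2) + τ by ring,
    jacobiTheta₂_add_left']
  have hexp : exp (π * I * ((z + 2 * τ) / 2 + τ / 4)) *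
      exp (-π * I * (τ + 2 * (z / 2 + τ / 2 + 1 / 2))) =
      -(exp (-π * I * (τ + z)) * exp (π * I * (z / 2 + τ / 4))) := by
    rw [← Complex.exp_add, ← Complex.exp_add, ← Complex.exp_antiperiodic.sub_eq]
    congr 1; ring
  linear_combination -I * jacobiTheta₂ (z / 2 + τ / 2 + 1 / 2) τ * hexp

theorem thetaOneTilde_neg (z τ : ℂ) : thetaOneTilde (-z) τ = -thetaOneTilde z τ := by
  rw [thetaOneTilde_eq_jacobiTheta₂, thetaOneTilde_eq_jacobiTheta₂, ← jacobiTheta₂_neg_left,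
    show -(-z / 2 + τ / 2 + 1 / 2) = z / 2 - τ / 2 - 1 / 2 by ring, ← jacobiTheta₂_add_left,
    show z / 2 + τ / 2 + 1 / 2 = (z / 2 - τ / 2 - 1 / 2 + 1) + τ by ring, jacobiTheta₂_add_left']
  have hexp : exp (π * I * (z / 2 + τ / 4)) *
      exp (-π * I * (τ + 2 * (z / 2 - τ / 2 - 1 / 2 + 1))) = -exp (π * I * (-z / 2 + τ / 4)) := by
    rw [← Complex.exp_add, ← Complex.exp_antiperiodic.sub_eq]
    congr 1; ring
  linear_combination -I * jacobiTheta₂ (z / 2 - τ / 2 - 1 / 2 + 1) τ * hexp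

theorem differentiable_thetaOneTilde {τ : ℂ} (hτ : 0 < τ.im) :
    Differentiable ℂ fun z => thetaOneTilde z τ := by
  have hJ : Differentiable ℂ fun z => jacobiTheta₂ (z / 2 + τ / 2 + 1 / 2) τ :=
    (differentiable_jacobiTheta₂_fst hτ).comp (f := fun z => z / 2 + τ / 2 + 1 / 2) (by fun_prop)
  simp only [thetaOneTilde_eq_jacobiTheta₂]
  fun_prop

theorem eventually_thetaOneTilde_ne_zero {τ : ℂ} (hτ : 0 < τ.im) (x : ℂ) :
    ∀ᶠ z in 𝓝[≠] x, thetaOneTilde z τ ≠ 0 := by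
  have hd := differentiable_thetaOneTilde hτ
  refine (hd.analyticAt x).eventually_eq_zero_or_eventually_ne_zero.resolve_left fun h => ?_
  obtain ⟨u, hu⟩ := exists_jacobiTheta₂_ne_zero hτ
  have hzero := AnalyticOnNhd.eqOn_zero_of_preconnected_of_eventuallyEq_zero
    (fun z _ => hd.analyticAt z) isPreconnected_univ (Set.mem_univ x) h
    (Set.mem_univ (2 * u - τ - 1))
  simp only [thetaOneTilde_eq_jacobiTheta₂, Pi.zero_apply,
    show (2 * u - τ - 1) / 2 + τ / 2 + 1 / 2 = u by ring] at hzero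
  simp [hu, Complex.exp_ne_zero] at hzero

theorem exists_eq_const_mul_thetaOneTilde {w : ℂ → ℂ} {τ : ℂ} (hτ : 0 < τ.im)
    (hw : Differentiable ℂ w) (h_two : ∀ z, w (z + 2) = -w z)
    (h_tau : ∀ z, w (z + 2 * τ) = -exp (-π * I * (τ + z)) * w z) :
    ∃ k : ℂ, ∀ z, w z = k * thetaOneTilde z τ := by
  have hquasi : IsThetaQuasiPeriodic (fun u => w (2 * u - τ - 1) * exp (-(π * I * u))) τ := by
    refine ⟨fun u => ?_, fun u => ?_⟩
    · rw [show 2 * (u + 1) - τ - 1 = 2 * u - τ - 1 + 2 by ring, h_two,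
        show -(π * I * (u + 1)) = -(π * I * u) - π * I by ring, Complex.exp_antiperiodic.sub_eq]
      ring
    · rw [show 2 * (u + τ) - τ - 1 = 2 * u - τ - 1 + 2 * τ by ring, h_tau,
        show -π * I * (τ + (2 * u - τ - 1)) = -(2 * π * I * u) + π * I by ring,
        Complex.exp_antiperiodic, show -(π * I * (u + τ)) = -(π * I * u) + -(π * I * τ) by ring,
        show -π * I * (τ + 2 * u) = -(2 * π * I * u) + -(π * I * τ) by ring,
        Complex.exp_add, Complex.exp_add]
      ring
  obtain ⟨c, hc⟩ := hquasi.exists_eq_const_mul hτ (by fun_prop)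
  refine ⟨-c * exp (π * I * (τ / 4)), fun z => ?_⟩
  have hcz := hc (z / 2 + τ / 2 + 1 / 2)
  rw [show 2 * (z / 2 + τ / 2 + 1 / 2) - τ - 1 = z by ring, Complex.exp_neg,
    ← div_eq_mul_inv, div_eq_iff (Complex.exp_ne_zero _),
    show π * I * (z / 2 + τ / 2 + 1 / 2) = π * I * (τ / 4) + π * I * (z / 2 + τ / 4) + π / 2 * I
      by ring, Complex.exp_add, Complex.exp_add, Complex.exp_pi_div_two_mul_I] at hcz
  rw [hcz, thetaOneTilde_eq_jacobiTheta₂]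
  ring

/-- The group of translations under which `f` gets multiplied by the exponential of an affine
function. -/
noncomputable def affineExpPeriods (f : ℂ → ℂ) : AddSubgroup ℂ where
  carrier := {l | ∃ α β : ℂ, ∀ z, f (z + l) = exp (α + β * z) * f z}
  zero_mem' := ⟨0, 0, fun z => by simp⟩
  add_mem' := by
    rintro l m ⟨α, β, hl⟩ ⟨α', β', hm⟩
    refine ⟨α + α' + β' * l, β + β', fun z => ?_⟩
    rw [← add_assoc, hm, hl, ← mul_assoc, ← Complex.exp_add]
    congr 2; ring
  neg_mem' := by
    rintro l ⟨α, β, hl⟩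
    refine ⟨-α + β * l, -β, fun z => ?_⟩
    have h := hl (z + -l)
    rw [neg_add_cancel_right] at h
    rw [h, ← mul_assoc, ← Complex.exp_add,
      show -α + β * l + -β * z + (α + β * (z + -l)) = 0 by ring, Complex.exp_zero, one_mul]

theorem exists_thetaOneTilde_add_eq {τ : UpperHalfPlane} {l : ℂ}
    (hl : l ∈ (halfPeriodPair τ).lattice) :
    ∃ α β : ℂ, ∀ z, thetaOneTilde (z + l) τ = exp (α + β * z) * thetaOneTilde z τ := by
  let S := affineExpPeriods (thetaOneTilde · τ)
  have h₁ : (halfPeriodPair τ).ω₁ ∈ S := ⟨π * I, 0, fun z => by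
    simp [halfPeriodPair, thetaOneTilde_add_two, Complex.exp_pi_mul_I]⟩
  have h₂ : (halfPeriodPair τ).ω₂ ∈ S := ⟨-π * I * τ + π * I, -π * I, fun z => by
    simp only [halfPeriodPair, thetaOneTilde_add_two_mul]
    rw [← Complex.exp_antiperiodic]
    congr 2; ring⟩
  obtain ⟨m, n, rfl⟩ := PeriodPair.mem_lattice.1 hl
  have hmem : m • (halfPeriodPair τ).ω₁ + n • (halfPeriodPair τ).ω₂ ∈ S :=
    S.add_mem (S.zsmul_mem h₁ m) (S.zsmul_mem h₂ n)
  rwa [zsmul_eq_mul, zsmul_eq_mul] at hmem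

theorem thetaOneTilde_add_eq_zero_iff {τ : UpperHalfPlane} {l : ℂ}
    (hl : l ∈ (halfPeriodPair τ).lattice) (z : ℂ) :
    thetaOneTilde (z + l) τ = 0 ↔ thetaOneTilde z τ = 0 := by
  obtain ⟨α, β, h⟩ := exists_thetaOneTilde_add_eq hl
  rw [h, mul_eq_zero, or_iff_right (Complex.exp_ne_zero _)]

theorem thetaOneTilde_eq_zero_of_mem_lattice {τ : UpperHalfPlane} {l : ℂ}
    (hl : l ∈ (halfPeriodPair τ).lattice) : thetaOneTilde l τ = 0 := by
  have hzero : thetaOneTilde 0 τ = 0 := by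
    have h := thetaOneTilde_neg 0 τ
    rw [neg_zero] at h
    linear_combination h / 2
  simpa only [zero_add] using (thetaOneTilde_add_eq_zero_iff hl 0).2 hzero

/-! ### Elliptic functions whose poles are compensated by the zeros of `ϑ₁` -/

theorem eq_of_eventuallyEq_nhdsNE {f g : ℂ → ℂ} {x : ℂ} (hf : ContinuousAt f x)
    (hg : ContinuousAt g x) (h : f =ᶠ[𝓝[≠] x] g) : f x = g x :=
  ((hf.eventuallyEq_nhds_iff_eventuallyEq_nhdsNE hg).1 h).eq_of_nhds

theorem tendsto_add_const_nhdsNE (x l : ℂ) : Tendsto (· + l) (𝓝[≠] x) (𝓝[≠] (x + l)) :=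
  ((hasDerivAt_id' x).add_const l).tendsto_nhdsNE one_ne_zero

theorem exists_differentiable_of_meromorphicOrderAt_nonneg {f : ℂ → ℂ} (hf : Meromorphic f)
    (hord : ∀ x, 0 ≤ meromorphicOrderAt f x) :
    ∃ w : ℂ → ℂ, Differentiable ℂ w ∧ ∀ x, f =ᶠ[𝓝[≠] x] w := by
  have hf' : MeromorphicOn f Set.univ := fun x _ => hf x
  refine ⟨toMeromorphicNFOn f Set.univ, fun x => ?_, fun x =>
    (hf'.toMeromorphicNFOn_eq_self_on_nhdsNE (Set.mem_univ x)).symm⟩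
  have hNF := meromorphicNFOn_toMeromorphicNFOn f Set.univ (Set.mem_univ x)
  refine (hNF.meromorphicOrderAt_nonneg_iff_analyticAt.1 ?_).differentiableAt
  rw [meromorphicOrderAt_toMeromorphicNFOn hf' (Set.mem_univ x)]
  exact hord x

theorem exists_eventually_eq_const_of_elliptic (τ : UpperHalfPlane) {h : ℂ → ℂ}
    (hmer : Meromorphic h)
    (hper : ∀ l ∈ (halfPeriodPair τ).lattice, ∀ x, ∀ᶠ z in 𝓝[≠] x, h (z + l) = h z)
    (hord : ∀ x, 0 ≤ meromorphicOrderAt h x + meromorphicOrderAt (thetaOneTilde · τ) x) :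
    ∃ k : ℂ, ∀ x, ∀ᶠ z in 𝓝[≠] x, h z = k := by
  have hϑ := differentiable_thetaOneTilde τ.im_pos
  have hϑmer : Meromorphic (thetaOneTilde · τ) := fun x => (hϑ.analyticAt x).meromorphicAt
  obtain ⟨w, hw, hwh⟩ := exists_differentiable_of_meromorphicOrderAt_nonneg
    (hmer.fun_mul hϑmer) fun x => by
      rw [fun_meromorphicOrderAt_mul (hmer x) (hϑmer x)]
      exact hord x
  -- `w` extends `h ϑ₁`, hence transforms like `ϑ₁`.
  have hadd {l : ℂ} (hl : l ∈ (halfPeriodPair τ).lattice) {e : ℂ → ℂ} (he : Continuous e)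
      (hϑe : ∀ z, thetaOneTilde (z + l) τ = e z * thetaOneTilde z τ) (z : ℂ) :
      w (z + l) = e z * w z := by
    have hc := hw.continuous
    refine eq_of_eventuallyEq_nhdsNE (f := fun z => w (z + l)) (g := fun z => e z * w z)
      (by fun_prop) (by fun_prop) ?_
    filter_upwards [hwh z, (tendsto_add_const_nhdsNE z l).eventually (hwh _), hper l hl z]
      with y hy hyl hyper
    rw [← hy, ← hyl, hyper, hϑe]; ring
  obtain ⟨k, hk⟩ := exists_eq_const_mul_thetaOneTilde τ.im_pos hw
    (fun z => (hadd (halfPeriodPair τ).ω₁_mem_lattice (e := fun _ => -1) continuous_const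
      (fun z => (thetaOneTilde_add_two z τ).trans (neg_one_mul _).symm) z).trans (neg_one_mul _))
    (hadd (halfPeriodPair τ).ω₂_mem_lattice (by fun_prop) fun z => thetaOneTilde_add_two_mul z τ)
  refine ⟨k, fun x => ?_⟩
  filter_upwards [hwh x, eventually_thetaOneTilde_ne_zero τ.im_pos x] with z hz hne
  exact mul_right_cancel₀ hne (hz.trans (hk z))

theorem natCast_le_meromorphicOrderAt {f : ℂ → ℂ} {x : ℂ} {n : ℕ} (hf : AnalyticAt ℂ f x)
    (h : ∀ i < n, iteratedDeriv i f x = 0) : ((n : ℤ) : WithTop ℤ) ≤ meromorphicOrderAt f x := by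
  rw [hf.meromorphicOrderAt_eq]
  exact ENat.monotone_map_iff.2 Nat.mono_cast
    ((natCast_le_analyticOrderAt_iff_iteratedDeriv_eq_zero hf).2 h)

theorem neg_one_le_meromorphicOrderAt_weierstrassZeta_sub (L : PeriodPair) (a x : ℂ) :
    (-1 : ℤ) ≤
      meromorphicOrderAt (fun z => weierstrassZeta L z - weierstrassZeta L (z - a)) x := by
  have hmer := meromorphic_weierstrassZeta L
  have hmer_a : MeromorphicAt (fun z => weierstrassZeta L (z - a)) x :=
    (hmer (x - a)).comp_analyticAt (g := (· - a)) (by fun_prop)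
  simp only [sub_eq_add_neg (weierstrassZeta L _)]
  refine le_trans (le_min (neg_one_le_meromorphicOrderAt_weierstrassZeta L x) ?_)
    (meromorphicOrderAt_add (f₂ := fun z => -weierstrassZeta L (z - a)) (hmer x) hmer_a.fun_neg)
  rw [← meromorphicOrderAt_fun_neg, meromorphicOrderAt_fun_comp_sub_const_eq_meromorphicOrderAt]
  exact neg_one_le_meromorphicOrderAt_weierstrassZeta L (x - a)

theorem eventually_weierstrassZeta_sub_add_coe (L : PeriodPair) (a : ℂ) {l : ℂ}
    (hl : l ∈ L.lattice) (x : ℂ) : ∀ᶠ z in 𝓝[≠] x,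
      weierstrassZeta L (z + l) - weierstrassZeta L (z + l - a) =
        weierstrassZeta L z - weierstrassZeta L (z - a) := by
  obtain ⟨η, hη⟩ := exists_weierstrassZeta_add_coe_eq L hl
  filter_upwards [eventually_notMem_lattice L x,
    (tendsto_add_const_nhdsNE x (-a)).eventually (eventually_notMem_lattice L (x + -a))]
    with z hz hza
  rw [hη z hz, add_sub_right_comm z l a, hη (z - a) hza, add_sub_add_right_eq_sub]

theorem analyticAt_thetaOneTilde (τ : UpperHalfPlane) (z : ℂ) :
    AnalyticAt ℂ (thetaOneTilde · τ) z :=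
  (differentiable_thetaOneTilde τ.im_pos).analyticAt z

section ThetaOne

variable {τ : UpperHalfPlane}

theorem one_le_meromorphicOrderAt_thetaOneTilde {x : ℂ} (hx : thetaOneTilde x τ = 0) :
    (1 : ℤ) ≤ meromorphicOrderAt (thetaOneTilde · τ) x :=
  natCast_le_meromorphicOrderAt (n := 1) (analyticAt_thetaOneTilde τ x) fun i hi => by
    rw [Nat.lt_one_iff.1 hi, iteratedDeriv_zero, hx]

/-! ### The zeros of `ϑ₁` -/

/-- If `ϑ₁` vanished at `a ∉ Λ`, its zeros would compensate all the poles of `ζ(z) - ζ(z - a)`,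
which would thus be constant, although it has a pole at `0`. -/
theorem mem_lattice_of_thetaOneTilde_eq_zero {a : ℂ} (ha : thetaOneTilde a τ = 0) :
    a ∈ (halfPeriodPair τ).lattice := by
  by_contra hna
  set L := halfPeriodPair τ
  have hanalytic : ∀ x, x - a ∉ L.lattice →
      AnalyticAt ℂ (fun z => weierstrassZeta L (z - a)) x :=
    fun x hx => (analyticAt_weierstrassZeta L hx).fun_comp (f := (· - a)) (by fun_prop)
  have hmer : Meromorphic fun z => weierstrassZeta L z - weierstrassZeta L (z - a) := fun x =>
    (meromorphic_weierstrassZeta L x).fun_sub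
      ((meromorphic_weierstrassZeta L (x - a)).comp_analyticAt (g := (· - a)) (by fun_prop))
  have hord : ∀ x, 0 ≤
      meromorphicOrderAt (fun z => weierstrassZeta L z - weierstrassZeta L (z - a)) x +
        meromorphicOrderAt (thetaOneTilde · τ) x := by
    intro x
    by_cases hx : thetaOneTilde x τ = 0
    · exact add_le_add (neg_one_le_meromorphicOrderAt_weierstrassZeta_sub L a x)
        (one_le_meromorphicOrderAt_thetaOneTilde hx)
    · have hxL : x ∉ L.lattice := fun h => hx (thetaOneTilde_eq_zero_of_mem_lattice h)
      have hxa : x - a ∉ L.lattice := fun h => hx (by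
        rwa [← thetaOneTilde_add_eq_zero_iff h, add_sub_cancel] at ha)
      exact add_nonneg
        ((analyticAt_weierstrassZeta L hxL).fun_sub (hanalytic x hxa)).meromorphicOrderAt_nonneg
        (analyticAt_thetaOneTilde τ x).meromorphicOrderAt_nonneg
  obtain ⟨k, hk⟩ := exists_eventually_eq_const_of_elliptic τ hmer
    (fun l hl x => eventually_weierstrassZeta_sub_add_coe L a hl x) hord
  have hcongr : weierstrassZeta L =ᶠ[𝓝[≠] 0] fun z => k + weierstrassZeta L (z - a) := by
    filter_upwards [hk 0] with z hz
    rw [← hz, sub_add_cancel]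
  have hpole := meromorphicOrderAt_congr hcongr
  rw [meromorphicOrderAt_weierstrassZeta L L.lattice.zero_mem] at hpole
  have h0a : 0 - a ∉ L.lattice := fun h => hna (by simpa using h)
  have hnonneg := (analyticAt_const.fun_add (hanalytic 0 h0a) :
    AnalyticAt ℂ (fun z => k + weierstrassZeta L (z - a)) 0).meromorphicOrderAt_nonneg
  exact absurd (hpole ▸ hnonneg) (by decide)

theorem thetaOneTilde_eq_zero_iff {a : ℂ} :
    thetaOneTilde a τ = 0 ↔ a ∈ (halfPeriodPair τ).lattice :=
  ⟨mem_lattice_of_thetaOneTilde_eq_zero, thetaOneTilde_eq_zero_of_mem_lattice⟩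

theorem deriv_thetaOneTilde_add {l α β : ℂ}
    (h : ∀ z, thetaOneTilde (z + l) τ = exp (α + β * z) * thetaOneTilde z τ) (z : ℂ) :
    deriv (thetaOneTilde · τ) (z + l) =
      exp (α + β * z) * (β * thetaOneTilde z τ + deriv (thetaOneTilde · τ) z) := by
  have hexp : HasDerivAt (fun z => exp (α + β * z)) (exp (α + β * z) * β) z :=
    (((hasDerivAt_id' z).const_mul β).const_add α).cexp.congr_deriv (by ring)
  rw [← deriv_comp_add_const, funext h,
    (hexp.fun_mul (differentiable_thetaOneTilde τ.im_pos z).hasDerivAt).deriv]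
  ring

/-- If `ϑ₁` had a double zero on the lattice, its zeros would compensate the poles of `℘`. -/
theorem deriv_thetaOneTilde_ne_zero {l : ℂ} (hl : l ∈ (halfPeriodPair τ).lattice) :
    deriv (thetaOneTilde · τ) l ≠ 0 := by
  intro hl'
  set L := halfPeriodPair τ
  have hderiv : ∀ x ∈ L.lattice, deriv (thetaOneTilde · τ) x = 0 := fun x hx => by
    obtain ⟨α, β, h⟩ := exists_thetaOneTilde_add_eq (L.lattice.sub_mem hx hl)
    have hx' := deriv_thetaOneTilde_add h l
    rwa [add_sub_cancel, hl', thetaOneTilde_eq_zero_of_mem_lattice hl, mul_zero, add_zero,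
      mul_zero] at hx'
  have hord : ∀ x, 0 ≤ meromorphicOrderAt L.weierstrassP x +
      meromorphicOrderAt (thetaOneTilde · τ) x := by
    intro x
    by_cases hx : x ∈ L.lattice
    · have htwo : (2 : ℤ) ≤ meromorphicOrderAt (thetaOneTilde · τ) x :=
        natCast_le_meromorphicOrderAt (n := 2) (analyticAt_thetaOneTilde τ x) fun i hi => by
          interval_cases i
          · rw [iteratedDeriv_zero, thetaOneTilde_eq_zero_of_mem_lattice hx]
          · rw [iteratedDeriv_one, hderiv x hx]
      exact add_le_add (L.order_weierstrassP x hx).ge htwo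
    · exact add_nonneg (L.analyticOnNhd_weierstrassP x hx).meromorphicOrderAt_nonneg
        (analyticAt_thetaOneTilde τ x).meromorphicOrderAt_nonneg
  obtain ⟨k, hk⟩ := exists_eventually_eq_const_of_elliptic τ L.meromorphic_weierstrassP
    (fun l hl x => Eventually.of_forall fun z => L.weierstrassP_add_coe z ⟨l, hl⟩) hord
  exact not_eventually_weierstrassP_eq L k L.lattice.zero_mem (hk 0)

theorem exists_thetaOneTilde_eq_sub_mul {l : ℂ} (hl : l ∈ (halfPeriodPair τ).lattice) :
    ∃ u : ℂ → ℂ, AnalyticAt ℂ u l ∧ u l ≠ 0 ∧ ∀ᶠ z in 𝓝 l, thetaOneTilde z τ = (z - l) * u z := by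
  have han := analyticAt_thetaOneTilde τ l
  simpa only [pow_one, smul_eq_mul] using (han.analyticOrderAt_eq_natCast (n := 1)).1
    (han.analyticOrderAt_eq_one_of_zero_deriv_ne_zero (thetaOneTilde_eq_zero_of_mem_lattice hl)
      (deriv_thetaOneTilde_ne_zero hl))

/-! ### The logarithmic derivative of `ϑ₁` -/

theorem logDeriv_thetaOneTilde_add {l α β : ℂ}
    (h : ∀ z, thetaOneTilde (z + l) τ = exp (α + β * z) * thetaOneTilde z τ) {z : ℂ}
    (hz : z ∉ (halfPeriodPair τ).lattice) :
    logDeriv (thetaOneTilde · τ) (z + l) = β + logDeriv (thetaOneTilde · τ) z := by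
  have hϑ : thetaOneTilde z τ ≠ 0 := fun h0 => hz (thetaOneTilde_eq_zero_iff.1 h0)
  simp only [logDeriv_apply, deriv_thetaOneTilde_add h, h]
  have hexp := Complex.exp_ne_zero (α + β * z)
  field_simp

theorem logDeriv_thetaOneTilde_neg (z : ℂ) :
    logDeriv (thetaOneTilde · τ) (-z) = -logDeriv (thetaOneTilde · τ) z := by
  have hderiv : deriv (thetaOneTilde · τ) (-z) = deriv (thetaOneTilde · τ) z := by
    rw [← neg_inj, ← deriv_comp_neg, ← deriv.fun_neg]
    simp only [thetaOneTilde_neg]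
  rw [logDeriv_apply, logDeriv_apply, hderiv, thetaOneTilde_neg, div_neg]

theorem analyticAt_logDeriv_thetaOneTilde {z : ℂ} (hz : z ∉ (halfPeriodPair τ).lattice) :
    AnalyticAt ℂ (logDeriv (thetaOneTilde · τ)) z :=
  (analyticAt_thetaOneTilde τ z).deriv.div (analyticAt_thetaOneTilde τ z)
    fun h => hz (thetaOneTilde_eq_zero_iff.1 h)

/-- The simple poles of `ζ` and of the logarithmic derivative of `ϑ₁` cancel. -/
theorem exists_eventuallyEq_logDeriv_thetaOneTilde_sub {l : ℂ}
    (hl : l ∈ (halfPeriodPair τ).lattice) :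
    ∃ g : ℂ → ℂ, AnalyticAt ℂ g l ∧
      logDeriv (thetaOneTilde · τ) - weierstrassZeta (halfPeriodPair τ) =ᶠ[𝓝[≠] l] g := by
  obtain ⟨g, hg, hζ⟩ := exists_weierstrassZeta_eq_inv_add (halfPeriodPair τ) hl
  obtain ⟨u, hu, hul, hϑ⟩ := exists_thetaOneTilde_eq_sub_mul hl
  refine ⟨logDeriv u - g, (hu.deriv.div hu hul).sub hg, ?_⟩
  filter_upwards [nhdsWithin_le_nhds (eventually_eventually_nhds.2 hϑ), self_mem_nhdsWithin,
    nhdsWithin_le_nhds (hu.continuousAt.eventually_ne hul),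
    nhdsWithin_le_nhds hu.eventually_analyticAt] with z hϑz hzl huz huan
  have hzl' : z - l ≠ 0 := sub_ne_zero.2 hzl
  have hlog : logDeriv (· - l) z = 1 / (z - l) := by
    rw [logDeriv_apply, deriv_sub_const, deriv_id'']
  rw [Pi.sub_apply, Pi.sub_apply, hζ, (logDeriv_congr_nhds hϑz).eq_of_nhds,
    logDeriv_mul z hzl' huz (by fun_prop) huan.differentiableAt, hlog, add_sub_add_left_eq_sub]

theorem exists_differentiable_eq_logDeriv_thetaOneTilde_sub (τ : UpperHalfPlane) :
    ∃ K : ℂ → ℂ, Differentiable ℂ K ∧ ∀ z ∉ (halfPeriodPair τ).lattice,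
      K z = logDeriv (thetaOneTilde · τ) z - weierstrassZeta (halfPeriodPair τ) z := by
  set L := halfPeriodPair τ
  have hanalytic : ∀ x, ∃ g : ℂ → ℂ, AnalyticAt ℂ g x ∧
      logDeriv (thetaOneTilde · τ) - weierstrassZeta L =ᶠ[𝓝[≠] x] g := fun x => by
    by_cases hx : x ∈ L.lattice
    · exact exists_eventuallyEq_logDeriv_thetaOneTilde_sub hx
    · exact ⟨_, (analyticAt_logDeriv_thetaOneTilde hx).sub (analyticAt_weierstrassZeta L hx), .rfl⟩
  obtain ⟨K, hK, hKeq⟩ := exists_differentiable_of_meromorphicOrderAt_nonneg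
    (f := logDeriv (thetaOneTilde · τ) - weierstrassZeta L)
    (fun x => by
      obtain ⟨g, hg, hgeq⟩ := hanalytic x
      exact hg.meromorphicAt.congr hgeq.symm)
    (fun x => by
      obtain ⟨g, hg, hgeq⟩ := hanalytic x
      rw [meromorphicOrderAt_congr hgeq]
      exact hg.meromorphicOrderAt_nonneg)
  refine ⟨K, hK, fun z hz => (eq_of_eventuallyEq_nhdsNE ?_ (hK z).continuousAt (hKeq z)).symm⟩
  exact ((analyticAt_logDeriv_thetaOneTilde hz).sub (analyticAt_weierstrassZeta L hz)).continuousAt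

theorem exists_eq_mul_add_of_add_lattice_eq (L : PeriodPair) {K : ℂ → ℂ}
    (hK : Differentiable ℂ K) (hadd : ∀ l ∈ L.lattice, ∃ η, ∀ z, K (z + l) = K z + η) :
    ∃ c, ∀ z, K z = c * z + K 0 := by
  have hK' : Differentiable ℂ (deriv K) := fun z => (hK.analyticAt z).deriv.differentiableAt
  have hper : ∀ z, ∀ l ∈ L.lattice, deriv K (z + l) = deriv K z := fun z l hl => by
    obtain ⟨η, hη⟩ := hadd l hl
    rw [← deriv_comp_add_const, funext hη, deriv_add_const]
  have hconst : ∀ z, deriv K z = deriv K 0 := fun z =>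
    hK'.apply_eq_apply_of_bounded
      (IsZLattice.isCompact_range_of_periodic L.lattice _ hK'.continuous hper).isBounded z 0
  refine ⟨deriv K 0, fun z => ?_⟩
  have hderiv : ∀ z, HasDerivAt (fun z => K z - deriv K 0 * z) 0 z := fun z =>
    ((hK z).hasDerivAt.sub ((hasDerivAt_id' z).const_mul _)).congr_deriv (by rw [hconst]; ring)
  have hz := is_const_of_deriv_eq_zero (fun z => (hderiv z).differentiableAt)
    (fun z => (hderiv z).deriv) z 0
  linear_combination hz

theorem exists_logDeriv_thetaOneTilde_eq (τ : UpperHalfPlane) :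
    ∃ c : ℂ, ∀ z ∉ (halfPeriodPair τ).lattice,
      logDeriv (thetaOneTilde · τ) z = zetaTau z τ + c * z := by
  set L := halfPeriodPair τ
  obtain ⟨K, hK, hKeq⟩ := exists_differentiable_eq_logDeriv_thetaOneTilde_sub τ
  obtain ⟨c, hc⟩ := exists_eq_mul_add_of_add_lattice_eq L hK fun l hl => by
    obtain ⟨α, β, hϑ⟩ := exists_thetaOneTilde_add_eq hl
    obtain ⟨η, hη⟩ := exists_weierstrassZeta_add_coe_eq L hl
    refine ⟨β - η, fun x => ?_⟩
    have hcont := hK.continuous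
    refine eq_of_eventuallyEq_nhdsNE (f := fun z => K (z + l)) (g := fun z => K z + (β - η))
      (by fun_prop) (by fun_prop) ?_
    filter_upwards [eventually_notMem_lattice L x] with z hz
    have hzl : z + l ∉ L.lattice := fun h => hz (by simpa using L.lattice.sub_mem h hl)
    rw [hKeq z hz, hKeq (z + l) hzl, logDeriv_thetaOneTilde_add hϑ hz, hη z hz]
    ring
  have hK0 : K 0 = 0 := by
    have h1 : 1 ∉ L.lattice := by
      simpa [L, halfPeriodPair] using L.ω₁_div_two_notMem_lattice
    have hpos := hKeq 1 h1
    have hneg := hKeq (-1) (by simpa using h1)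
    rw [hc] at hpos
    rw [hc, logDeriv_thetaOneTilde_neg, weierstrassZeta_neg] at hneg
    linear_combination (hpos + hneg) / 2
  refine ⟨c, fun z hz => ?_⟩
  have hζ : zetaTau z τ = weierstrassZeta L z := rfl
  linear_combination hc z - hKeq z hz + hK0 - hζ

end ThetaOne

/-! ### The values of `℘` at the half periods -/

theorem neg_one_le_meromorphicOrderAt_of_eventuallyEq_div_sq {f N : ℂ → ℂ} {x : ℂ}
    (hN : AnalyticAt ℂ N x) (hNx : N x = 0) (hf : f =ᶠ[𝓝[≠] x] fun z => N z / (z - x) ^ 2) :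
    (-1 : ℤ) ≤ meromorphicOrderAt f x := by
  have hpow : MeromorphicAt (· - x) x := MeromorphicAt.id x |>.sub (MeromorphicAt.const x x)
  have hN_ord : ((1 : ℤ) : WithTop ℤ) ≤ meromorphicOrderAt N x :=
    natCast_le_meromorphicOrderAt (n := 1) hN fun i hi => by
      rw [Nat.lt_one_iff.1 hi, iteratedDeriv_zero, hNx]
  have hf' : f =ᶠ[𝓝[≠] x] N * (· - x) ^ (-2 : ℤ) :=
    hf.trans (.of_forall fun z => div_eq_mul_inv _ _)
  rw [meromorphicOrderAt_congr hf', meromorphicOrderAt_mul hN.meromorphicAt (hpow.zpow _),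
    meromorphicOrderAt_zpow_id_sub_const]
  exact add_le_add_left hN_ord _

/-- `ϑ₁(z + a) ϑ₁(z - a) / ϑ₁(z)²`, an elliptic function of `z` with divisor `[a] + [-a] - 2[0]`. -/
noncomputable def thetaQuotient (τ a z : ℂ) : ℂ :=
  thetaOneTilde (z + a) τ * thetaOneTilde (z - a) τ / thetaOneTilde z τ ^ 2

section HalfPeriods

variable {τ : UpperHalfPlane}

theorem thetaQuotient_add_coe (a : ℂ) {l : ℂ} (hl : l ∈ (halfPeriodPair τ).lattice) (z : ℂ) :
    thetaQuotient τ a (z + l) = thetaQuotient τ a z := by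
  obtain ⟨α, β, h⟩ := exists_thetaOneTilde_add_eq hl
  have hexp : exp (α + β * (z + a)) * exp (α + β * (z - a)) = exp (α + β * z) ^ 2 := by
    rw [← Complex.exp_add, ← Complex.exp_nat_mul]; congr 1; push_cast; ring
  rw [thetaQuotient, add_right_comm, add_sub_right_comm, h, h, h, mul_mul_mul_comm, hexp, mul_pow,
    mul_div_mul_left _ _ (pow_ne_zero 2 (Complex.exp_ne_zero _)), thetaQuotient]

theorem meromorphic_thetaQuotient (a : ℂ) : Meromorphic (thetaQuotient τ a) := fun z =>
  ((((analyticAt_thetaOneTilde τ (z + a)).fun_comp (f := (· + a)) (by fun_prop)).mul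
    ((analyticAt_thetaOneTilde τ (z - a)).fun_comp (f := (· - a)) (by fun_prop))).meromorphicAt).div
    ((analyticAt_thetaOneTilde τ z).pow 2).meromorphicAt

theorem analyticAt_thetaQuotient (a : ℂ) {z : ℂ} (hz : z ∉ (halfPeriodPair τ).lattice) :
    AnalyticAt ℂ (thetaQuotient τ a) z :=
  (((analyticAt_thetaOneTilde τ (z + a)).fun_comp (f := (· + a)) (by fun_prop)).mul
    ((analyticAt_thetaOneTilde τ (z - a)).fun_comp (f := (· - a)) (by fun_prop))).div
    ((analyticAt_thetaOneTilde τ z).pow 2)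
    (pow_ne_zero 2 fun h => hz (thetaOneTilde_eq_zero_iff.1 h))

theorem exists_neg_one_le_meromorphicOrderAt_thetaQuotient_sub (τ : UpperHalfPlane) (a : ℂ) :
    ∃ k : ℂ, (-1 : ℤ) ≤
      meromorphicOrderAt (fun z => thetaQuotient τ a z - k * (halfPeriodPair τ).weierstrassP z)
        0 := by
  have hadd : AnalyticAt ℂ (fun z => thetaOneTilde (z + a) τ) 0 :=
    (analyticAt_thetaOneTilde τ (0 + a)).fun_comp (f := (· + a)) (by fun_prop)
  have hsub : AnalyticAt ℂ (fun z => thetaOneTilde (z - a) τ) 0 :=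
    (analyticAt_thetaOneTilde τ (0 - a)).fun_comp (f := (· - a)) (by fun_prop)
  have h0 := (halfPeriodPair τ).lattice.zero_mem
  obtain ⟨g, hg, hP⟩ := exists_weierstrassP_eq_inv_sq_add (halfPeriodPair τ) h0
  obtain ⟨u, hu, hu0, hϑ⟩ := exists_thetaOneTilde_eq_sub_mul h0
  have hquot := (hadd.fun_mul hsub).fun_div (hu.fun_pow 2) (pow_ne_zero 2 hu0)
  set q : ℂ → ℂ := fun z => thetaOneTilde (z + a) τ * thetaOneTilde (z - a) τ / u z ^ 2
  have hN : AnalyticAt ℂ (fun z => q z - q 0 * (1 + z ^ 2 * g z)) 0 := by fun_prop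
  refine ⟨q 0, neg_one_le_meromorphicOrderAt_of_eventuallyEq_div_sq hN (by simp) ?_⟩
  filter_upwards [nhdsWithin_le_nhds hϑ, self_mem_nhdsWithin,
    nhdsWithin_le_nhds (hu.continuousAt.eventually_ne hu0)] with z hϑz hz huz
  simp only [sub_zero] at hϑz hP ⊢
  rw [thetaQuotient, hP, hϑz]
  have hz' : z ≠ 0 := hz
  simp only [q]
  field_simp

/-- Subtracting a multiple of `℘` from `ϑ₁(z + a) ϑ₁(z - a) / ϑ₁(z)²` to lower the order of its
poles leaves a constant. -/
theorem exists_thetaQuotient_eq (τ : UpperHalfPlane) {a : ℂ}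
    (ha : a ∉ (halfPeriodPair τ).lattice) :
    ∃ k : ℂ, ∀ z ∉ (halfPeriodPair τ).lattice, thetaQuotient τ a z =
      k * ((halfPeriodPair τ).weierstrassP z - (halfPeriodPair τ).weierstrassP a) := by
  set L := halfPeriodPair τ
  obtain ⟨k, hk⟩ := exists_neg_one_le_meromorphicOrderAt_thetaQuotient_sub τ a
  set h : ℂ → ℂ := fun z => thetaQuotient τ a z - k * L.weierstrassP z
  have hper : ∀ l ∈ L.lattice, ∀ z, h (z + l) = h z := fun l hl z => by
    have hP := L.weierstrassP_add_coe z ⟨l, hl⟩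
    simp only [h, thetaQuotient_add_coe a hl, hP]
  have hanalytic : ∀ x ∉ L.lattice, AnalyticAt ℂ h x := fun x hx =>
    (analyticAt_thetaQuotient a hx).fun_sub
      (analyticAt_const.fun_mul (L.analyticOnNhd_weierstrassP x hx))
  have hmer : Meromorphic h := fun x => (meromorphic_thetaQuotient a x).fun_sub
    ((MeromorphicAt.const k x).fun_mul (L.meromorphic_weierstrassP x))
  have hord : ∀ x, 0 ≤ meromorphicOrderAt h x + meromorphicOrderAt (thetaOneTilde · τ) x := by
    intro x
    by_cases hx : x ∈ L.lattice
    · have htranslate : (fun z => h (z - x)) = h := funext fun z => by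
        rw [← hper x hx, sub_add_cancel]
      have hpole : (-1 : ℤ) ≤ meromorphicOrderAt h x := by
        rwa [← htranslate, meromorphicOrderAt_fun_comp_sub_const_eq_meromorphicOrderAt, sub_self]
      exact add_le_add hpole
        (one_le_meromorphicOrderAt_thetaOneTilde (thetaOneTilde_eq_zero_of_mem_lattice hx))
    · exact add_nonneg (hanalytic x hx).meromorphicOrderAt_nonneg
        (analyticAt_thetaOneTilde τ x).meromorphicOrderAt_nonneg
  obtain ⟨m, hm⟩ := exists_eventually_eq_const_of_elliptic τ hmer
    (fun l hl x => .of_forall (hper l hl)) hord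
  have hconst : ∀ z ∉ L.lattice, h z = m := fun z hz =>
    eq_of_eventuallyEq_nhdsNE (hanalytic z hz).continuousAt continuousAt_const (hm z)
  have hzero : thetaQuotient τ a a = 0 := by
    rw [thetaQuotient, sub_self, thetaOneTilde_eq_zero_of_mem_lattice L.lattice.zero_mem, mul_zero,
      zero_div]
  exact ⟨k, fun z hz => by linear_combination hconst z hz - hconst a ha + hzero⟩

theorem weierstrassP_ne {a b : ℂ} (ha : a ∉ (halfPeriodPair τ).lattice)
    (hb : b ∉ (halfPeriodPair τ).lattice) (hadd : b + a ∉ (halfPeriodPair τ).lattice)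
    (hsub : b - a ∉ (halfPeriodPair τ).lattice) :
    (halfPeriodPair τ).weierstrassP b ≠ (halfPeriodPair τ).weierstrassP a := by
  intro hab
  obtain ⟨k, hk⟩ := exists_thetaQuotient_eq τ ha
  have hb' := hk b hb
  rw [hab, sub_self, mul_zero, thetaQuotient] at hb'
  simp [thetaOneTilde_eq_zero_iff, hb, hadd, hsub] at hb'

/-- The even thetas are obtained from `ϑ₁` by translation by `1`, `1 - τ`, `-τ`. -/
noncomputable def thetaShift (τ : ℂ) : Fin 3 → ℂ := ![1, 1 - τ, -τ]

theorem mem_halfPeriodPair_lattice {z : ℂ} :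
    z ∈ (halfPeriodPair τ).lattice ↔ ∃ m n : ℤ, z = 2 * m + 2 * n * τ := by
  rw [PeriodPair.mem_lattice]
  refine exists_congr fun m => exists_congr fun n => ?_
  rw [eq_comm, halfPeriodPair]
  ring_nf

theorem intCast_add_mul_mem_lattice_iff {m n : ℤ} :
    (m + n * τ : ℂ) ∈ (halfPeriodPair τ).lattice ↔ Even m ∧ Even n := by
  rw [mem_halfPeriodPair_lattice]
  constructor
  · rintro ⟨p, q, h⟩
    have him : (n : ℝ) * τ.im = 2 * q * τ.im := by simpa using congrArg Complex.im h
    have hn : (n : ℝ) = 2 * q := mul_right_cancel₀ τ.im_ne_zero him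
    have hm : (m : ℝ) = 2 * p := by
      have hre : m + n * τ.re = 2 * p + 2 * q * τ.re := by simpa using congrArg Complex.re h
      rwa [hn, add_left_inj] at hre
    exact ⟨even_iff_exists_two_mul.2 ⟨p, by exact_mod_cast hm⟩,
      even_iff_exists_two_mul.2 ⟨q, by exact_mod_cast hn⟩⟩
  · rintro ⟨⟨p, rfl⟩, ⟨q, rfl⟩⟩
    exact ⟨p, q, by push_cast; ring⟩

theorem thetaShift_eq (τ : ℂ) (j : Fin 3) :
    thetaShift τ j = (![1, 1, 0] j : ℤ) + (![0, -1, -1] j : ℤ) * τ := by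
  fin_cases j <;> simp [thetaShift, sub_eq_add_neg]

theorem two_mul_thetaShift_mem_lattice (j : Fin 3) :
    2 * thetaShift τ j ∈ (halfPeriodPair τ).lattice :=
  mem_halfPeriodPair_lattice.2 ⟨![1, 1, 0] j, ![0, -1, -1] j, by rw [thetaShift_eq]; ring⟩

theorem thetaShift_notMem_lattice (j : Fin 3) : thetaShift τ j ∉ (halfPeriodPair τ).lattice := by
  rw [thetaShift_eq, intCast_add_mul_mem_lattice_iff]
  revert j; decide

theorem weierstrassP_thetaShift_ne {i j : Fin 3} (hij : i ≠ j) :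
    (halfPeriodPair τ).weierstrassP (thetaShift τ i) ≠
      (halfPeriodPair τ).weierstrassP (thetaShift τ j) := by
  refine weierstrassP_ne (thetaShift_notMem_lattice j) (thetaShift_notMem_lattice i) ?_ ?_
  · rw [thetaShift_eq, thetaShift_eq, add_add_add_comm, ← add_mul, ← Int.cast_add, ← Int.cast_add,
      intCast_add_mul_mem_lattice_iff]
    revert i j; decide
  · rw [thetaShift_eq, thetaShift_eq, add_sub_add_comm, ← sub_mul, ← Int.cast_sub, ← Int.cast_sub,
      intCast_add_mul_mem_lattice_iff]
    revert i j; decide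

theorem sum_eq_zero_of_cubic_roots {e₁ e₂ e₃ g₂ g₃ : ℂ} (h12 : e₁ ≠ e₂) (h13 : e₁ ≠ e₃)
    (h23 : e₂ ≠ e₃) (h1 : 4 * e₁ ^ 3 - g₂ * e₁ - g₃ = 0) (h2 : 4 * e₂ ^ 3 - g₂ * e₂ - g₃ = 0)
    (h3 : 4 * e₃ ^ 3 - g₂ * e₃ - g₃ = 0) :
    e₁ + e₂ + e₃ = 0 ∧ g₂ = 2 * (e₁ ^ 2 + e₂ ^ 2 + e₃ ^ 2) := by
  have h12' : 4 * (e₁ ^ 2 + e₁ * e₂ + e₂ ^ 2) - g₂ = 0 :=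
    mul_left_cancel₀ (sub_ne_zero.2 h12) (by linear_combination h1 - h2)
  have h13' : 4 * (e₁ ^ 2 + e₁ * e₃ + e₃ ^ 2) - g₂ = 0 :=
    mul_left_cancel₀ (sub_ne_zero.2 h13) (by linear_combination h1 - h3)
  have hsum : e₁ + e₂ + e₃ = 0 :=
    mul_left_cancel₀ (sub_ne_zero.2 h23) (by linear_combination (h12' - h13') / 4)
  refine ⟨hsum, ?_⟩
  obtain rfl : e₃ = -e₁ - e₂ := by linear_combination hsum
  linear_combination -h12'

theorem weierstrassP_thetaShift_sum (τ : UpperHalfPlane) :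
    wpTau (thetaShift τ 0) τ + wpTau (thetaShift τ 1) τ + wpTau (thetaShift τ 2) τ = 0 ∧
      (halfPeriodPair τ).g₂ = 2 * (wpTau (thetaShift τ 0) τ ^ 2 + wpTau (thetaShift τ 1) τ ^ 2 +
        wpTau (thetaShift τ 2) τ ^ 2) := by
  set L := halfPeriodPair τ
  have hcubic : ∀ j, 4 * L.weierstrassP (thetaShift τ j) ^ 3 -
      L.g₂ * L.weierstrassP (thetaShift τ j) - L.g₃ = 0 :=
    fun j => by
      rw [ ← L.derivWeierstrassP_sq _ (thetaShift_notMem_lattice j),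
        derivWeierstrassP_eq_zero_of_two_mul_mem L (two_mul_thetaShift_mem_lattice j), sq, mul_zero]
  exact sum_eq_zero_of_cubic_roots (weierstrassP_thetaShift_ne (by decide))
    (weierstrassP_thetaShift_ne (by decide)) (weierstrassP_thetaShift_ne (by decide))
    (hcubic 0) (hcubic 1) (hcubic 2)

end HalfPeriods

/-! ### Taylor coefficients of the even theta functions -/

section IteratedLogDeriv

variable {V : Set ℂ} {f B A A' A'' : ℂ → ℂ}

theorem eqOn_deriv_of_hasDerivAt (hV : IsOpen V) {g G g' : ℂ → ℂ} (hgG : Set.EqOn g G V)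
    (hG : ∀ z ∈ V, HasDerivAt G (g' z) z) : Set.EqOn (deriv g) g' V := fun z hz =>
  ((hG z hz).congr_of_eventuallyEq (hgG.eventuallyEq_of_mem (hV.mem_nhds hz))).deriv

theorem eqOn_iterate_deriv_two (hV : IsOpen V) (hf : ∀ z ∈ V, HasDerivAt f (f z * B z) z)
    (hB : ∀ z ∈ V, HasDerivAt B (A z) z) :
    Set.EqOn (deriv^[2] f) (fun z => f z * (B z ^ 2 + A z)) V :=
  eqOn_deriv_of_hasDerivAt hV (fun z hz => (hf z hz).deriv) fun z hz =>
    ((hf z hz).fun_mul (hB z hz)).congr_deriv (by ring)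

theorem eqOn_iterate_deriv_four (hV : IsOpen V) (hf : ∀ z ∈ V, HasDerivAt f (f z * B z) z)
    (hB : ∀ z ∈ V, HasDerivAt B (A z) z) (hA : ∀ z ∈ V, HasDerivAt A (A' z) z)
    (hA' : ∀ z ∈ V, HasDerivAt A' (A'' z) z) :
    Set.EqOn (deriv^[4] f) (fun z => f z *
      (B z ^ 4 + 6 * B z ^ 2 * A z + 4 * B z * A' z + 3 * A z ^ 2 + A'' z)) V := by
  have hthird : Set.EqOn (deriv^[3] f) (fun z => f z * (B z ^ 3 + 3 * (B z * A z) + A' z)) V :=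
    eqOn_deriv_of_hasDerivAt hV (eqOn_iterate_deriv_two hV hf hB) fun z hz =>
      ((hf z hz).fun_mul (((hB z hz).fun_pow 2).fun_add (hA z hz))).congr_deriv
        (by push_cast; ring)
  exact eqOn_deriv_of_hasDerivAt hV hthird fun z hz =>
    ((hf z hz).fun_mul ((((hB z hz).fun_pow 3).fun_add
      (((hB z hz).fun_mul (hA z hz)).const_mul 3)).fun_add (hA' z hz))).congr_deriv
      (by push_cast; ring)

end IteratedLogDeriv

theorem deriv_zero_of_even {f : ℂ → ℂ} (hf : ∀ z, f (-z) = f z) : deriv f 0 = 0 := by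
  have h := deriv_comp_neg f 0
  simp only [hf, neg_zero] at h
  linear_combination h / 2

section ThetaTranslate

variable {τ : UpperHalfPlane} {c ω α β : ℂ} {f : ℂ → ℂ}

theorem hasDerivAt_exp_mul_thetaOneTilde
    (hc : ∀ z ∉ (halfPeriodPair τ).lattice, logDeriv (thetaOneTilde · τ) z = zetaTau z τ + c * z)
    (hf : ∀ z, f z = exp (α + β * z) * thetaOneTilde (z + ω) τ) {z : ℂ}
    (hz : z + ω ∉ (halfPeriodPair τ).lattice) :
    HasDerivAt f (f z * (β + weierstrassZeta (halfPeriodPair τ) (z + ω) + c * (z + ω))) z := by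
  have hexp : HasDerivAt (fun z => exp (α + β * z)) (exp (α + β * z) * β) z :=
    (((hasDerivAt_id' z).const_mul β).const_add α).cexp.congr_deriv (by ring)
  have hϑ := (differentiable_thetaOneTilde τ.im_pos (z + ω)).hasDerivAt.comp_add_const z ω
  have hne : thetaOneTilde (z + ω) τ ≠ 0 := fun h => hz (thetaOneTilde_eq_zero_iff.1 h)
  have hlog := hc _ hz
  rw [logDeriv_apply, div_eq_iff hne] at hlog
  rw [funext hf]
  refine (hexp.fun_mul hϑ).congr_deriv ?_
  rw [hlog, show zetaTau (z + ω) τ = weierstrassZeta (halfPeriodPair τ) (z + ω) from rfl]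
  ring

/-- Since `f` is even, its logarithmic derivative `B z = β + ζ(z + ω) + c (z + ω)` vanishes at `0`,
and so does `B'' z = -℘'(z + ω)` because `ω` is a half period. -/
theorem iterate_deriv_exp_mul_thetaOneTilde
    (hc : ∀ z ∉ (halfPeriodPair τ).lattice, logDeriv (thetaOneTilde · τ) z = zetaTau z τ + c * z)
    (hω : ω ∉ (halfPeriodPair τ).lattice) (h2ω : 2 * ω ∈ (halfPeriodPair τ).lattice)
    (hf : ∀ z, f z = exp (α + β * z) * thetaOneTilde (z + ω) τ) (heven : ∀ z, f (-z) = f z) :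
    f 0 ≠ 0 ∧ deriv^[2] f 0 = (c - wpTau ω τ) * f 0 ∧
      deriv^[4] f 0 = (3 * (c - wpTau ω τ) ^ 2 - 6 * wpTau ω τ ^ 2 + (halfPeriodPair τ).g₂ / 2) *
        f 0 := by
  set L := halfPeriodPair τ
  set V : Set ℂ := {z | z + ω ∉ L.lattice}
  have hV : IsOpen V := L.isClosed_lattice.isOpen_compl.preimage (continuous_add_const ω)
  have h0V : (0 : ℂ) ∈ V := by simpa [V] using hω
  have hf' : ∀ z ∈ V, HasDerivAt f (f z * (β + weierstrassZeta L (z + ω) + c * (z + ω))) z :=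
    fun z hz => hasDerivAt_exp_mul_thetaOneTilde hc hf hz
  have hB : ∀ z ∈ V, HasDerivAt (fun z => β + weierstrassZeta L (z + ω) + c * (z + ω))
      (c - L.weierstrassP (z + ω)) z := fun z hz =>
    ((((hasDerivAt_weierstrassZeta L hz).comp_add_const z ω).const_add β).fun_add
      (((hasDerivAt_id' z).add_const ω).const_mul c)).congr_deriv (by ring)
  have hA : ∀ z ∈ V, HasDerivAt (fun z => c - L.weierstrassP (z + ω))
      (-L.derivWeierstrassP (z + ω)) z := fun z hz =>
    ((hasDerivAt_weierstrassP L hz).comp_add_const z ω).const_sub c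
  have hA' : ∀ z ∈ V, HasDerivAt (fun z => -L.derivWeierstrassP (z + ω))
      (-(6 * L.weierstrassP (z + ω) ^ 2 - L.g₂ / 2)) z := fun z hz =>
    ((hasDerivAt_derivWeierstrassP L hz).comp_add_const z ω).fun_neg
  have hf0 : f 0 ≠ 0 := by
    rw [hf, zero_add]
    exact mul_ne_zero (Complex.exp_ne_zero _) fun h => hω (thetaOneTilde_eq_zero_iff.1 h)
  have hB0 : β + weierstrassZeta L (0 + ω) + c * (0 + ω) = 0 :=
    (mul_eq_zero.1 ((hf' 0 h0V).deriv ▸ deriv_zero_of_even heven)).resolve_left hf0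
  rw [zero_add] at hB0
  have hP : wpTau ω τ = L.weierstrassP ω := rfl
  refine ⟨hf0, ?_, ?_⟩
  · rw [eqOn_iterate_deriv_two hV hf' hB h0V]
    simp only [zero_add, hB0, hP]
    ring
  · rw [eqOn_iterate_deriv_four hV hf' hB hA hA' h0V]
    simp only [zero_add, hB0, hP, derivWeierstrassP_eq_zero_of_two_mul_mem L h2ω]
    ring

end ThetaTranslate

/-- `ϑ₂, ϑ₃, ϑ₄` at `(π z / 2; τ)`. -/
noncomputable def thetaEven (j : Fin 3) (z τ : ℂ) : ℂ :=
  ![thetaTwo (π * z / 2) τ, thetaThree (π * z / 2) τ, thetaFour (π * z / 2) τ] j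

theorem thetaEven_zero_right (j : Fin 3) (τ : ℂ) : thetaEven j 0 τ = thetaNull j τ := by
  fin_cases j <;> simp [thetaEven, thetaNull]

theorem thetaEven_zero_eq (z τ : ℂ) : thetaEven 0 z τ = thetaOneTilde (z + 1) τ := by
  simp only [thetaEven, thetaTwo, thetaOneTilde, Matrix.cons_val_zero]
  congr 1; ring

theorem thetaEven_one_eq (z τ : ℂ) : thetaEven 1 z τ = jacobiTheta₂ (z / 2) τ := by
  have hpi : (π : ℂ) ≠ 0 := by exact_mod_cast Real.pi_ne_zero
  change thetaFour (π * z / 2 + π / 2) τ = _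
  rw [thetaFour_eq_jacobiTheta₂, ← jacobiTheta₂_add_left (z / 2)]
  congr 1; field_simp; ring

theorem thetaEven_two_eq (z τ : ℂ) : thetaEven 2 z τ = jacobiTheta₂ (z / 2 + 1 / 2) τ := by
  have hpi : (π : ℂ) ≠ 0 := by exact_mod_cast Real.pi_ne_zero
  simp only [thetaEven, Matrix.cons_val, thetaFour_eq_jacobiTheta₂]
  congr 1; field_simp

theorem thetaEven_neg (j : Fin 3) (z τ : ℂ) : thetaEven j (-z) τ = thetaEven j z τ := by
  match j with
  | 0 =>
    rw [thetaEven_zero_eq, thetaEven_zero_eq, show -z + 1 = -(z - 1) by ring, thetaOneTilde_neg,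
      ← thetaOneTilde_add_two]
    congr 1; ring
  | 1 => rw [thetaEven_one_eq, thetaEven_one_eq, neg_div, jacobiTheta₂_neg_left]
  | 2 =>
    rw [thetaEven_two_eq, thetaEven_two_eq, ← jacobiTheta₂_neg_left, ← jacobiTheta₂_add_left]
    congr 1; ring

theorem exists_thetaEven_eq (j : Fin 3) (τ : ℂ) : ∃ α β : ℂ, ∀ z,
    thetaEven j z τ = exp (α + β * z) * thetaOneTilde (z + thetaShift τ j) τ := by
  match j with
  | 0 => exact ⟨0, 0, fun z => by simpa [thetaShift] using thetaEven_zero_eq z τ⟩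
  | 1 =>
    refine ⟨π / 2 * I - π * I * (1 / 2 - τ / 4), -(π * I / 2), fun z => ?_⟩
    have hexp : exp (π / 2 * I - π * I * (1 / 2 - τ / 4) + -(π * I / 2) * z) *
        exp (π * I * ((z + (1 - τ)) / 2 + τ / 4)) = I := by
      rw [← Complex.exp_add]
      exact (congrArg exp (by ring)).trans Complex.exp_pi_div_two_mul_I
    rw [thetaEven_one_eq, thetaOneTilde_eq_jacobiTheta₂, show thetaShift τ 1 = 1 - τ from rfl,
      show (z + (1 - τ)) / 2 + τ / 2 + 1 / 2 = z / 2 + 1 by ring, jacobiTheta₂_add_left]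
    linear_combination I * jacobiTheta₂ (z / 2) τ * hexp + jacobiTheta₂ (z / 2) τ * Complex.I_sq
  | 2 =>
    refine ⟨π / 2 * I + π * I * τ / 4, -(π * I / 2), fun z => ?_⟩
    have hexp : exp (π / 2 * I + π * I * τ / 4 + -(π * I / 2) * z) *
        exp (π * I * ((z + -τ) / 2 + τ / 4)) = I := by
      rw [← Complex.exp_add]
      exact (congrArg exp (by ring)).trans Complex.exp_pi_div_two_mul_I
    rw [thetaEven_two_eq, thetaOneTilde_eq_jacobiTheta₂, show thetaShift τ 2 = -τ from rfl,
      show (z + -τ) / 2 + τ / 2 + 1 / 2 = z / 2 + 1 / 2 by ring]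
    linear_combination I * jacobiTheta₂ (z / 2 + 1 / 2) τ * hexp +
      jacobiTheta₂ (z / 2 + 1 / 2) τ * Complex.I_sq

theorem exists_thetaEven_taylor (τ : UpperHalfPlane) : ∃ (c : ℂ) (e : Fin 3 → ℂ),
    (∀ z ∉ (halfPeriodPair τ).lattice,
      logDeriv (thetaOneTilde · τ) z = zetaTau z τ + c * z) ∧
    e 0 + e 1 + e 2 = 0 ∧
    ∀ j, thetaNull j τ ≠ 0 ∧
      deriv^[2] (fun z => thetaEven j z τ) 0 = (c - e j) * thetaNull j τ ∧
      deriv^[4] (fun z => thetaEven j z τ) 0 =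
        (3 * (c - e j) ^ 2 - 6 * e j ^ 2 + (e 0 ^ 2 + e 1 ^ 2 + e 2 ^ 2)) * thetaNull j τ := by
  obtain ⟨c, hc⟩ := exists_logDeriv_thetaOneTilde_eq τ
  obtain ⟨hsum, hg₂⟩ := weierstrassP_thetaShift_sum τ
  refine ⟨c, fun j => wpTau (thetaShift τ j) τ, hc, hsum, fun j => ?_⟩
  obtain ⟨α, β, hf⟩ := exists_thetaEven_eq j τ
  obtain ⟨hne, hderiv₂, hderiv₄⟩ := iterate_deriv_exp_mul_thetaOneTilde hc
    (thetaShift_notMem_lattice j) (two_mul_thetaShift_mem_lattice j) hf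
    (fun z => thetaEven_neg j z τ)
  rw [thetaEven_zero_right] at hne hderiv₂ hderiv₄
  refine ⟨hne, hderiv₂, ?_⟩
  rw [hderiv₄, hg₂, mul_div_cancel_left₀ _ two_ne_zero]

/-! ### Partial derivatives -/

/-- `f` is differentiable at `x` and `∂f/∂xⱼ (x) = d`. Unlike `HasLineDerivAt`, this asks for total
differentiability, which makes it stable under composition. -/
def HasPartialAt {n : ℕ} (f : (Fin n → ℂ) → ℂ) (j : Fin n) (d : ℂ) (x : Fin n → ℂ) : Prop :=
  DifferentiableAt ℂ f x ∧ partialAt f j x = d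

section Partial

variable {n : ℕ} {f g : (Fin n → ℂ) → ℂ} {j : Fin n} {d e : ℂ} {x : Fin n → ℂ}

theorem hasPartialAt_of_analyticAt (hf : AnalyticAt ℂ f x) (j : Fin n) :
    HasPartialAt f j (partialAt f j x) x := ⟨hf.differentiableAt, rfl⟩

theorem hasPartialAt_of_hasFDerivAt {f' : (Fin n → ℂ) →L[ℂ] ℂ} (hf : HasFDerivAt f f' x)
    (j : Fin n) : HasPartialAt f j (f' (Pi.single j 1)) x :=
  ⟨hf.differentiableAt, by rw [partialAt, hf.fderiv]⟩

theorem HasPartialAt.congr_value (hf : HasPartialAt f j d x) (h : d = e) : HasPartialAt f j e x :=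
  h ▸ hf

theorem HasPartialAt.congr (hf : HasPartialAt f j d x) (h : g =ᶠ[𝓝 x] f) : HasPartialAt g j d x :=
  ⟨hf.1.congr_of_eventuallyEq h, by rw [partialAt, h.fderiv_eq]; exact hf.2⟩

theorem HasPartialAt.congr_on {U : Set (Fin n → ℂ)} (hU : IsOpen U) (hx : x ∈ U)
    (hf : HasPartialAt f j d x) (h : ∀ y ∈ U, g y = f y) : HasPartialAt g j d x :=
  hf.congr (mem_of_superset (hU.mem_nhds hx) h)

theorem HasPartialAt.comp {h : ℂ → ℂ} (hh : HasDerivAt h e (f x)) (hf : HasPartialAt f j d x) :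
    HasPartialAt (fun y => h (f y)) j (e * d) x :=
  (hasPartialAt_of_hasFDerivAt (hh.comp_hasFDerivAt x hf.1.hasFDerivAt) j).congr_value
    (congrArg (e * ·) hf.2)

theorem HasPartialAt.comp_prodMk {G : ℂ × ℂ → ℂ} {G' : ℂ × ℂ →L[ℂ] ℂ}
    (hG : HasFDerivAt G G' (f x, g x)) (hf : HasPartialAt f j d x) (hg : HasPartialAt g j e x) :
    HasPartialAt (fun y => G (f y, g y)) j (G' (d, e)) x :=
  (hasPartialAt_of_hasFDerivAt
    (hG.comp x (hf.1.hasFDerivAt.prodMk hg.1.hasFDerivAt)) j).congr_value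
    (congrArg G' (Prod.ext hf.2 hg.2))

theorem hasPartialAt_const (c : ℂ) (j : Fin n) (x : Fin n → ℂ) :
    HasPartialAt (fun _ => c) j 0 x :=
  hasPartialAt_of_hasFDerivAt (hasFDerivAt_const c x) j

theorem HasPartialAt.add (hf : HasPartialAt f j d x) (hg : HasPartialAt g j e x) :
    HasPartialAt (fun y => f y + g y) j (d + e) x :=
  (hasPartialAt_of_hasFDerivAt (hf.1.hasFDerivAt.fun_add hg.1.hasFDerivAt) j).congr_value
    (congrArg₂ (· + ·) hf.2 hg.2)

theorem HasPartialAt.mul (hf : HasPartialAt f j d x) (hg : HasPartialAt g j e x) :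
    HasPartialAt (fun y => f y * g y) j (d * g x + f x * e) x := by
  refine (hasPartialAt_of_hasFDerivAt (hf.1.hasFDerivAt.fun_mul hg.1.hasFDerivAt) j).congr_value ?_
  rw [← hf.2, ← hg.2]
  simp only [partialAt, add_apply, FunLike.coe_smul, Pi.smul_apply, smul_eq_mul]
  ring

theorem HasPartialAt.const_mul (hf : HasPartialAt f j d x) (c : ℂ) :
    HasPartialAt (fun y => c * f y) j (c * d) x :=
  ((hasPartialAt_const c j x).mul hf).congr_value (by ring)

theorem HasPartialAt.sq (hf : HasPartialAt f j d x) :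
    HasPartialAt (fun y => f y ^ 2) j (2 * f x * d) x := by
  simp only [pow_two]
  exact (hf.mul hf).congr_value (by ring)

theorem HasPartialAt.inv (hf : HasPartialAt f j d x) (h0 : f x ≠ 0) :
    HasPartialAt (fun y => (f y)⁻¹) j (-d / f x ^ 2) x :=
  (HasPartialAt.comp (hasDerivAt_inv h0) hf).congr_value (by ring)

theorem analyticAt_coord (i : Fin n) (x : Fin n → ℂ) :
    AnalyticAt ℂ (fun y : Fin n → ℂ => y i) x :=
  (ContinuousLinearMap.proj (R := ℂ) (φ := fun _ : Fin n => ℂ) i).analyticAt x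

theorem hasPartialAt_coord (i j : Fin n) (x : Fin n → ℂ) :
    HasPartialAt (fun y => y i) j (if j = i then 1 else 0) x :=
  (hasPartialAt_of_hasFDerivAt
    (ContinuousLinearMap.proj (R := ℂ) (φ := fun _ : Fin n => ℂ) i).hasFDerivAt j).congr_value
    (by simp [Pi.single_apply, eq_comm])

theorem HasPartialAt.comp_coord {h : ℂ → ℂ} (i : Fin n) (hh : HasDerivAt h d (x i)) (j : Fin n) :
    HasPartialAt (fun y => h (y i)) j (if j = i then d else 0) x :=
  (HasPartialAt.comp hh (hasPartialAt_coord i j x)).congr_value (by simp)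

theorem HasPartialAt.hasDerivAt_update (hf : HasPartialAt f j d x) :
    HasDerivAt (fun s => f (Function.update x j s)) d (x j) := by
  have hfd : HasFDerivAt f (fderiv ℂ f x) (Function.update x j (x j)) := by
    rw [Function.update_eq_self]
    exact hf.1.hasFDerivAt
  exact (hfd.comp_hasDerivAt (x j) (_root_.hasDerivAt_update x j (x j))).congr_deriv hf.2

theorem analyticAt_partialAt (hf : AnalyticAt ℂ f x) (j : Fin n) :
    AnalyticAt ℂ (partialAt f j) x :=
  ((ContinuousLinearMap.apply ℂ ℂ (Pi.single j 1 : Fin n → ℂ)).analyticAt _).comp hf.fderiv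

theorem partialAt_partialAt (hf : AnalyticAt ℂ f x) (i j : Fin n) :
    partialAt (partialAt f i) j x =
      fderiv ℂ (fderiv ℂ f) x (Pi.single j 1) (Pi.single i 1) :=
  (hasPartialAt_of_hasFDerivAt ((ContinuousLinearMap.apply ℂ ℂ
    (Pi.single i 1 : Fin n → ℂ)).hasFDerivAt.comp x hf.fderiv.differentiableAt.hasFDerivAt) j).2

theorem partialAt_comm (hf : AnalyticAt ℂ f x) (i j : Fin n) :
    partialAt (partialAt f i) j x = partialAt (partialAt f j) i x := by
  rw [partialAt_partialAt hf, partialAt_partialAt hf]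
  exact (hf.contDiffAt (n := 2)).isSymmSndFDerivAt (by simp) _ _

end Partial

theorem isOpen_planeTimesUpper : IsOpen planeTimesUpper :=
  isOpen_lt continuous_const (Complex.continuous_im.comp (continuous_apply 1))

theorem analyticOnNhd_iterate_partialAt_zero {F : (Fin 2 → ℂ) → ℂ} {U : Set (Fin 2 → ℂ)}
    (hF : AnalyticOnNhd ℂ F U) (k : ℕ) :
    AnalyticOnNhd ℂ ((fun G => partialAt G 0)^[k] F) U := by
  induction k with
  | zero => exact hF
  | succ k ih =>
    rw [Function.iterate_succ_apply']
    exact fun x hx => analyticAt_partialAt (ih x hx) 0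

theorem iterate_partialAt_zero_eq {F : (Fin 2 → ℂ) → ℂ} (hF : AnalyticOnNhd ℂ F planeTimesUpper)
    (k : ℕ) {z τ : ℂ} (hτ : 0 < τ.im) :
    (fun G => partialAt G 0)^[k] F ![z, τ] = deriv^[k] (fun w => F ![w, τ]) z := by
  have hupdate : ∀ z s : ℂ, Function.update ![z, τ] 0 s = ![s, τ] := fun z s => by
    ext i; fin_cases i <;> rfl
  induction k generalizing z with
  | zero => rfl
  | succ k ih =>
    have hx : ![z, τ] ∈ planeTimesUpper := hτ
    have hpartial := (hasPartialAt_of_analyticAt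
      (analyticOnNhd_iterate_partialAt_zero hF k _ hx) 0).hasDerivAt_update
    simp only [hupdate, ih] at hpartial
    rw [Function.iterate_succ_apply', Function.iterate_succ_apply']
    exact hpartial.deriv.symm

/-! ### The heat equation -/

/-- The heat equation `δF = π⁻² ∂²F/∂z²`, in the normalization of the theta functions at
`π z / 2`, for functions holomorphic on `ℂ × ℍ`. -/
def SatisfiesHeat (F : (Fin 2 → ℂ) → ℂ) : Prop :=
  AnalyticOnNhd ℂ F planeTimesUpper ∧ ∀ x ∈ planeTimesUpper,
    partialAt F 1 x = -I / π * partialAt (partialAt F 0) 0 x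

theorem SatisfiesHeat.partialAt_zero {F : (Fin 2 → ℂ) → ℂ} (hF : SatisfiesHeat F) :
    SatisfiesHeat (partialAt F 0) := by
  have h0 : AnalyticOnNhd ℂ (partialAt F 0) planeTimesUpper := fun x hx =>
    analyticAt_partialAt (hF.1 x hx) 0
  refine ⟨h0, fun x hx => ?_⟩
  rw [partialAt_comm (hF.1 x hx)]
  exact (((hasPartialAt_of_analyticAt (analyticAt_partialAt (h0 x hx) 0) 0).const_mul _).congr_on
    isOpen_planeTimesUpper hx hF.2).2

theorem SatisfiesHeat.hasDerivAt {F : (Fin 2 → ℂ) → ℂ} (hF : SatisfiesHeat F) (z : ℂ) {τ : ℂ}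
    (hτ : 0 < τ.im) :
    HasDerivAt (fun s => F ![z, s]) (-I / π * partialAt (partialAt F 0) 0 ![z, τ]) τ := by
  have hx : ![z, τ] ∈ planeTimesUpper := hτ
  have hpartial := (hasPartialAt_of_analyticAt (hF.1 _ hx) 1).hasDerivAt_update
  have hupdate : ∀ s, Function.update ![z, τ] 1 s = ![z, s] := fun s => by
    ext i; fin_cases i <;> rfl
  rw [hF.2 _ hx] at hpartial
  simp only [hupdate] at hpartial
  exact hpartial

section ThetaTranslate

/-- The Gaussian factor `C exp(π i (ε z / 2 + ε² τ / 4))` of a translated theta series. -/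
noncomputable def thetaTranslateFactor (C ε : ℂ) (x : Fin 2 → ℂ) : ℂ :=
  C * exp (π * I * (ε * x 0 / 2 + ε ^ 2 * x 1 / 4))

/-- The argument `z / 2 + ε τ / 2 + b` of a translated theta series. -/
noncomputable def thetaTranslateArg (ε b : ℂ) (x : Fin 2 → ℂ) : ℂ := x 0 / 2 + ε * x 1 / 2 + b

/-- The theta series at `z / 2`, translated by `ε τ / 2 + b` and multiplied by the Gaussian factor
that keeps it a solution of the heat equation. All four theta functions at `π z / 2` have this
form. -/
noncomputable def thetaTranslate (C ε b : ℂ) (x : Fin 2 → ℂ) : ℂ :=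
  thetaTranslateFactor C ε x * jacobiTheta₂ (thetaTranslateArg ε b x) (x 1)

variable (C ε b : ℂ) (x : Fin 2 → ℂ)

theorem hasPartialAt_thetaTranslateFactor (j : Fin 2) :
    HasPartialAt (thetaTranslateFactor C ε) j
      (π * I * ![ε / 2, ε ^ 2 / 4] j * thetaTranslateFactor C ε x) x := by
  have hexponent := ((((hasPartialAt_coord 0 j x).const_mul (ε / 2)).add
    ((hasPartialAt_coord 1 j x).const_mul (ε ^ 2 / 4))).const_mul (π * I))
  refine (((HasPartialAt.comp (Complex.hasDerivAt_exp _) hexponent).const_mul C).congr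
    (.of_forall fun y => ?_)).congr_value ?_
  · rw [thetaTranslateFactor]; congr 2; ring
  · rw [thetaTranslateFactor, show ∀ u v : ℂ, u * x 0 / 2 + v * x 1 / 4 =
      u / 2 * x 0 + v / 4 * x 1 by intros; ring]
    fin_cases j <;> simp <;> ring

theorem hasPartialAt_thetaTranslateArg (j : Fin 2) :
    HasPartialAt (thetaTranslateArg ε b) j (![1 / 2, ε / 2] j) x := by
  refine (((((hasPartialAt_coord 0 j x).const_mul (1 / 2)).add
    ((hasPartialAt_coord 1 j x).const_mul (ε / 2))).add (hasPartialAt_const b j x)).congr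
    (.of_forall fun y => ?_)).congr_value ?_
  · rw [thetaTranslateArg]; ring
  · fin_cases j <;> simp

variable {x}

theorem analyticAt_jacobiTheta₂' (z : ℂ) {τ : ℂ} (hτ : 0 < τ.im) :
    AnalyticAt ℂ (fun p : ℂ × ℂ => jacobiTheta₂' p.1 p.2) (z, τ) := by
  refine (((ContinuousLinearMap.apply ℂ ℂ ((1, 0) : ℂ × ℂ)).analyticAt _).comp
    (analyticAt_jacobiTheta₂ z hτ).fderiv).congr ?_
  filter_upwards [(isOpen_lt continuous_const
    (Complex.continuous_im.comp continuous_snd)).mem_nhds hτ] with p hp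
  rw [← jacobiTheta₂_fderiv_apply_fst p.1 hp, ← (hasFDerivAt_jacobiTheta₂ p.1 hp).fderiv]
  rfl

theorem hasPartialAt_jacobiTheta₂_zero (hx : x ∈ planeTimesUpper) :
    HasPartialAt (fun y => jacobiTheta₂ (thetaTranslateArg ε b y) (y 1)) 0
      (1 / 2 * jacobiTheta₂' (thetaTranslateArg ε b x) (x 1)) x := by
  refine (HasPartialAt.comp_prodMk (g := (· 1))
    (hasFDerivAt_jacobiTheta₂ (thetaTranslateArg ε b x) hx)
    (hasPartialAt_thetaTranslateArg ε b x 0) (hasPartialAt_coord 1 0 x)).congr_value ?_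
  rw [← jacobiTheta₂_fderiv_apply_fst _ hx, ← smul_eq_mul, ← map_smul]
  simp

theorem hasPartialAt_jacobiTheta₂_one (hx : x ∈ planeTimesUpper) :
    HasPartialAt (fun y => jacobiTheta₂ (thetaTranslateArg ε b y) (y 1)) 1
      (ε / 2 * jacobiTheta₂' (thetaTranslateArg ε b x) (x 1) +
        -I / (4 * π) * deriv (jacobiTheta₂' · (x 1)) (thetaTranslateArg ε b x)) x := by
  refine (HasPartialAt.comp_prodMk (g := (· 1))
    (hasFDerivAt_jacobiTheta₂ (thetaTranslateArg ε b x) hx)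
    (hasPartialAt_thetaTranslateArg ε b x 1) (hasPartialAt_coord 1 1 x)).congr_value ?_
  rw [← jacobiTheta₂_fderiv_apply_fst _ hx, ← jacobiTheta₂_fderiv_apply_snd _ hx, ← smul_eq_mul,
    ← map_smul, ← map_add]
  simp

theorem hasPartialAt_jacobiTheta₂'_zero (hx : x ∈ planeTimesUpper) :
    HasPartialAt (fun y => jacobiTheta₂' (thetaTranslateArg ε b y) (y 1)) 0
      (1 / 2 * deriv (jacobiTheta₂' · (x 1)) (thetaTranslateArg ε b x)) x := by
  have hfderiv := (analyticAt_jacobiTheta₂' (thetaTranslateArg ε b x)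
    hx).differentiableAt.hasFDerivAt
  have hslice := HasFDerivAt.comp_hasDerivAt (f := fun u : ℂ => (u, x 1)) _ hfderiv
    ((hasDerivAt_id' (thetaTranslateArg ε b x)).prodMk (hasDerivAt_const _ (x 1)))
  refine (HasPartialAt.comp_prodMk hfderiv
    (hasPartialAt_thetaTranslateArg ε b x 0) (hasPartialAt_coord 1 0 x)).congr_value ?_
  rw [show deriv (jacobiTheta₂' · (x 1)) (thetaTranslateArg ε b x) = _ from hslice.deriv,
    ← smul_eq_mul, ← map_smul]
  simp

theorem hasPartialAt_thetaTranslate_zero (hx : x ∈ planeTimesUpper) :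
    HasPartialAt (thetaTranslate C ε b) 0 (thetaTranslateFactor C ε x *
      (π * I * (ε / 2) * jacobiTheta₂ (thetaTranslateArg ε b x) (x 1) +
        1 / 2 * jacobiTheta₂' (thetaTranslateArg ε b x) (x 1))) x :=
  ((hasPartialAt_thetaTranslateFactor C ε x 0).mul
    (hasPartialAt_jacobiTheta₂_zero ε b hx)).congr_value (by simp; ring)

theorem hasPartialAt_partialAt_thetaTranslate (hx : x ∈ planeTimesUpper) :
    HasPartialAt (partialAt (thetaTranslate C ε b) 0) 0 (thetaTranslateFactor C ε x *
      ((π * I * (ε / 2)) ^ 2 * jacobiTheta₂ (thetaTranslateArg ε b x) (x 1) +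
        π * I * (ε / 2) * jacobiTheta₂' (thetaTranslateArg ε b x) (x 1) +
        1 / 4 * deriv (jacobiTheta₂' · (x 1)) (thetaTranslateArg ε b x))) x :=
  (((hasPartialAt_thetaTranslateFactor C ε x 0).mul
    (((hasPartialAt_jacobiTheta₂_zero ε b hx).const_mul (π * I * (ε / 2))).add
      ((hasPartialAt_jacobiTheta₂'_zero ε b hx).const_mul (1 / 2)))).congr_on
    isOpen_planeTimesUpper hx
    fun y hy => (hasPartialAt_thetaTranslate_zero C ε b hy).2).congr_value (by simp; ring)

theorem hasPartialAt_thetaTranslate_one (hx : x ∈ planeTimesUpper) :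
    HasPartialAt (thetaTranslate C ε b) 1 (thetaTranslateFactor C ε x *
      (π * I * (ε ^ 2 / 4) * jacobiTheta₂ (thetaTranslateArg ε b x) (x 1) +
        ε / 2 * jacobiTheta₂' (thetaTranslateArg ε b x) (x 1) +
        -I / (4 * π) * deriv (jacobiTheta₂' · (x 1)) (thetaTranslateArg ε b x))) x :=
  ((hasPartialAt_thetaTranslateFactor C ε x 1).mul
    (hasPartialAt_jacobiTheta₂_one ε b hx)).congr_value (by simp; ring)

theorem analyticOnNhd_thetaTranslate :
    AnalyticOnNhd ℂ (thetaTranslate C ε b) planeTimesUpper := fun x hx => by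
  have hz := analyticAt_coord 0 x
  have hτ := analyticAt_coord 1 x
  have harg : AnalyticAt ℂ (thetaTranslateArg ε b) x :=
    ((hz.fun_div analyticAt_const two_ne_zero).fun_add
      ((analyticAt_const.fun_mul hτ).fun_div analyticAt_const two_ne_zero)).fun_add analyticAt_const
  have hfactor : AnalyticAt ℂ (thetaTranslateFactor C ε) x :=
    analyticAt_const.fun_mul (analyticAt_const.fun_mul
      (((analyticAt_const.fun_mul hz).fun_div analyticAt_const two_ne_zero).fun_add
        ((analyticAt_const.fun_mul hτ).fun_div analyticAt_const
          (by norm_num : (4 : ℂ) ≠ 0)))).cexp'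
  exact hfactor.fun_mul (AnalyticAt.fun_comp (g := fun p : ℂ × ℂ => jacobiTheta₂ p.1 p.2)
    (f := fun y => (thetaTranslateArg ε b y, y 1)) (analyticAt_jacobiTheta₂ _ hx) (harg.prod hτ))

theorem satisfiesHeat_thetaTranslate : SatisfiesHeat (thetaTranslate C ε b) := by
  refine ⟨analyticOnNhd_thetaTranslate C ε b, fun x hx => ?_⟩
  have hpi : (π : ℂ) ≠ 0 := by exact_mod_cast Real.pi_ne_zero
  rw [(hasPartialAt_thetaTranslate_one C ε b hx).2,
    (hasPartialAt_partialAt_thetaTranslate C ε b hx).2]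
  field_simp
  linear_combination thetaTranslateFactor C ε x *
    (4 * π ^ 2 * ε ^ 2 * I * jacobiTheta₂ (thetaTranslateArg ε b x) (x 1) +
      8 * π * ε * jacobiTheta₂' (thetaTranslateArg ε b x) (x 1)) * Complex.I_sq

end ThetaTranslate

theorem thetaOneTilde_eq_thetaTranslate (x : Fin 2 → ℂ) :
    thetaOneTilde (x 0) (x 1) = thetaTranslate (-I) 1 (1 / 2) x := by
  simp only [thetaOneTilde_eq_jacobiTheta₂, thetaTranslate, thetaTranslateFactor,
    thetaTranslateArg, one_mul, one_pow]

theorem exists_thetaEven_eq_thetaTranslate (j : Fin 3) : ∃ C ε b : ℂ, ∀ x : Fin 2 → ℂ,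
    thetaEven j (x 0) (x 1) = thetaTranslate C ε b x := by
  match j with
  | 0 =>
    refine ⟨-I * exp (π * I / 2), 1, 1, fun x => ?_⟩
    rw [thetaEven_zero_eq, thetaOneTilde_eq_jacobiTheta₂, thetaTranslate, thetaTranslateFactor,
      thetaTranslateArg, mul_assoc (-I) (exp (π * I / 2)), ← Complex.exp_add]
    congr 2
    · congr 2; ring
    · ring
  | 1 =>
    exact ⟨1, 0, 0, fun x => by
      simp [thetaEven_one_eq, thetaTranslate, thetaTranslateFactor, thetaTranslateArg]⟩
  | 2 =>
    exact ⟨1, 0, 1 / 2, fun x => by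
      simp [thetaEven_two_eq, thetaTranslate, thetaTranslateFactor, thetaTranslateArg]⟩

theorem satisfiesHeat_thetaOneTilde :
    SatisfiesHeat fun x : Fin 2 → ℂ => thetaOneTilde (x 0) (x 1) := by
  rw [funext thetaOneTilde_eq_thetaTranslate]
  exact satisfiesHeat_thetaTranslate _ _ _

theorem satisfiesHeat_thetaEven (j : Fin 3) :
    SatisfiesHeat fun x : Fin 2 → ℂ => thetaEven j (x 0) (x 1) := by
  obtain ⟨C, ε, b, h⟩ := exists_thetaEven_eq_thetaTranslate j
  rw [funext h]
  exact satisfiesHeat_thetaTranslate _ _ _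

/-! ### Differential equations of the thetanulls -/

theorem hasDerivAt_thetaNull_heat (j : Fin 3) {τ : ℂ} (hτ : 0 < τ.im) :
    HasDerivAt (thetaNull j) (-I / π * deriv^[2] (fun z => thetaEven j z τ) 0) τ := by
  have hF := satisfiesHeat_thetaEven j
  refine (hF.hasDerivAt 0 hτ).congr_of_eventuallyEq
    (.of_forall fun s => (thetaEven_zero_right j s).symm) |>.congr_deriv ?_
  exact congrArg (-I / π * ·) (iterate_partialAt_zero_eq hF.1 2 hτ)

theorem hasDerivAt_deriv_thetaNull (j : Fin 3) {τ : ℂ} (hτ : 0 < τ.im) :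
    HasDerivAt (deriv (thetaNull j))
      ((-I / π) ^ 2 * deriv^[4] (fun z => thetaEven j z τ) 0) τ := by
  have hF := satisfiesHeat_thetaEven j
  refine ((hF.partialAt_zero.partialAt_zero.hasDerivAt 0 hτ).const_mul
    (-I / π)).congr_of_eventuallyEq ?_ |>.congr_deriv ?_
  · filter_upwards [(isOpen_lt continuous_const Complex.continuous_im).mem_nhds hτ] with s hs
    rw [(hasDerivAt_thetaNull_heat j hs).deriv]
    exact congrArg (-I / π * ·) (iterate_partialAt_zero_eq hF.1 2 hs).symm
  · rw [pow_two, mul_assoc]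
    exact congrArg (fun u => -I / π * (-I / π * u)) (iterate_partialAt_zero_eq hF.1 4 hτ)

/-- The logarithmic derivative `δϑⱼ / ϑⱼ` of a thetanull. -/
noncomputable def thetaLogDelta (j : Fin 3) (τ : ℂ) : ℂ :=
  deltaDeriv (thetaNull j) τ / thetaNull j τ

/-- The mean of the three logarithmic derivatives `δϑⱼ / ϑⱼ`; it equals `E₂ / 12`. -/
noncomputable def thetaLogMean (τ : ℂ) : ℂ :=
  (thetaLogDelta 0 τ + thetaLogDelta 1 τ + thetaLogDelta 2 τ) / 3

/-- The expression for `δ²ϑⱼ / ϑⱼ` in terms of the `δϑₖ / ϑₖ`. -/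
noncomputable def thetaLogSecondDelta (j : Fin 3) (τ : ℂ) : ℂ :=
  3 * thetaLogDelta j τ ^ 2 - 6 * (thetaLogDelta j τ - thetaLogMean τ) ^ 2 +
    ((thetaLogDelta 0 τ - thetaLogMean τ) ^ 2 + (thetaLogDelta 1 τ - thetaLogMean τ) ^ 2 +
      (thetaLogDelta 2 τ - thetaLogMean τ) ^ 2)

/-- The coefficient `c` in `ϑ₁' / ϑ₁ = ζ + c z`, where `ϑ₁` is taken at `π z / 2`. -/
noncomputable def zetaCorrection (τ : ℂ) : ℂ := -(π ^ 2 * thetaLogMean τ)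

/-- By the heat equation, `δϑⱼ / ϑⱼ = π⁻² (e j - c)` where `e 0 + e 1 + e 2 = 0`; taking the mean
gives `c`, and then each `e j`. -/
theorem thetaNull_system (τ : UpperHalfPlane) :
    (∀ z ∉ (halfPeriodPair τ).lattice,
      logDeriv (thetaOneTilde · τ) z = zetaTau z τ + zetaCorrection τ * z) ∧
    ∀ j, thetaNull j τ ≠ 0 ∧
      deltaDeriv (deltaDeriv (thetaNull j)) τ = thetaLogSecondDelta j τ * thetaNull j τ := by
  obtain ⟨c, e, hc, he, h⟩ := exists_thetaEven_taylor τ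
  have hpi : (π : ℂ) ≠ 0 := by exact_mod_cast Real.pi_ne_zero
  have hI := Complex.I_ne_zero
  have hej : ∀ j, e j = c + π ^ 2 * thetaLogDelta j τ := fun j => by
    obtain ⟨hne, htwo, -⟩ := h j
    rw [thetaLogDelta, deltaDeriv, (hasDerivAt_thetaNull_heat j τ.im_pos).deriv, htwo]
    field_simp
    ring
  have hcorrection : c = zetaCorrection τ := by
    rw [hej 0, hej 1, hej 2] at he
    rw [zetaCorrection, thetaLogMean]
    linear_combination he / 3
  refine ⟨hcorrection ▸ hc, fun j => ⟨(h j).1, ?_⟩⟩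
  have hδδ : deltaDeriv (deltaDeriv (thetaNull j)) τ =
      1 / (π * I) * (1 / (π * I) * deriv (deriv (thetaNull j)) τ) :=
    congrArg (1 / (π * I) * ·)
      ((hasDerivAt_deriv_thetaNull j τ.im_pos).differentiableAt.hasDerivAt.const_mul _).deriv
  rw [hδδ, (hasDerivAt_deriv_thetaNull j τ.im_pos).deriv, (h j).2.2, hej j, hej 0, hej 1, hej 2,
    hcorrection, zetaCorrection, thetaLogSecondDelta]
  field_simp
  ring

theorem logDeriv_thetaOneTilde_eq {τ : UpperHalfPlane} {z : ℂ}
    (hz : z ∉ (halfPeriodPair τ).lattice) :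
    logDeriv (thetaOneTilde · τ) z = zetaTau z τ + zetaCorrection τ * z :=
  (thetaNull_system τ).1 z hz

section Thetanulls

variable (j : Fin 3) {τ : ℂ} (hτ : 0 < τ.im)
include hτ

theorem thetaNull_ne_zero : thetaNull j τ ≠ 0 :=
  ((thetaNull_system ⟨τ, hτ⟩).2 j).1

theorem deltaDeriv_deltaDeriv_thetaNull :
    deltaDeriv (deltaDeriv (thetaNull j)) τ = thetaLogSecondDelta j τ * thetaNull j τ :=
  ((thetaNull_system ⟨τ, hτ⟩).2 j).2

omit hτ in
theorem hasDerivAt_deltaDeriv {f : ℂ → ℂ} (hf : DifferentiableAt ℂ f τ) :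
    HasDerivAt f (π * I * deltaDeriv f τ) τ := by
  refine hf.hasDerivAt.congr_deriv ?_
  have hpi : (π : ℂ) ≠ 0 := by exact_mod_cast Real.pi_ne_zero
  have hI := Complex.I_ne_zero
  rw [deltaDeriv]
  field_simp

omit hτ in
theorem analyticAt_deltaDeriv {f : ℂ → ℂ} (hf : AnalyticAt ℂ f τ) :
    AnalyticAt ℂ (deltaDeriv f) τ :=
  analyticAt_const.fun_mul hf.deriv

theorem analyticAt_thetaNull : AnalyticAt ℂ (thetaNull j) τ :=
  DifferentiableOn.analyticAt (s := {s : ℂ | 0 < s.im})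
    (fun _ hs => (hasDerivAt_thetaNull_heat j hs).differentiableAt.differentiableWithinAt)
    ((isOpen_lt continuous_const Complex.continuous_im).mem_nhds hτ)

theorem hasDerivAt_thetaNull : HasDerivAt (thetaNull j) (π * I * deltaDeriv (thetaNull j) τ) τ :=
  hasDerivAt_deltaDeriv (analyticAt_thetaNull j hτ).differentiableAt

theorem hasDerivAt_deltaDeriv_thetaNull : HasDerivAt (deltaDeriv (thetaNull j))
    (π * I * (thetaLogSecondDelta j τ * thetaNull j τ)) τ := by
  rw [← deltaDeriv_deltaDeriv_thetaNull j hτ]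
  exact hasDerivAt_deltaDeriv (analyticAt_deltaDeriv (analyticAt_thetaNull j hτ)).differentiableAt

theorem analyticAt_thetaLogDelta : AnalyticAt ℂ (thetaLogDelta j) τ :=
  (analyticAt_deltaDeriv (analyticAt_thetaNull j hτ)).fun_div (analyticAt_thetaNull j hτ)
    (thetaNull_ne_zero j hτ)

omit j in
theorem analyticAt_thetaLogMean : AnalyticAt ℂ thetaLogMean τ :=
  (((analyticAt_thetaLogDelta 0 hτ).fun_add (analyticAt_thetaLogDelta 1 hτ)).fun_add
    (analyticAt_thetaLogDelta 2 hτ)).fun_div analyticAt_const three_ne_zero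

theorem deltaDeriv_thetaLogDelta :
    deltaDeriv (thetaLogDelta j) τ = thetaLogSecondDelta j τ - thetaLogDelta j τ ^ 2 := by
  have hne := thetaNull_ne_zero j hτ
  have hpi : (π : ℂ) ≠ 0 := by exact_mod_cast Real.pi_ne_zero
  have hI := Complex.I_ne_zero
  have hquot := (hasDerivAt_deltaDeriv_thetaNull j hτ).fun_div (hasDerivAt_thetaNull j hτ) hne
  rw [deltaDeriv, show deriv (thetaLogDelta j) τ = _ from hquot.deriv, thetaLogDelta]
  field_simp

omit j in
theorem deltaDeriv_thetaLogMean :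
    deltaDeriv thetaLogMean τ = ((thetaLogSecondDelta 0 τ - thetaLogDelta 0 τ ^ 2) +
      (thetaLogSecondDelta 1 τ - thetaLogDelta 1 τ ^ 2) +
      (thetaLogSecondDelta 2 τ - thetaLogDelta 2 τ ^ 2)) / 3 := by
  have hlog : ∀ j, HasDerivAt (thetaLogDelta j) (deriv (thetaLogDelta j) τ) τ := fun j =>
    (analyticAt_thetaLogDelta j hτ).differentiableAt.hasDerivAt
  rw [← deltaDeriv_thetaLogDelta 0 hτ, ← deltaDeriv_thetaLogDelta 1 hτ,
    ← deltaDeriv_thetaLogDelta 2 hτ, deltaDeriv, show deriv thetaLogMean τ = _ from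
    ((((hlog 0).fun_add (hlog 1)).fun_add (hlog 2)).div_const 3).deriv]
  simp only [deltaDeriv]
  ring

end Thetanulls

/-! ### The two-variable system of `ϑ₁` and `ζ` -/

/-- The points of `ℂ × ℍ` where `ϑ₁(π z / 2; τ)` does not vanish. -/
def thetaRegular : Set (Fin 2 → ℂ) :=
  {x | x ∈ planeTimesUpper ∧ thetaOneTilde (x 0) (x 1) ≠ 0}

theorem isOpen_thetaRegular : IsOpen thetaRegular :=
  ContinuousOn.isOpen_inter_preimage
    (f := fun x : Fin 2 → ℂ => thetaOneTilde (x 0) (x 1))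
    (fun x hx => (satisfiesHeat_thetaOneTilde.1 x hx).continuousAt.continuousWithinAt)
    isOpen_planeTimesUpper isOpen_compl_singleton

theorem coe_ofComplex_of_mem {x : Fin 2 → ℂ} (hx : x ∈ planeTimesUpper) :
    (UpperHalfPlane.ofComplex (x 1) : ℂ) = x 1 := by
  rw [UpperHalfPlane.ofComplex_apply_of_im_pos hx]

theorem mem_thetaRegular_iff {x : Fin 2 → ℂ} : x ∈ thetaRegular ↔
    x ∈ planeTimesUpper ∧ x 0 ∉ (halfPeriodPair (UpperHalfPlane.ofComplex (x 1))).lattice := by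
  refine and_congr_right fun hx => ?_
  rw [← thetaOneTilde_eq_zero_iff, coe_ofComplex_of_mem hx]

theorem analyticAt_zetaCorrection {τ : ℂ} (hτ : 0 < τ.im) : AnalyticAt ℂ zetaCorrection τ :=
  (analyticAt_const.fun_mul (analyticAt_thetaLogMean hτ)).neg

theorem hasPartialAt_zetaCorrection_zero {x : Fin 2 → ℂ} (hx : x ∈ planeTimesUpper) :
    HasPartialAt (fun x => zetaCorrection (x 1)) 0 0 x :=
  HasPartialAt.comp_coord 1 (analyticAt_zetaCorrection hx).differentiableAt.hasDerivAt 0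

theorem hasPartialAt_zetaCorrection_one {x : Fin 2 → ℂ} (hx : x ∈ planeTimesUpper) :
    HasPartialAt (fun x => zetaCorrection (x 1)) 1
      (-(π ^ 2 * (π * I * deltaDeriv thetaLogMean (x 1)))) x :=
  HasPartialAt.comp_coord 1 ((hasDerivAt_deltaDeriv
    (analyticAt_thetaLogMean hx).differentiableAt).const_mul _).fun_neg 1

theorem hasPartialAt_deltaDeriv_thetaLogMean_zero {x : Fin 2 → ℂ} (hx : x ∈ planeTimesUpper) :
    HasPartialAt (fun x => deltaDeriv thetaLogMean (x 1)) 0 0 x :=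
  HasPartialAt.comp_coord 1
    (analyticAt_deltaDeriv (analyticAt_thetaLogMean hx)).differentiableAt.hasDerivAt 0

theorem partialAt_zero_thetaOneTilde {x : Fin 2 → ℂ} (hx : x ∈ thetaRegular) :
    partialAt (fun x => thetaOneTilde (x 0) (x 1)) 0 x =
      thetaOneTilde (x 0) (x 1) * (onPlane zetaTau x + zetaCorrection (x 1) * x 0) := by
  have hlog := logDeriv_thetaOneTilde_eq (mem_thetaRegular_iff.1 hx).2
  have hderiv :=
    (hasPartialAt_of_analyticAt (satisfiesHeat_thetaOneTilde.1 x hx.1) 0).hasDerivAt_update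
  simp only [Function.update_self, Function.update_of_ne (show (1 : Fin 2) ≠ 0 by decide)]
    at hderiv
  rw [coe_ofComplex_of_mem hx.1, logDeriv_apply, hderiv.deriv, div_eq_iff hx.2] at hlog
  rw [hlog, mul_comm, onPlane]

theorem analyticOnNhd_onPlane_zetaTau : AnalyticOnNhd ℂ (onPlane zetaTau) thetaRegular := by
  intro x hx
  have htheta := satisfiesHeat_thetaOneTilde.1 x hx.1
  have hcorrection : AnalyticAt ℂ (fun x : Fin 2 → ℂ => zetaCorrection (x 1)) x :=
    AnalyticAt.fun_comp (f := fun x : Fin 2 → ℂ => x 1) (analyticAt_zetaCorrection hx.1)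
      (analyticAt_coord 1 x)
  refine (((analyticAt_partialAt htheta 0).fun_div htheta hx.2).fun_sub
    (hcorrection.fun_mul (analyticAt_coord 0 x))).congr ?_
  filter_upwards [isOpen_thetaRegular.mem_nhds hx] with y hy
  rw [partialAt_zero_thetaOneTilde hy, mul_div_cancel_left₀ _ hy.2, add_sub_cancel_right]

/-- The iterated `z`-derivatives of `ζ` as functions of two variables. -/
noncomputable def zetaIter (k : ℕ) : (Fin 2 → ℂ) → ℂ :=
  onPlane fun z τ => iteratedDeriv k (fun w => zetaTau w τ) z

theorem zetaIter_zero : zetaIter 0 = onPlane zetaTau := by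
  funext x
  simp only [zetaIter, onPlane, iteratedDeriv_zero]

theorem partialAt_zero_zetaIter {k : ℕ} {x : Fin 2 → ℂ} (h : AnalyticAt ℂ (zetaIter k) x) :
    partialAt (zetaIter k) 0 x = zetaIter (k + 1) x := by
  rw [← (hasPartialAt_of_analyticAt h 0).hasDerivAt_update.deriv]
  simp only [zetaIter, onPlane, iteratedDeriv_succ, Function.update_self,
    Function.update_of_ne (show (1 : Fin 2) ≠ 0 by decide)]

theorem analyticOnNhd_zetaIter (k : ℕ) : AnalyticOnNhd ℂ (zetaIter k) thetaRegular := by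
  induction k with
  | zero => exact zetaIter_zero ▸ analyticOnNhd_onPlane_zetaTau
  | succ k ih =>
    intro x hx
    refine (analyticAt_partialAt (ih x hx) 0).congr ?_
    filter_upwards [isOpen_thetaRegular.mem_nhds hx] with y hy
      using partialAt_zero_zetaIter (ih y hy)

theorem iteratedDeriv_succ_eq_of_hasDerivAt {U : Set ℂ} (hU : IsOpen U) {k : ℕ}
    {f g g' : ℂ → ℂ} (hf : ∀ z ∈ U, iteratedDeriv k f z = g z)
    (hg : ∀ z ∈ U, HasDerivAt g (g' z) z) : ∀ z ∈ U, iteratedDeriv (k + 1) f z = g' z :=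
  fun z hz => by
    rw [iteratedDeriv_succ]
    exact ((hg z hz).congr_of_eventuallyEq (mem_of_superset (hU.mem_nhds hz) hf)).deriv

section WeierstrassZeta

variable (L : PeriodPair) {z : ℂ}

theorem iteratedDeriv_one_weierstrassZeta (hz : z ∉ L.lattice) :
    iteratedDeriv 1 (weierstrassZeta L) z = -L.weierstrassP z :=
  iteratedDeriv_succ_eq_of_hasDerivAt L.isClosed_lattice.isOpen_compl (k := 0)
    (fun _ _ => by rw [iteratedDeriv_zero])
    (fun _ hw => hasDerivAt_weierstrassZeta L hw) z hz

theorem iteratedDeriv_two_weierstrassZeta (hz : z ∉ L.lattice) :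
    iteratedDeriv 2 (weierstrassZeta L) z = -L.derivWeierstrassP z :=
  iteratedDeriv_succ_eq_of_hasDerivAt L.isClosed_lattice.isOpen_compl
    (fun _ hw => iteratedDeriv_one_weierstrassZeta L hw)
    (fun _ hw => (hasDerivAt_weierstrassP L hw).fun_neg) z hz

theorem iteratedDeriv_three_weierstrassZeta (hz : z ∉ L.lattice) :
    iteratedDeriv 3 (weierstrassZeta L) z = -(6 * L.weierstrassP z ^ 2 - L.g₂ / 2) :=
  iteratedDeriv_succ_eq_of_hasDerivAt L.isClosed_lattice.isOpen_compl
    (fun _ hw => iteratedDeriv_two_weierstrassZeta L hw)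
    (fun _ hw => (hasDerivAt_derivWeierstrassP L hw).fun_neg) z hz

theorem iteratedDeriv_four_weierstrassZeta (hz : z ∉ L.lattice) :
    iteratedDeriv 4 (weierstrassZeta L) z =
      -12 * (iteratedDeriv 1 (weierstrassZeta L) z * iteratedDeriv 2 (weierstrassZeta L) z) := by
  rw [iteratedDeriv_succ_eq_of_hasDerivAt L.isClosed_lattice.isOpen_compl
    (fun _ hw => iteratedDeriv_three_weierstrassZeta L hw)
    (fun _ hw => ((((hasDerivAt_weierstrassP L hw).fun_pow 2).const_mul 6).sub_const
      (L.g₂ / 2)).fun_neg) z hz, iteratedDeriv_one_weierstrassZeta L hz,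
    iteratedDeriv_two_weierstrassZeta L hz]
  push_cast
  ring

end WeierstrassZeta

/-- `ζ + c z`, the logarithmic derivative of `ϑ₁`. -/
noncomputable def thetaLogDeriv (x : Fin 2 → ℂ) : ℂ := zetaIter 0 x + zetaCorrection (x 1) * x 0

/-- The expression for `∂ζ/∂τ`. -/
noncomputable def zetaTauDeriv (x : Fin 2 → ℂ) : ℂ :=
  -I / π * (2 * (thetaLogDeriv x * (zetaIter 1 x + zetaCorrection (x 1))) + zetaIter 2 x) +
    π ^ 2 * (π * I * deltaDeriv thetaLogMean (x 1)) * x 0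

/-- The expression for `∂²ζ/∂τ∂z`. -/
noncomputable def zetaTauDeriv₁ (x : Fin 2 → ℂ) : ℂ :=
  -I / π * (2 * ((zetaIter 1 x + zetaCorrection (x 1)) ^ 2 + thetaLogDeriv x * zetaIter 2 x) +
    zetaIter 3 x) + π ^ 2 * (π * I * deltaDeriv thetaLogMean (x 1))

/-- The expression for `∂³ζ/∂τ∂z²`. -/
noncomputable def zetaTauDeriv₂ (x : Fin 2 → ℂ) : ℂ :=
  -I / π * (6 * ((zetaIter 1 x + zetaCorrection (x 1)) * zetaIter 2 x) +
    2 * (thetaLogDeriv x * zetaIter 3 x) + -12 * (zetaIter 1 x * zetaIter 2 x))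

/-- The expression for `∂⁴ζ/∂τ∂z³`. -/
noncomputable def zetaTauDeriv₃ (x : Fin 2 → ℂ) : ℂ :=
  -I / π * (6 * zetaIter 2 x ^ 2 + 8 * ((zetaIter 1 x + zetaCorrection (x 1)) * zetaIter 3 x) +
    -24 * (thetaLogDeriv x * (zetaIter 1 x * zetaIter 2 x)) +
    -12 * (zetaIter 2 x ^ 2 + zetaIter 1 x * zetaIter 3 x))

section ThetaRegular

variable {x : Fin 2 → ℂ} (hx : x ∈ thetaRegular)
include hx

theorem zetaIter_one : zetaIter 1 x = -onPlane wpTau x :=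
  iteratedDeriv_one_weierstrassZeta _ (mem_thetaRegular_iff.1 hx).2

theorem zetaIter_four : zetaIter 4 x = -12 * (zetaIter 1 x * zetaIter 2 x) :=
  iteratedDeriv_four_weierstrassZeta _ (mem_thetaRegular_iff.1 hx).2

theorem hasPartialAt_zetaIter_zero (k : ℕ) : HasPartialAt (zetaIter k) 0 (zetaIter (k + 1) x) x :=
  (hasPartialAt_of_analyticAt (analyticOnNhd_zetaIter k x hx) 0).congr_value
    (partialAt_zero_zetaIter (analyticOnNhd_zetaIter k x hx))

theorem hasPartialAt_zetaIter_three_zero :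
    HasPartialAt (zetaIter 3) 0 (-12 * (zetaIter 1 x * zetaIter 2 x)) x :=
  (hasPartialAt_zetaIter_zero hx 3).congr_value (zetaIter_four hx)

theorem hasPartialAt_zetaIter_one_add_zetaCorrection_zero :
    HasPartialAt (fun x => zetaIter 1 x + zetaCorrection (x 1)) 0 (zetaIter 2 x) x :=
  ((hasPartialAt_zetaIter_zero hx 1).add
    (hasPartialAt_zetaCorrection_zero hx.1)).congr_value (add_zero _)

theorem hasPartialAt_thetaLogDeriv_zero :
    HasPartialAt thetaLogDeriv 0 (zetaIter 1 x + zetaCorrection (x 1)) x :=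
  ((hasPartialAt_zetaIter_zero hx 0).add
    ((hasPartialAt_zetaCorrection_zero hx.1).mul (hasPartialAt_coord 0 0 x))).congr_value (by simp)

theorem hasPartialAt_thetaLogDeriv_one :
    HasPartialAt thetaLogDeriv 1 (partialAt (zetaIter 0) 1 x -
      π ^ 2 * (π * I * deltaDeriv thetaLogMean (x 1)) * x 0) x :=
  ((hasPartialAt_of_analyticAt (analyticOnNhd_zetaIter 0 x hx) 1).add
    ((hasPartialAt_zetaCorrection_one hx.1).mul (hasPartialAt_coord 0 1 x))).congr_value
      (by simp; ring)

theorem hasPartialAt_thetaOneTilde_zero :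
    HasPartialAt (fun x => thetaOneTilde (x 0) (x 1)) 0
      (thetaOneTilde (x 0) (x 1) * thetaLogDeriv x) x :=
  (hasPartialAt_of_analyticAt (satisfiesHeat_thetaOneTilde.1 x hx.1) 0).congr_value (by
    rw [partialAt_zero_thetaOneTilde hx, thetaLogDeriv, zetaIter_zero])

theorem hasPartialAt_thetaOneTilde_one :
    HasPartialAt (fun x => thetaOneTilde (x 0) (x 1)) 1
      (-I / π * (thetaOneTilde (x 0) (x 1) *
        (thetaLogDeriv x ^ 2 + (zetaIter 1 x + zetaCorrection (x 1))))) x := by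
  have hzz := ((hasPartialAt_thetaOneTilde_zero hx).mul
    (hasPartialAt_thetaLogDeriv_zero hx)).congr_on isOpen_thetaRegular hx
      fun y hy => (hasPartialAt_thetaOneTilde_zero hy).2
  refine (hasPartialAt_of_analyticAt (satisfiesHeat_thetaOneTilde.1 x hx.1) 1).congr_value ?_
  rw [satisfiesHeat_thetaOneTilde.2 x hx.1, hzz.2]
  ring

/-- Compare the two mixed second derivatives of `ϑ₁`: one contains `∂ζ/∂τ`, the other does not. -/
theorem hasPartialAt_zetaIter_zero_one : HasPartialAt (zetaIter 0) 1 (zetaTauDeriv x) x := by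
  have hzτ := ((hasPartialAt_thetaOneTilde_one hx).mul
    (hasPartialAt_thetaLogDeriv_one hx)).congr_on isOpen_thetaRegular hx
      fun y hy => (hasPartialAt_thetaOneTilde_zero hy).2
  have hτz := (((hasPartialAt_thetaOneTilde_zero hx).mul
    ((hasPartialAt_thetaLogDeriv_zero hx).sq.add
      (hasPartialAt_zetaIter_one_add_zetaCorrection_zero hx))).const_mul (-I / π)).congr_on
        isOpen_thetaRegular hx fun y hy => (hasPartialAt_thetaOneTilde_one hy).2
  have hmixed := hzτ.2
  rw [partialAt_comm (satisfiesHeat_thetaOneTilde.1 x hx.1), hτz.2] at hmixed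
  refine (hasPartialAt_of_analyticAt (analyticOnNhd_zetaIter 0 x hx) 1).congr_value
    (mul_left_cancel₀ hx.2 ?_)
  rw [zetaTauDeriv]
  linear_combination -hmixed

theorem hasPartialAt_zetaIter_succ_one {k : ℕ} {E : (Fin 2 → ℂ) → ℂ} {d : ℂ}
    (hE : ∀ y ∈ thetaRegular, HasPartialAt (zetaIter k) 1 (E y) y) (hd : HasPartialAt E 0 d x) :
    HasPartialAt (zetaIter (k + 1)) 1 d x := by
  have hzeta := analyticOnNhd_zetaIter k
  have hzτ := (hasPartialAt_of_analyticAt (analyticAt_partialAt (hzeta x hx) 0) 1).congr_on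
    isOpen_thetaRegular hx fun y hy => (partialAt_zero_zetaIter (hzeta y hy)).symm
  refine hzτ.congr_value ?_
  rw [partialAt_comm (hzeta x hx)]
  exact (hd.congr_on isOpen_thetaRegular hx fun y hy => (hE y hy).2).2

theorem hasPartialAt_zetaIter_one_one : HasPartialAt (zetaIter 1) 1 (zetaTauDeriv₁ x) x := by
  refine hasPartialAt_zetaIter_succ_one hx (fun y hy => hasPartialAt_zetaIter_zero_one hy)
    ((((((hasPartialAt_thetaLogDeriv_zero hx).mul
      (hasPartialAt_zetaIter_one_add_zetaCorrection_zero hx)).const_mul 2).add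
        (hasPartialAt_zetaIter_zero hx 2)).const_mul (-I / π)).add
    (((hasPartialAt_deltaDeriv_thetaLogMean_zero hx.1).const_mul (π * I)
      |>.const_mul (π ^ 2)).mul (hasPartialAt_coord 0 0 x)) |>.congr_value ?_)
  rw [zetaTauDeriv₁, if_pos rfl]
  ring

theorem hasPartialAt_zetaIter_two_one : HasPartialAt (zetaIter 2) 1 (zetaTauDeriv₂ x) x := by
  refine hasPartialAt_zetaIter_succ_one hx (fun y hy => hasPartialAt_zetaIter_one_one hy)
    (((((hasPartialAt_zetaIter_one_add_zetaCorrection_zero hx).sq.add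
      ((hasPartialAt_thetaLogDeriv_zero hx).mul (hasPartialAt_zetaIter_zero hx 2))).const_mul
        2).add (hasPartialAt_zetaIter_three_zero hx)).const_mul (-I / π) |>.add
    ((hasPartialAt_deltaDeriv_thetaLogMean_zero hx.1).const_mul (π * I)
      |>.const_mul (π ^ 2)) |>.congr_value ?_)
  rw [zetaTauDeriv₂]
  ring

theorem hasPartialAt_zetaIter_three_one : HasPartialAt (zetaIter 3) 1 (zetaTauDeriv₃ x) x := by
  have hone := hasPartialAt_zetaIter_zero hx 1
  have htwo := hasPartialAt_zetaIter_zero hx 2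
  refine hasPartialAt_zetaIter_succ_one hx (fun y hy => hasPartialAt_zetaIter_two_one hy)
    (((((hasPartialAt_zetaIter_one_add_zetaCorrection_zero hx).mul htwo).const_mul 6).add
      (((hasPartialAt_thetaLogDeriv_zero hx).mul
        (hasPartialAt_zetaIter_three_zero hx)).const_mul 2)).add
    ((hone.mul htwo).const_mul (-12)) |>.const_mul (-I / π) |>.congr_value ?_)
  rw [zetaTauDeriv₃]
  ring

end ThetaRegular

/-! ### Polynomial and rational expressions in a chain -/

section Expressions

variable {n ℓ : ℕ} {U : Set (Fin n → ℂ)} {φ : Fin ℓ → (Fin n → ℂ) → ℂ} {f g : (Fin n → ℂ) → ℂ}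
  (P Q : MvPolynomial (Fin n ⊕ Fin ℓ) ℂ)

theorem evalChain_C (φ : Fin ℓ → (Fin n → ℂ) → ℂ) (c : ℂ) :
    evalChain (MvPolynomial.C c) φ = fun _ => c :=
  funext fun _ => MvPolynomial.eval_C c

theorem evalChain_X_inl (φ : Fin ℓ → (Fin n → ℂ) → ℂ) (i : Fin n) :
    evalChain (MvPolynomial.X (Sum.inl i)) φ = fun x => x i :=
  funext fun _ => MvPolynomial.eval_X _

theorem evalChain_X_inr (φ : Fin ℓ → (Fin n → ℂ) → ℂ) (i : Fin ℓ) :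
    evalChain (MvPolynomial.X (Sum.inr i)) φ = φ i :=
  funext fun _ => MvPolynomial.eval_X _

theorem evalChain_add : evalChain (P + Q) φ = fun x => evalChain P φ x + evalChain Q φ x :=
  funext fun _ => map_add _ P Q

theorem evalChain_mul : evalChain (P * Q) φ = fun x => evalChain P φ x * evalChain Q φ x :=
  funext fun _ => map_mul _ P Q

theorem evalChain_prod {ι : Type*} (s : Finset ι) (R : ι → MvPolynomial (Fin n ⊕ Fin ℓ) ℂ)
    (x : Fin n → ℂ) : evalChain (∏ i ∈ s, R i) φ x = ∏ i ∈ s, evalChain (R i) φ x :=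
  map_prod _ R s

theorem analyticOnNhd_evalChain (hφ : ∀ i, AnalyticOnNhd ℂ (φ i) U) :
    AnalyticOnNhd ℂ (evalChain P φ) U := by
  intro x hx
  induction P using MvPolynomial.induction_on with
  | C c => exact evalChain_C φ c ▸ analyticAt_const
  | add p q hp hq => exact evalChain_add p q ▸ hp.fun_add hq
  | mul_X p i hp =>
    rw [evalChain_mul]
    rcases i with i | i
    · exact hp.fun_mul (evalChain_X_inl φ i ▸ analyticAt_coord i x)
    · exact hp.fun_mul (evalChain_X_inr φ i ▸ hφ i x hx)

/-- `g` is a polynomial in `x, φ` on `U`. -/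
def PolyExpr (U : Set (Fin n → ℂ)) (φ : Fin ℓ → (Fin n → ℂ) → ℂ) (g : (Fin n → ℂ) → ℂ) : Prop :=
  ∃ P : MvPolynomial (Fin n ⊕ Fin ℓ) ℂ, ∀ x ∈ U, g x = evalChain P φ x

theorem polyExpr_const (c : ℂ) : PolyExpr U φ fun _ => c :=
  ⟨MvPolynomial.C c, fun _ _ => by rw [evalChain_C]⟩

theorem polyExpr_coord (i : Fin n) : PolyExpr U φ fun x => x i :=
  ⟨MvPolynomial.X (Sum.inl i), fun _ _ => by rw [evalChain_X_inl]⟩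

theorem polyExpr_chain (i : Fin ℓ) : PolyExpr U φ (φ i) :=
  ⟨MvPolynomial.X (Sum.inr i), fun _ _ => by rw [evalChain_X_inr]⟩

theorem PolyExpr.add (hf : PolyExpr U φ f) (hg : PolyExpr U φ g) :
    PolyExpr U φ fun x => f x + g x := by
  obtain ⟨P, hP⟩ := hf
  obtain ⟨Q, hQ⟩ := hg
  exact ⟨P + Q, fun x hx => by simp only [evalChain_add, hP x hx, hQ x hx]⟩

theorem PolyExpr.mul (hf : PolyExpr U φ f) (hg : PolyExpr U φ g) :
    PolyExpr U φ fun x => f x * g x := by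
  obtain ⟨P, hP⟩ := hf
  obtain ⟨Q, hQ⟩ := hg
  exact ⟨P * Q, fun x hx => by simp only [evalChain_mul, hP x hx, hQ x hx]⟩

theorem PolyExpr.congr (hf : PolyExpr U φ f) (h : ∀ x ∈ U, g x = f x) : PolyExpr U φ g := by
  obtain ⟨P, hP⟩ := hf
  exact ⟨P, fun x hx => (h x hx).trans (hP x hx)⟩

theorem PolyExpr.mono {V : Set (Fin n → ℂ)} (hf : PolyExpr U φ f) (hVU : V ⊆ U) :
    PolyExpr V φ f := by
  obtain ⟨P, hP⟩ := hf
  exact ⟨P, fun x hx => hP x (hVU hx)⟩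

theorem polyExpr_evalChain {m : ℕ} {χ : Fin m → (Fin n → ℂ) → ℂ}
    (P : MvPolynomial (Fin n ⊕ Fin m) ℂ) (h : ∀ i, PolyExpr U φ (χ i)) :
    PolyExpr U φ (evalChain P χ) := by
  induction P using MvPolynomial.induction_on with
  | C c => exact evalChain_C χ c ▸ polyExpr_const c
  | add p q hp hq => exact evalChain_add p q ▸ hp.add hq
  | mul_X p i hp =>
    rw [evalChain_mul]
    rcases i with i | i
    · exact hp.mul (evalChain_X_inl χ i ▸ polyExpr_coord i)
    · exact hp.mul (evalChain_X_inr χ i ▸ h i)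

/-- `g` is a quotient of two polynomials in `x, φ` on `U` whose denominator does not vanish on
`U`. -/
def RatExpr (U : Set (Fin n → ℂ)) (φ : Fin ℓ → (Fin n → ℂ) → ℂ) (g : (Fin n → ℂ) → ℂ) : Prop :=
  ∃ p q, PolyExpr U φ p ∧ PolyExpr U φ q ∧ ∀ x ∈ U, q x ≠ 0 ∧ g x = p x / q x

theorem PolyExpr.ratExpr (hf : PolyExpr U φ f) : RatExpr U φ f :=
  ⟨f, _, hf, polyExpr_const 1, fun _ _ => ⟨one_ne_zero, (div_one _).symm⟩⟩

theorem ratExpr_const (c : ℂ) : RatExpr U φ fun _ => c := (polyExpr_const c).ratExpr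

theorem ratExpr_coord (i : Fin n) : RatExpr U φ fun x => x i := (polyExpr_coord i).ratExpr

theorem RatExpr.congr (hf : RatExpr U φ f) (h : ∀ x ∈ U, g x = f x) : RatExpr U φ g := by
  obtain ⟨p, q, hp, hq, hpq⟩ := hf
  exact ⟨p, q, hp, hq, fun x hx => ⟨(hpq x hx).1, (h x hx).trans (hpq x hx).2⟩⟩

theorem RatExpr.add (hf : RatExpr U φ f) (hg : RatExpr U φ g) :
    RatExpr U φ fun x => f x + g x := by
  obtain ⟨p, q, hp, hq, hpq⟩ := hf
  obtain ⟨r, s, hr, hs, hrs⟩ := hg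
  refine ⟨_, _, (hp.mul hs).add (hq.mul hr), hq.mul hs, fun x hx => ?_⟩
  obtain ⟨hq0, hf⟩ := hpq x hx
  obtain ⟨hs0, hg⟩ := hrs x hx
  exact ⟨mul_ne_zero hq0 hs0, by simp only [hf, hg, div_add_div _ _ hq0 hs0]⟩

theorem RatExpr.mul (hf : RatExpr U φ f) (hg : RatExpr U φ g) :
    RatExpr U φ fun x => f x * g x := by
  obtain ⟨p, q, hp, hq, hpq⟩ := hf
  obtain ⟨r, s, hr, hs, hrs⟩ := hg
  refine ⟨_, _, hp.mul hr, hq.mul hs, fun x hx => ?_⟩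
  obtain ⟨hq0, hf⟩ := hpq x hx
  obtain ⟨hs0, hg⟩ := hrs x hx
  exact ⟨mul_ne_zero hq0 hs0, by simp only [hf, hg, div_mul_div_comm]⟩

theorem RatExpr.const_mul (c : ℂ) (hf : RatExpr U φ f) : RatExpr U φ fun x => c * f x :=
  (ratExpr_const c).mul hf

theorem RatExpr.neg (hf : RatExpr U φ f) : RatExpr U φ fun x => -f x :=
  (hf.const_mul (-1)).congr fun _ _ => by ring

theorem RatExpr.sub (hf : RatExpr U φ f) (hg : RatExpr U φ g) :
    RatExpr U φ fun x => f x - g x :=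
  (hf.add hg.neg).congr fun _ _ => by ring

theorem RatExpr.sq (hf : RatExpr U φ f) : RatExpr U φ fun x => f x ^ 2 :=
  (hf.mul hf).congr fun _ _ => by ring

theorem RatExpr.div (hf : RatExpr U φ f) (hg : RatExpr U φ g) (h0 : ∀ x ∈ U, g x ≠ 0) :
    RatExpr U φ fun x => f x / g x := by
  obtain ⟨p, q, hp, hq, hpq⟩ := hf
  obtain ⟨r, s, hr, hs, hrs⟩ := hg
  refine ⟨_, _, hp.mul hs, hq.mul hr, fun x hx => ?_⟩
  obtain ⟨hq0, hf⟩ := hpq x hx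
  have hg := (hrs x hx).2
  have hr0 : r x ≠ 0 := fun h => h0 x hx (by rw [hg, h, zero_div])
  exact ⟨mul_ne_zero hq0 hr0, by simp only [hf, hg, div_div_div_eq]⟩

theorem satisfiesRationalSystem_of_ratExpr (hU : IsOpen U) (hφ : ∀ i, AnalyticOnNhd ℂ (φ i) U)
    (h : ∀ i j, ∃ g, RatExpr U φ g ∧ ∀ x ∈ U, HasPartialAt (φ i) j (g x) x) :
    SatisfiesRationalSystem U φ := by
  choose g hg hpartial using h
  choose p q hp hq hpq using hg
  choose Q hQ using hp
  choose R hR using hq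
  refine ⟨hU, hφ, Q, R, fun i j x hx => ⟨hR i j x hx ▸ (hpq i j x hx).1, ?_⟩⟩
  rw [(hpartial i j x hx).2, (hpq i j x hx).2, hQ i j x hx, hR i j x hx]

/-! ### Rational systems without poles give Noetherian functions -/

theorem exists_hasPartialAt_evalChain {m : ℕ} {χ : Fin m → (Fin n → ℂ) → ℂ} {j : Fin n}
    (hχ : ∀ i, PolyExpr U φ (χ i)) (h : ∀ i, ∃ g, PolyExpr U φ g ∧
      ∀ x ∈ U, HasPartialAt (χ i) j (g x) x) (P : MvPolynomial (Fin n ⊕ Fin m) ℂ) :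
    ∃ g, PolyExpr U φ g ∧ ∀ x ∈ U, HasPartialAt (evalChain P χ) j (g x) x := by
  induction P using MvPolynomial.induction_on with
  | C c => exact ⟨_, polyExpr_const 0, fun x _ => evalChain_C χ c ▸ hasPartialAt_const c j x⟩
  | add p q hp hq =>
    obtain ⟨p', hp', hpderiv⟩ := hp
    obtain ⟨q', hq', hqderiv⟩ := hq
    exact ⟨_, hp'.add hq', fun x hx => evalChain_add p q ▸ (hpderiv x hx).add (hqderiv x hx)⟩
  | mul_X p i hp =>
    obtain ⟨p', hp', hpderiv⟩ := hp
    have hpoly := polyExpr_evalChain p hχ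
    rw [evalChain_mul]
    rcases i with i | i
    · rw [evalChain_X_inl]
      exact ⟨_, (hp'.mul (polyExpr_coord i)).add (hpoly.mul (polyExpr_const _)),
        fun x hx => (hpderiv x hx).mul (hasPartialAt_coord i j x)⟩
    · obtain ⟨χ', hχ', hχderiv⟩ := h i
      rw [evalChain_X_inr]
      exact ⟨_, (hp'.mul (hχ i)).add (hpoly.mul hχ'),
        fun x hx => (hpderiv x hx).mul (hχderiv x hx)⟩

theorem isNoetherianChain_of_polyExpr {Ω : Set (Fin n → ℂ)} (hΩ : IsRelCompactDomain U Ω)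
    (hφ : ∀ i, AnalyticOnNhd ℂ (φ i) U)
    (h : ∀ i j, ∃ g, PolyExpr U φ g ∧ ∀ x ∈ U, HasPartialAt (φ i) j (g x) x) :
    IsNoetherianChain Ω φ := by
  obtain ⟨hopen, hconn, hcompact, hsub⟩ := hΩ
  choose g hg hpartial using h
  choose P hP using hg
  refine ⟨hopen, hconn, hcompact.isBounded.subset subset_closure, fun i => (hφ i).mono hsub, P,
    fun i j x hx => ?_⟩
  have hxU := hsub (subset_closure hx)
  rw [(hpartial i j x hxU).2, hP i j x hxU]

theorem SatisfiesRationalSystem.exists_common_denominator (hφ : SatisfiesRationalSystem U φ) :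
    ∃ (N : Fin ℓ → Fin n → MvPolynomial (Fin n ⊕ Fin ℓ) ℂ) (D : MvPolynomial (Fin n ⊕ Fin ℓ) ℂ),
      ∀ x ∈ U, evalChain D φ x ≠ 0 ∧
        ∀ i j, partialAt (φ i) j x = evalChain (N i j) φ x / evalChain D φ x := by
  obtain ⟨-, -, Q, R, hQR⟩ := hφ
  refine ⟨fun i j => Q i j * ∏ p ∈ Finset.univ.erase (i, j), R p.1 p.2,
    ∏ p : Fin ℓ × Fin n, R p.1 p.2, fun x hx => ?_⟩
  have hR : ∀ p : Fin ℓ × Fin n, evalChain (R p.1 p.2) φ x ≠ 0 := fun p => (hQR p.1 p.2 x hx).1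
  simp only [evalChain_mul, evalChain_prod]
  refine ⟨Finset.prod_ne_zero_iff.2 fun p _ => hR p, fun i j => ?_⟩
  rw [(hQR i j x hx).2, ← Finset.prod_erase_mul Finset.univ _ (Finset.mem_univ (i, j)),
    mul_comm (∏ p ∈ Finset.univ.erase (i, j), evalChain (R p.1 p.2) φ x),
    mul_div_mul_right _ _ (Finset.prod_ne_zero_iff.2 fun p _ => hR p)]

/-- The chain `φ` preceded by the inverse of the polynomial `D` in `x, φ`. Adjoining the inverse of
a common denominator makes a rational system polynomial. -/
noncomputable def adjoinInv (D : MvPolynomial (Fin n ⊕ Fin ℓ) ℂ) (φ : Fin ℓ → (Fin n → ℂ) → ℂ) :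
    Fin (ℓ + 1) → (Fin n → ℂ) → ℂ :=
  Fin.cons (fun x => (evalChain D φ x)⁻¹) φ

theorem polyExpr_adjoinInv (D : MvPolynomial (Fin n ⊕ Fin ℓ) ℂ) (i : Fin ℓ) :
    PolyExpr U (adjoinInv D φ) (φ i) :=
  polyExpr_chain (φ := adjoinInv D φ) i.succ

theorem polyExpr_adjoinInv_inv (D : MvPolynomial (Fin n ⊕ Fin ℓ) ℂ) :
    PolyExpr U (adjoinInv D φ) fun x => (evalChain D φ x)⁻¹ :=
  polyExpr_chain (φ := adjoinInv D φ) 0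

theorem analyticOnNhd_adjoinInv {D : MvPolynomial (Fin n ⊕ Fin ℓ) ℂ}
    (hφ : ∀ i, AnalyticOnNhd ℂ (φ i) U) (hD : ∀ x ∈ U, evalChain D φ x ≠ 0) :
    ∀ i, AnalyticOnNhd ℂ (adjoinInv D φ i) U :=
  Fin.cases ((analyticOnNhd_evalChain D hφ).fun_inv hD) hφ

theorem exists_polyExpr_hasPartialAt_adjoinInv {D : MvPolynomial (Fin n ⊕ Fin ℓ) ℂ}
    (hD : ∀ x ∈ U, evalChain D φ x ≠ 0) {j : Fin n}
    (h : ∀ i, ∃ g, PolyExpr U (adjoinInv D φ) g ∧ ∀ x ∈ U, HasPartialAt (φ i) j (g x) x) :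
    ∀ i, ∃ g, PolyExpr U (adjoinInv D φ) g ∧ ∀ x ∈ U, HasPartialAt (adjoinInv D φ i) j (g x) x := by
  refine Fin.cases ?_ h
  obtain ⟨g, hg, hpartial⟩ := exists_hasPartialAt_evalChain (polyExpr_adjoinInv D) h D
  have hinv := polyExpr_adjoinInv_inv (U := U) (φ := φ) D
  refine ⟨_, ((polyExpr_const (-1)).mul hg).mul (hinv.mul hinv), fun x hx => ?_⟩
  exact ((hpartial x hx).inv (hD x hx)).congr_value (by ring)

theorem SatisfiesRationalSystem.isNoetherianFunction (hφ : SatisfiesRationalSystem U φ)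
    {Ω : Set (Fin n → ℂ)} (hΩ : IsRelCompactDomain U Ω) (hf : PolyExpr U φ f) :
    IsNoetherianFunction Ω f := by
  obtain ⟨N, D, hND⟩ := hφ.exists_common_denominator
  have hD : ∀ x ∈ U, evalChain D φ x ≠ 0 := fun x hx => (hND x hx).1
  have hpartial : ∀ j i, ∃ g, PolyExpr U (adjoinInv D φ) g ∧
      ∀ x ∈ U, HasPartialAt (φ i) j (g x) x := fun j i =>
    ⟨_, (polyExpr_evalChain (N i j) (polyExpr_adjoinInv D)).mul (polyExpr_adjoinInv_inv D),
      fun x hx => (hasPartialAt_of_analyticAt (hφ.2.1 i x hx) j).congr_value ((hND x hx).2 i j)⟩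
  obtain ⟨F, hF⟩ := hf
  obtain ⟨G, hG⟩ := ((polyExpr_evalChain F (polyExpr_adjoinInv D)).congr hF).mono
    (subset_closure.trans hΩ.2.2.2)
  exact ⟨ℓ + 1, adjoinInv D φ, G,
    isNoetherianChain_of_polyExpr hΩ (analyticOnNhd_adjoinInv hφ.2.1 hD)
      (fun i j => exists_polyExpr_hasPartialAt_adjoinInv hD (hpartial j) i), hG⟩

end Expressions

/-! ### The rational systems of the thetanulls and of `ζ` -/

section ThetaExpressions

variable {n ℓ : ℕ} {U : Set (Fin n → ℂ)} {φ : Fin ℓ → (Fin n → ℂ) → ℂ} {k : Fin n}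

theorem ratExpr_thetaLogMean (h : ∀ j, RatExpr U φ fun x => thetaLogDelta j (x k)) :
    RatExpr U φ fun x => thetaLogMean (x k) :=
  (((h 0).add (h 1)).add (h 2)).div (ratExpr_const 3) fun _ _ => three_ne_zero

theorem ratExpr_thetaLogSecondDelta (h : ∀ j, RatExpr U φ fun x => thetaLogDelta j (x k))
    (j : Fin 3) : RatExpr U φ fun x => thetaLogSecondDelta j (x k) := by
  have hmean := ratExpr_thetaLogMean h
  exact (((h j).sq.const_mul 3).sub (((h j).sub hmean).sq.const_mul 6)).add
    (((((h 0).sub hmean).sq).add (((h 1).sub hmean).sq)).add (((h 2).sub hmean).sq))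

variable (hU : ∀ x ∈ U, 0 < (x k).im)
include hU

theorem ratExpr_deltaDeriv_thetaLogMean (h : ∀ j, RatExpr U φ fun x => thetaLogDelta j (x k)) :
    RatExpr U φ fun x => deltaDeriv thetaLogMean (x k) := by
  have hsecond := ratExpr_thetaLogSecondDelta h
  exact (((((hsecond 0).sub (h 0).sq).add ((hsecond 1).sub (h 1).sq)).add
    ((hsecond 2).sub (h 2).sq)).div (ratExpr_const 3) fun _ _ => three_ne_zero).congr
      fun x hx => deltaDeriv_thetaLogMean (hU x hx)

variable (hδ : ∀ j, RatExpr U φ fun x => deltaDeriv (thetaNull j) (x k))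
include hδ

theorem exists_ratExpr_partial_thetaNull (i : Fin 3) (j : Fin n) :
    ∃ g, RatExpr U φ g ∧ ∀ x ∈ U, HasPartialAt (fun x => thetaNull i (x k)) j (g x) x :=
  ⟨_, (ratExpr_const (if j = k then 1 else 0)).mul ((hδ i).const_mul (π * I)), fun x hx =>
    (HasPartialAt.comp_coord k (hasDerivAt_thetaNull i (hU x hx)) j).congr_value (by simp)⟩

variable (hθ : ∀ j, RatExpr U φ fun x => thetaNull j (x k))
include hθ

theorem ratExpr_thetaLogDelta (j : Fin 3) : RatExpr U φ fun x => thetaLogDelta j (x k) :=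
  (hδ j).div (hθ j) fun x hx => thetaNull_ne_zero j (hU x hx)

theorem exists_ratExpr_partial_deltaDeriv_thetaNull (i : Fin 3) (j : Fin n) :
    ∃ g, RatExpr U φ g ∧
      ∀ x ∈ U, HasPartialAt (fun x => deltaDeriv (thetaNull i) (x k)) j (g x) x :=
  ⟨_, (ratExpr_const (if j = k then 1 else 0)).mul
    (((ratExpr_thetaLogSecondDelta (ratExpr_thetaLogDelta hU hδ hθ) i).mul (hθ i)).const_mul
      (π * I)), fun x hx =>
    (HasPartialAt.comp_coord k (hasDerivAt_deltaDeriv_thetaNull i (hU x hx)) j).congr_value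
      (by simp)⟩

end ThetaExpressions

section ThetaNullChain

/-- The chain `thetaNullChain`, evaluated at `τ = x k`. -/
noncomputable def thetaNullChainAt {n : ℕ} (k : Fin n) : Fin 6 → (Fin n → ℂ) → ℂ :=
  fun i x => thetaNullChain i fun _ => x k

theorem thetaNullChainAt_zero : thetaNullChainAt (0 : Fin 1) = thetaNullChain := by
  funext i x
  exact congrArg (thetaNullChain i) (funext fun a => congrArg x (Subsingleton.elim 0 a))

variable {n : ℕ} (k : Fin n) {U : Set (Fin n → ℂ)}

theorem polyExpr_thetaNull_thetaNullChainAt (j : Fin 3) :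
    PolyExpr U (thetaNullChainAt k) fun x => thetaNull j (x k) := by
  fin_cases j
  exacts [polyExpr_chain (φ := thetaNullChainAt k) 0, polyExpr_chain (φ := thetaNullChainAt k) 1,
    polyExpr_chain (φ := thetaNullChainAt k) 2]

theorem polyExpr_deltaDeriv_thetaNullChainAt (j : Fin 3) :
    PolyExpr U (thetaNullChainAt k) fun x => deltaDeriv (thetaNull j) (x k) := by
  fin_cases j
  exacts [polyExpr_chain (φ := thetaNullChainAt k) 3, polyExpr_chain (φ := thetaNullChainAt k) 4,
    polyExpr_chain (φ := thetaNullChainAt k) 5]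

theorem analyticAt_thetaNull_coord (j : Fin 3) {x : Fin n → ℂ} (hx : 0 < (x k).im) :
    AnalyticAt ℂ (fun x : Fin n → ℂ => thetaNull j (x k)) x :=
  AnalyticAt.fun_comp (f := fun x : Fin n → ℂ => x k) (analyticAt_thetaNull j hx)
    (analyticAt_coord k x)

theorem analyticAt_deltaDeriv_thetaNull_coord (j : Fin 3) {x : Fin n → ℂ} (hx : 0 < (x k).im) :
    AnalyticAt ℂ (fun x : Fin n → ℂ => deltaDeriv (thetaNull j) (x k)) x :=
  AnalyticAt.fun_comp (f := fun x : Fin n → ℂ => x k)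
    (analyticAt_deltaDeriv (analyticAt_thetaNull j hx)) (analyticAt_coord k x)

theorem satisfiesRationalSystem_thetaNullChainAt :
    SatisfiesRationalSystem {x : Fin n → ℂ | 0 < (x k).im} (thetaNullChainAt k) := by
  have hθ := fun j => (polyExpr_thetaNull_thetaNullChainAt k j
    (U := {x : Fin n → ℂ | 0 < (x k).im})).ratExpr
  have hδ := fun j => (polyExpr_deltaDeriv_thetaNullChainAt k j
    (U := {x : Fin n → ℂ | 0 < (x k).im})).ratExpr
  refine satisfiesRationalSystem_of_ratExpr
    (isOpen_lt continuous_const (Complex.continuous_im.comp (continuous_apply k)))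
    (fun i x hx => ?_) (fun i j => ?_)
  · have hθan := fun j => analyticAt_thetaNull_coord k j hx
    have hδan := fun j => analyticAt_deltaDeriv_thetaNull_coord k j hx
    fin_cases i
    exacts [hθan 0, hθan 1, hθan 2, hδan 0, hδan 1, hδan 2]
  · have hθ' := fun i => exists_ratExpr_partial_thetaNull (fun _ hx => hx) hδ i j
    have hδ' := fun i => exists_ratExpr_partial_deltaDeriv_thetaNull (fun _ hx => hx) hδ hθ i j
    fin_cases i
    exacts [hθ' 0, hθ' 1, hθ' 2, hδ' 0, hδ' 1, hδ' 2]

theorem isNoetherianFunction_thetaNull (hU : IsRelCompactDomain {x : Fin n → ℂ | 0 < (x k).im} U)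
    (j : Fin 3) : IsNoetherianFunction U fun x => thetaNull j (x k) :=
  (satisfiesRationalSystem_thetaNullChainAt k).isNoetherianFunction hU
    (polyExpr_thetaNull_thetaNullChainAt k j)

end ThetaNullChain

section ThetaZetaChain

variable {U : Set (Fin 2 → ℂ)}

theorem polyExpr_thetaNull_thetaZetaChain (j : Fin 3) :
    PolyExpr U thetaZetaChain fun x => thetaNull j (x 1) := by
  fin_cases j
  exacts [polyExpr_chain (φ := thetaZetaChain) 0, polyExpr_chain (φ := thetaZetaChain) 1,
    polyExpr_chain (φ := thetaZetaChain) 2]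

theorem polyExpr_deltaDeriv_thetaZetaChain (j : Fin 3) :
    PolyExpr U thetaZetaChain fun x => deltaDeriv (thetaNull j) (x 1) := by
  fin_cases j
  exacts [polyExpr_chain (φ := thetaZetaChain) 3, polyExpr_chain (φ := thetaZetaChain) 4,
    polyExpr_chain (φ := thetaZetaChain) 5]

theorem polyExpr_thetaOneTilde :
    PolyExpr U thetaZetaChain fun x => thetaOneTilde (x 0) (x 1) :=
  polyExpr_chain (φ := thetaZetaChain) 6

theorem polyExpr_onPlane_zetaTau : PolyExpr U thetaZetaChain (onPlane zetaTau) :=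
  polyExpr_chain (φ := thetaZetaChain) 7

theorem polyExpr_zetaIter {k : ℕ} (hk : k ≤ 3) : PolyExpr U thetaZetaChain (zetaIter k) := by
  interval_cases k
  exacts [zetaIter_zero ▸ polyExpr_onPlane_zetaTau, polyExpr_chain (φ := thetaZetaChain) 8,
    polyExpr_chain (φ := thetaZetaChain) 9, polyExpr_chain (φ := thetaZetaChain) 10]

theorem polyExpr_onPlane_wpTau : PolyExpr thetaRegular thetaZetaChain (onPlane wpTau) :=
  ((polyExpr_const (-1)).mul (polyExpr_zetaIter (k := 1) (by norm_num))).congr fun x hx => by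
    rw [zetaIter_one hx, neg_one_mul, neg_neg]

theorem ratExpr_zetaIter {k : ℕ} (hk : k ≤ 3) : RatExpr U thetaZetaChain (zetaIter k) :=
  (polyExpr_zetaIter hk).ratExpr

theorem ratExpr_thetaLogDelta_thetaZetaChain (j : Fin 3) :
    RatExpr thetaRegular thetaZetaChain fun x => thetaLogDelta j (x 1) :=
  ratExpr_thetaLogDelta (fun _ hx => hx.1)
    (fun i => (polyExpr_deltaDeriv_thetaZetaChain i).ratExpr)
    (fun i => (polyExpr_thetaNull_thetaZetaChain i).ratExpr) j

theorem ratExpr_deltaDeriv_thetaLogMean_thetaZetaChain :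
    RatExpr thetaRegular thetaZetaChain fun x =>
      π ^ 2 * (π * I * deltaDeriv thetaLogMean (x 1)) :=
  ((ratExpr_deltaDeriv_thetaLogMean (fun _ hx => hx.1)
    ratExpr_thetaLogDelta_thetaZetaChain).const_mul (π * I)).const_mul (π ^ 2)

theorem ratExpr_zetaCorrection :
    RatExpr thetaRegular thetaZetaChain fun x => zetaCorrection (x 1) :=
  ((ratExpr_thetaLogMean ratExpr_thetaLogDelta_thetaZetaChain).const_mul (π ^ 2)).neg

theorem ratExpr_zetaIter_one_add_zetaCorrection :
    RatExpr thetaRegular thetaZetaChain fun x => zetaIter 1 x + zetaCorrection (x 1) :=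
  (ratExpr_zetaIter (by norm_num)).add ratExpr_zetaCorrection

theorem ratExpr_thetaLogDeriv : RatExpr thetaRegular thetaZetaChain thetaLogDeriv :=
  (ratExpr_zetaIter (by norm_num)).add (ratExpr_zetaCorrection.mul (ratExpr_coord 0))

theorem ratExpr_zetaTauDeriv : RatExpr thetaRegular thetaZetaChain zetaTauDeriv :=
  ((((ratExpr_thetaLogDeriv.mul ratExpr_zetaIter_one_add_zetaCorrection).const_mul 2).add
    (ratExpr_zetaIter (by norm_num))).const_mul (-I / π)).add
      (ratExpr_deltaDeriv_thetaLogMean_thetaZetaChain.mul (ratExpr_coord 0))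

theorem ratExpr_zetaTauDeriv₁ : RatExpr thetaRegular thetaZetaChain zetaTauDeriv₁ :=
  (((ratExpr_zetaIter_one_add_zetaCorrection.sq.add
    (ratExpr_thetaLogDeriv.mul (ratExpr_zetaIter (by norm_num)))).const_mul 2).add
      (ratExpr_zetaIter (by norm_num))).const_mul (-I / π) |>.add
        ratExpr_deltaDeriv_thetaLogMean_thetaZetaChain

theorem ratExpr_zetaTauDeriv₂ : RatExpr thetaRegular thetaZetaChain zetaTauDeriv₂ := by
  have hone := ratExpr_zetaIter (U := thetaRegular) (k := 1) (by norm_num)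
  have htwo := ratExpr_zetaIter (U := thetaRegular) (k := 2) (by norm_num)
  have hthree := ratExpr_zetaIter (U := thetaRegular) (k := 3) (by norm_num)
  exact ((((ratExpr_zetaIter_one_add_zetaCorrection.mul htwo).const_mul 6).add
    ((ratExpr_thetaLogDeriv.mul hthree).const_mul 2)).add
      ((hone.mul htwo).const_mul (-12))).const_mul (-I / π)

theorem ratExpr_zetaTauDeriv₃ : RatExpr thetaRegular thetaZetaChain zetaTauDeriv₃ := by
  have hone := ratExpr_zetaIter (U := thetaRegular) (k := 1) (by norm_num)
  have htwo := ratExpr_zetaIter (U := thetaRegular) (k := 2) (by norm_num)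
  have hthree := ratExpr_zetaIter (U := thetaRegular) (k := 3) (by norm_num)
  exact ((((htwo.sq.const_mul 6).add
    ((ratExpr_zetaIter_one_add_zetaCorrection.mul hthree).const_mul 8)).add
      ((ratExpr_thetaLogDeriv.mul (hone.mul htwo)).const_mul (-24))).add
        ((htwo.sq.add (hone.mul hthree)).const_mul (-12))).const_mul (-I / π)

theorem exists_ratExpr_partial_thetaOneTilde (j : Fin 2) :
    ∃ g, RatExpr thetaRegular thetaZetaChain g ∧
      ∀ x ∈ thetaRegular, HasPartialAt (fun x => thetaOneTilde (x 0) (x 1)) j (g x) x := by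
  have htheta := (polyExpr_thetaOneTilde (U := thetaRegular)).ratExpr
  match j with
  | 0 => exact ⟨_, htheta.mul ratExpr_thetaLogDeriv,
      fun _ hx => hasPartialAt_thetaOneTilde_zero hx⟩
  | 1 => exact ⟨_, (htheta.mul (ratExpr_thetaLogDeriv.sq.add
      ratExpr_zetaIter_one_add_zetaCorrection)).const_mul (-I / π),
      fun _ hx => hasPartialAt_thetaOneTilde_one hx⟩

theorem exists_ratExpr_partial_zetaIter {k : ℕ} (hk : k ≤ 3) (j : Fin 2) :
    ∃ g, RatExpr thetaRegular thetaZetaChain g ∧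
      ∀ x ∈ thetaRegular, HasPartialAt (zetaIter k) j (g x) x := by
  match j with
  | 0 =>
    rcases hk.lt_or_eq with hk | rfl
    · exact ⟨_, ratExpr_zetaIter hk, fun _ hx => hasPartialAt_zetaIter_zero hx k⟩
    · exact ⟨_, ((ratExpr_zetaIter (by norm_num)).mul (ratExpr_zetaIter (by norm_num))).const_mul
        (-12), fun _ hx => hasPartialAt_zetaIter_three_zero hx⟩
  | 1 =>
    interval_cases k
    exacts [⟨_, ratExpr_zetaTauDeriv, fun _ hx => hasPartialAt_zetaIter_zero_one hx⟩,
      ⟨_, ratExpr_zetaTauDeriv₁, fun _ hx => hasPartialAt_zetaIter_one_one hx⟩,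
      ⟨_, ratExpr_zetaTauDeriv₂, fun _ hx => hasPartialAt_zetaIter_two_one hx⟩,
      ⟨_, ratExpr_zetaTauDeriv₃, fun _ hx => hasPartialAt_zetaIter_three_one hx⟩]

theorem analyticOnNhd_thetaZetaChain (i : Fin 11) :
    AnalyticOnNhd ℂ (thetaZetaChain i) thetaRegular := by
  intro x hx
  have hθ := fun j => analyticAt_thetaNull_coord 1 j hx.1
  have hδ := fun j => analyticAt_deltaDeriv_thetaNull_coord 1 j hx.1
  have hzeta := fun k => analyticOnNhd_zetaIter k x hx
  fin_cases i
  exacts [hθ 0, hθ 1, hθ 2, hδ 0, hδ 1, hδ 2, satisfiesHeat_thetaOneTilde.1 x hx.1,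
    analyticOnNhd_onPlane_zetaTau x hx, hzeta 1, hzeta 2, hzeta 3]

theorem satisfiesRationalSystem_thetaZetaChain :
    SatisfiesRationalSystem thetaRegular thetaZetaChain := by
  refine satisfiesRationalSystem_of_ratExpr isOpen_thetaRegular analyticOnNhd_thetaZetaChain
    fun i j => ?_
  have hδ := fun i => (polyExpr_deltaDeriv_thetaZetaChain (U := thetaRegular) i).ratExpr
  have hθ := fun i => (polyExpr_thetaNull_thetaZetaChain (U := thetaRegular) i).ratExpr
  have hθ' := fun i => exists_ratExpr_partial_thetaNull (fun _ hx => hx.1) hδ i j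
  have hδ' := fun i => exists_ratExpr_partial_deltaDeriv_thetaNull (fun _ hx => hx.1) hδ hθ i j
  have hzeta := fun k hk => exists_ratExpr_partial_zetaIter (k := k) hk j
  have hzeta₀ := zetaIter_zero ▸ hzeta 0 (by norm_num)
  fin_cases i
  exacts [hθ' 0, hθ' 1, hθ' 2, hδ' 0, hδ' 1, hδ' 2, exists_ratExpr_partial_thetaOneTilde j,
    hzeta₀, hzeta 1 (by norm_num), hzeta 2 (by norm_num), hzeta 3 le_rfl]

end ThetaZetaChain

/-! ### Polar loci -/

theorem meromorphicOrderAt_zetaTau_neg_iff (z : ℂ) (τ : UpperHalfPlane) :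
    meromorphicOrderAt (fun w => zetaTau w τ) z < 0 ↔ z ∈ (halfPeriodPair τ).lattice := by
  by_cases hz : z ∈ (halfPeriodPair τ).lattice
  · have horder : meromorphicOrderAt (fun w => zetaTau w τ) z = (-1 : ℤ) :=
      meromorphicOrderAt_weierstrassZeta (halfPeriodPair τ) hz
    exact iff_of_true (horder ▸ by decide) hz
  · have hanalytic : AnalyticAt ℂ (fun w => zetaTau w τ) z :=
      analyticAt_weierstrassZeta (halfPeriodPair τ) hz
    exact iff_of_false hanalytic.meromorphicOrderAt_nonneg.not_gt hz

theorem meromorphicOrderAt_wpTau_neg_iff (z : ℂ) (τ : UpperHalfPlane) :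
    meromorphicOrderAt (fun w => wpTau w τ) z < 0 ↔ z ∈ (halfPeriodPair τ).lattice := by
  by_cases hz : z ∈ (halfPeriodPair τ).lattice
  · have horder : meromorphicOrderAt (fun w => wpTau w τ) z = -2 :=
      (halfPeriodPair τ).order_weierstrassP z hz
    exact iff_of_true (horder ▸ by decide) hz
  · have hanalytic : AnalyticAt ℂ (fun w => wpTau w τ) z :=
      (halfPeriodPair τ).analyticOnNhd_weierstrassP z hz
    exact iff_of_false hanalytic.meromorphicOrderAt_nonneg.not_gt hz

theorem polarLocus_wpTau_eq_polarLocus_zetaTau : polarLocus wpTau = polarLocus zetaTau :=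
  Set.ext fun _ => and_congr_right fun _ => (meromorphicOrderAt_wpTau_neg_iff _ _).trans
    (meromorphicOrderAt_zetaTau_neg_iff _ _).symm

theorem polarLocus_zetaTau_eq_lattice : polarLocus zetaTau =
    {x | x ∈ planeTimesUpper ∧ ∃ m n : ℤ, x 0 = 2 * (m : ℂ) + 2 * (n : ℂ) * x 1} :=
  Set.ext fun x => and_congr_right fun hx => by
    rw [meromorphicOrderAt_zetaTau_neg_iff, mem_halfPeriodPair_lattice, coe_ofComplex_of_mem hx]

theorem polarLocus_zetaTau_eq_zeros_thetaOneTilde : polarLocus zetaTau =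
    {x | x ∈ planeTimesUpper ∧ thetaOneTilde (x 0) (x 1) = 0} :=
  Set.ext fun x => and_congr_right fun hx => by
    rw [meromorphicOrderAt_zetaTau_neg_iff, ← thetaOneTilde_eq_zero_iff, coe_ofComplex_of_mem hx]

theorem planeTimesUpper_diff_polarLocus_zetaTau :
    planeTimesUpper \ polarLocus zetaTau = thetaRegular := by
  rw [polarLocus_zetaTau_eq_zeros_thetaOneTilde]
  exact Set.ext fun x => and_congr_right fun hx => not_congr (and_iff_right hx)

theorem mainTheorem12 :
    -- `ζ` is the primitive of `-℘` normalised by `ζ(z;τ) - 1/z → 0` at `z = 0`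
    (∀ τ : UpperHalfPlane,
      (∀ z : ℂ, z ∉ (halfPeriodPair τ).lattice →
        HasDerivAt (fun w => zetaTau w τ) (-wpTau z τ) z) ∧
      Filter.Tendsto (fun z => zetaTau z τ - z⁻¹) (nhdsWithin 0 {0}ᶜ) (nhds 0)) ∧
    -- the polar locus of `ζ` is the zero locus of `ϑ₁(π z / 2;τ)`, is `z ∈ 2ℤ + 2τℤ`, and is
    -- the polar locus of `℘`
    polarLocus zetaTau = {x | x ∈ planeTimesUpper ∧ thetaOneTilde (x 0) (x 1) = 0} ∧
    polarLocus zetaTau =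
      {x | x ∈ planeTimesUpper ∧ ∃ m n : ℤ, x 0 = 2 * (m : ℂ) + 2 * (n : ℂ) * x 1} ∧
    polarLocus wpTau = polarLocus zetaTau ∧
    -- the rational Noetherian systems, without poles outside the polar locus of `ζ`
    SatisfiesRationalSystem {x : Fin 1 → ℂ | 0 < (x 0).im} thetaNullChain ∧
    SatisfiesRationalSystem (planeTimesUpper \ polarLocus zetaTau) thetaZetaChain ∧
    -- the thetanulls are Noetherian on relatively compact subdomains of `ℍ` and of `ℂ × ℍ`
    (∀ Ω : Set (Fin 1 → ℂ), IsRelCompactDomain {x | 0 < (x 0).im} Ω →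
      ∀ j, IsNoetherianFunction Ω fun x => thetaNull j (x 0)) ∧
    (∀ Ω : Set (Fin 2 → ℂ), IsRelCompactDomain planeTimesUpper Ω →
      ∀ j, IsNoetherianFunction Ω fun x => thetaNull j (x 1)) ∧
    -- the remaining functions are Noetherian on relatively compact domains off the polar locus
    (∀ Ω : Set (Fin 2 → ℂ), IsRelCompactDomain (planeTimesUpper \ polarLocus zetaTau) Ω →
      IsNoetherianFunction Ω (fun x => thetaOneTilde (x 0) (x 1)) ∧
      IsNoetherianFunction Ω (onPlane zetaTau) ∧
      IsNoetherianFunction Ω (onPlane wpTau)) := by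
  have hregular := planeTimesUpper_diff_polarLocus_zetaTau
  refine ⟨fun τ => ⟨fun z hz => hasDerivAt_weierstrassZeta (halfPeriodPair τ) hz,
      tendsto_weierstrassZeta_sub_inv (halfPeriodPair τ)⟩,
    polarLocus_zetaTau_eq_zeros_thetaOneTilde, polarLocus_zetaTau_eq_lattice,
    polarLocus_wpTau_eq_polarLocus_zetaTau,
    thetaNullChainAt_zero ▸ satisfiesRationalSystem_thetaNullChainAt 0,
    hregular ▸ satisfiesRationalSystem_thetaZetaChain,
    fun Ω hΩ j => isNoetherianFunction_thetaNull 0 hΩ j,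
    fun Ω hΩ j => isNoetherianFunction_thetaNull 1 hΩ j, fun Ω hΩ => ?_⟩
  rw [hregular] at hΩ
  have hnoetherian : ∀ {f}, PolyExpr thetaRegular thetaZetaChain f → IsNoetherianFunction Ω f :=
    satisfiesRationalSystem_thetaZetaChain.isNoetherianFunction hΩ
  exact ⟨hnoetherian polyExpr_thetaOneTilde, hnoetherian polyExpr_onPlane_zetaTau,
    hnoetherian polyExpr_onPlane_wpTau⟩
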